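/- **Setting.** Let $T>0$ and let $\mathfrak X$ be a zero-mean generalized Gaussian field over $L_2((0,T))$ on a probability space $(\Omega,\mathcal F,\mathbb P)$: an (a.s.) linear family of zero-mean, possibly degenerate, Gaussian random variables $\mathfrak X(f)$, $f\in L_2((0,T))$, with $\mathfrak X(f_n)\to\mathfrak X(f)$ in probability whenever $f_n\to f$. Put $X(t)=\mathfrak X(\mathbf 1_{[0,t]})$ for $t\in[0,T]$. Let $\mathcal F^X$ be the $\sigma$-algebra generated by the field, and $\mathbb H_X$ the space of square-integrable random variables that are $\mathcal F^X$-measurable up to null sets. Let $\{\xi_k\}$ be any orthonormal basis of the closed linear span of $\{\mathfrak X(f)\}$ in $L_2(\Omega)$ and, for finitely supported multi-indices $\alpha$, let $\xi_\alpha=\prod_k H_{\alpha_k}(\xi_k)/\sqrt{\alpha_k!}$ ($H_n$ the probabilists' Hermite polynomials). The Wick product $\diamond$ is determined by $\xi_\alpha\diamond\xi_\beta=\sqrt{(\alpha+\beta)!/(\alpha!\,\beta!)}\;\xi_{\alpha+\beta}$. For $\eta\in L_2((0,T);\mathbb H_X)$ with $\eta_\alpha(s)=\mathbb E(\eta(s)\xi_\alpha)$,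 the Itô–Skorokhod integral is $$\int_0^t\eta(s)\diamond dX(s)=\sum_\alpha \mathfrak X(\eta_\alpha\mathbf 1_{[0,t]})\diamond\xi_\alpha ,$$ a formal series in the $\xi_\gamma$ (each coefficient is a finite sum); an equation containing it requires that it be an element of $\mathbb H_X$. **Theorem.** (a) The equation $u(t)=1+\int_0^t u(s)\diamond dX(s)$, $t\in[0,T]$, has a solution in $L_2((0,T);\mathbb H_X)$, it is unique, and for every $t\in[0,T]$, almost surely, $$u(t)=e^{X(t)-\frac12\mathbb E X^2(t)}.$$ Moreover, a process in $L_2((0,T);\mathbb H_X)$ that satisfies the equation only for almost every $t$ is given by this formula for almost every $t$. (b) Let $a,\sigma\in\mathbb R$. A square-integrable solution of $$u(t,x)=u_0(x)+a\int_0^t u_{xx}(s,x)\,ds+\int_0^t\sigma u_x(s,x)\diamond dX(s),\qquad t\in[0,T],\ x\in\mathbb R,$$ with non-random $u_0\in L_2(\mathbb R)$ is a function $u$ in $L_2((0,T);L_2(\Omega;L_2(\mathbb R)))$ with every $u(t)$, $t\in[0,T]$, $\mathcal F^X$-measurable (up to null sets), such that the equation holds for every $t\in[0,T]$ in the sense of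 distributions in $x$. Call the equation well-posed in $L_2(\Omega;L_2(\mathbb R))$ for a class $D\subseteq L_2(\mathbb R)$ of initial conditions if for every $u_0\in D$ such a solution exists and is unique on $[0,T]$, and there is a constant $C$ with $(\mathbb E\|u(t)\|_{L_2(\mathbb R)}^2)^{1/2}\le C\|u_0\|_{L_2(\mathbb R)}$ for all $u_0\in D$, all solutions $u$ with $u(0,\cdot)=u_0$ and all $t\in[0,T]$. Then the following are equivalent: 1. for every smooth compactly supported $u_0$ there is a square-integrable solution; 2. the equation is well-posed for the class of smooth compactly supported $u_0$; 3. the equation is well-posed for $D=L_2(\mathbb R)$; 4. $at\ge\frac{\sigma^2}{2}\,\mathbb E X^2(t)$ for all $t\in[0,T]$. If these conditions hold, then for every $u_0\in L_2(\mathbb R)$ and $t\in[0,T]$, almost surely, $u(t,x)=\bar u(t,x+\sigma X(t))$ for almost every $x$, where $r(t)=at-\frac{\sigma^2}{2}\mathbb E X^2(t)$ and $$\bar u(t,x)=\frac1{\sqrt{4\pi r(t)}}\int_{\mathbb R}e^{-(x-y)^2/(4r(t))}u_0(y)\,dy\ \text{ if } r(t)>0,\qquad \bar u(t,x)=u_0(x)\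 \text{ if } r(t)=0 .$$ -/

import Mathlib

open MeasureTheory ProbabilityTheory Set Filter
open scoped ENNReal NNReal Topology SchwartzMap

noncomputable section

namespace GaussField

/-! ### Generalized Gaussian fields -/

/-- A zero-mean generalized Gaussian field over a normed space `H`: an (almost surely) linear
family of zero-mean Gaussian random variables indexed by `H`, continuous in probability.
Degenerate Gaussian variables are allowed. -/
structure IsZeroMeanGaussianField {Ω H : Type*} [MeasurableSpace Ω] [NormedAddCommGroup H]
    [NormedSpace ℝ H] (P : Measure Ω) (X : H → Ω → ℝ) : Prop where
  measurable : ∀ f, Measurable (X f)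
  linear : ∀ (α β : ℝ) (f g : H), X (α • f + β • g) =ᵐ[P] fun ω => α * X f ω + β * X g ω
  continuous : ∀ (f : ℕ → H) (g : H), Tendsto f atTop (𝓝 g) →
    TendstoInMeasure P (fun n => X (f n)) atTop (X g)
  gaussian : ∀ f, HasGaussianLaw (X f) P
  zero_mean : ∀ f, ∫ ω, X f ω ∂P = 0

/-- The sigma-algebra generated by the field. -/
abbrev fieldSigma {Ω H : Type*} (X : H → Ω → ℝ) : MeasurableSpace Ω :=
  ⨆ f, MeasurableSpace.comap (X f) inferInstance

section Chaos

variable {Ω H : Type*} [MeasurableSpace Ω]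

/-- The space of square-integrable `E`-valued random elements that are measurable (up to null
sets) with respect to the sigma-algebra generated by the field. -/
def chaosSpaceOf (E : Type*) [NormedAddCommGroup E] [NormedSpace ℝ E]
    (P : Measure Ω) (X : H → Ω → ℝ) : Submodule ℝ (Lp E 2 P) :=
  lpMeas E ℝ (fieldSigma X) 2 P

/-- The (closed) first chaos space, inside the square-integrable random variables. -/
def firstChaos (P : Measure Ω) (X : H → Ω → ℝ) : Submodule ℝ (Lp ℝ 2 P) :=
  (Submodule.span ℝ {ζ : Lp ℝ 2 P | ∃ f, ζ =ᵐ[P] X f}).topologicalClosure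

variable {P : Measure Ω} {X : H → Ω → ℝ} {ι : Type*}

/-- For an orthonormal basis `ξ k` of the first chaos space and a multi-index `α`, the random
variable `ξ_α = ∏ k, H_{α k}(ξ k) / √(α k)!`, with `H_n` the probabilists' Hermite polynomials. -/
def chaosVar (b : HilbertBasis ι ℝ (firstChaos P X)) (α : ι →₀ ℕ) (ω : Ω) : ℝ :=
  α.prod fun k n =>
    Polynomial.aeval ((b k : Lp ℝ 2 P) ω) (Polynomial.hermite n) / √(Nat.factorial n : ℝ)

/-- The chaos coefficient `E (ζ ξ_α)`. -/
def chaosCoeff (b : HilbertBasis ι ℝ (firstChaos P X)) (ζ : Ω → ℝ) (α : ι →₀ ℕ) : ℝ :=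
  ∫ ω, ζ ω * chaosVar b α ω ∂P

/-- The factorial of a multi-index. -/
def multiFactorial (α : ι →₀ ℕ) : ℕ := α.prod fun _ n => Nat.factorial n

open Classical in
/-- The chaos coefficients of the Wick product of two elements with coefficients `c`, `d`. -/
def wickCoeff (c d : (ι →₀ ℕ) → ℝ) (γ : ι →₀ ℕ) : ℝ :=
  ∑ p ∈ Finset.HasAntidiagonal.antidiagonal γ, c p.1 * d p.2 *
    √((multiFactorial γ : ℝ) / (multiFactorial p.1 * multiFactorial p.2))

/-- The chaos coefficients of the Itô–Skorokhod integral `∑ α, X(η_α) ⋄ ξ_α` of an `H`-valued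
random element with chaos coefficients `η α : H`. For each `γ` only the terms with `α ≤ γ`
contribute, so that the sum over `α` is a finite one. -/
def skorokhodCoeff (b : HilbertBasis ι ℝ (firstChaos P X)) (η : (ι →₀ ℕ) → H)
    (γ : ι →₀ ℕ) : ℝ :=
  ∑ᶠ α : ι →₀ ℕ, wickCoeff (chaosCoeff b (X (η α))) (chaosCoeff b (chaosVar b α)) γ

end Chaos

/-! ### Fields over `L₂((0,T))` and time-dependent integrals -/

/-- Lebesgue measure on the interval `(0,T)`. -/
abbrev timeMeasure (T : ℝ) : Measure ℝ := volume.restrict (Ioo 0 T)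

/-- The real Hilbert space `L₂((0,T))`. -/
abbrev L2Time (T : ℝ) : Type := Lp ℝ 2 (timeMeasure T)

open Classical in
/-- The class in `L₂((0,T))` of a square-integrable function (and `0` for any other function). -/
def toL2Time (T : ℝ) (f : ℝ → ℝ) : L2Time T :=
  if h : MemLp f 2 (timeMeasure T) then h.toLp f else 0

/-- The indicator function of `[0,t]`, as an element of `L₂((0,T))`. -/
def chi (T t : ℝ) : L2Time T := toL2Time T ((Icc 0 t).indicator fun _ => 1)

section Time

variable {Ω : Type*} [MeasurableSpace Ω] {P : Measure Ω} {T : ℝ} {X : L2Time T → Ω → ℝ}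
  {ι : Type*}

/-- The associated process `X(t) = X(χ_t)`. -/
def assocProcess (X : L2Time T → Ω → ℝ) (t : ℝ) : Ω → ℝ := X (chi T t)

/-- The second moment `E X(t)²`. -/
def secondMoment (P : Measure Ω) (X : L2Time T → Ω → ℝ) (t : ℝ) : ℝ :=
  ∫ ω, assocProcess X t ω ^ 2 ∂P

/-- The chaos coefficients of the `L₂((0,T))`-valued random element `η χ_t`: the functions
`s ↦ E (η(s) ξ_α)` restricted to `[0,t]`. -/
def processCoeff (b : HilbertBasis ι ℝ (firstChaos P X)) (η : ℝ → Lp ℝ 2 P) (t : ℝ)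
    (α : ι →₀ ℕ) : L2Time T :=
  toL2Time T ((Icc 0 t).indicator fun s => chaosCoeff b (η s) α)

/-- `IsSkorokhodIntegral b η t ζ`: the process `η` belongs to `L₂((0,T))` with values in the chaos
space, and the Itô–Skorokhod integral `∫₀ᵗ η(s) ⋄ dX(s) = X^⋄(η χ_t)` exists as an element of the
chaos space and equals `ζ`. -/
structure IsSkorokhodIntegral (b : HilbertBasis ι ℝ (firstChaos P X)) (η : ℝ → Lp ℝ 2 P) (t : ℝ)
    (ζ : Lp ℝ 2 P) : Prop where
  memLp : MemLp η 2 (timeMeasure T)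
  mem_chaos : ∀ᵐ s ∂(timeMeasure T), η s ∈ chaosSpaceOf ℝ P X
  mem_chaosSpace : ζ ∈ chaosSpaceOf ℝ P X
  coeff_eq : ∀ γ, chaosCoeff b ζ γ = skorokhodCoeff b (processCoeff b η t) γ

/-! ### The linear equation `u(t) = 1 + ∫₀ᵗ u ⋄ dX` -/

/-- The equation `u(t) = 1 + ∫₀ᵗ u(s) ⋄ dX(s)` holds at time `t`, for a process `u` in
`L₂((0,T))` with values in the chaos space. -/
def SolvesLinearAt [IsFiniteMeasure P] (b : HilbertBasis ι ℝ (firstChaos P X))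
    (u : ℝ → Lp ℝ 2 P) (t : ℝ) : Prop :=
  IsSkorokhodIntegral b u t (u t - Lp.const 2 P (1 : ℝ))

/-! ### The equation `du = a u_xx dt + σ u_x ⋄ dX(t)` -/

/-- The real Hilbert space `L₂(ℝ)`. -/
abbrev L2Line : Type := Lp ℝ 2 (volume : Measure ℝ)

/-- The classes in `L₂(ℝ)` of the smooth compactly supported functions. -/
def smoothData : Set L2Line :=
  {f | ∃ φ : ℝ → ℝ, ContDiff ℝ (⊤ : ℕ∞) φ ∧ HasCompactSupport φ ∧ f =ᵐ[volume] φ}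

/-- The random variable `∫ w(x) φ(x) dx`, for a square-integrable random element `w` of
`L₂(ℝ)` and a Schwartz function `φ`. -/
def pairing (φ : 𝓢(ℝ, ℝ)) (w : Lp L2Line 2 P) : Lp ℝ 2 P :=
  (innerSL ℝ (φ.toLp 2 volume)).compLp w

/-- `u` is a square-integrable solution on `[0,T]` of
`u(t,x) = u₀(x) + a ∫₀ᵗ u_xx(s,x) ds + ∫₀ᵗ σ u_x(s,x) ⋄ dX(s)`. The equation holds at every time
`t`, as an equality of distributions in `x`; by `L₂(ℝ)`-boundedness it is the same to test it with
smooth compactly supported functions or, as here, with Schwartz functions. -/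
structure IsSPDESolution [IsFiniteMeasure P] (b : HilbertBasis ι ℝ (firstChaos P X)) (a σ : ℝ)
    (u₀ : L2Line) (u : ℝ → Lp L2Line 2 P) : Prop where
  memLp : MemLp u 2 (timeMeasure T)
  mem_chaosSpace : ∀ t ∈ Icc 0 T, u t ∈ chaosSpaceOf L2Line P X
  equation : ∀ t ∈ Icc 0 T, ∀ φ : 𝓢(ℝ, ℝ),
    IsSkorokhodIntegral b
      (fun s => -σ • pairing (SchwartzMap.derivCLM ℝ ℝ φ) (u s)) t
      (pairing φ (u t) - Lp.const 2 P (inner ℝ (φ.toLp 2 volume) u₀)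
        - a • ∫ s in (0 : ℝ)..t,
            pairing (SchwartzMap.derivCLM ℝ ℝ (SchwartzMap.derivCLM ℝ ℝ φ)) (u s))

/-- Well-posedness in `L₂(Ω; L₂(ℝ))` for initial data in the class `D`: existence, uniqueness, and
continuous dependence on the initial condition, on the time interval `[0,T]`. -/
structure WellPosed [IsFiniteMeasure P] (b : HilbertBasis ι ℝ (firstChaos P X)) (a σ : ℝ)
    (D : Set L2Line) : Prop where
  existence : ∀ u₀ ∈ D, ∃ u, IsSPDESolution b a σ u₀ u
  uniqueness : ∀ u₀ ∈ D, ∀ u v, IsSPDESolution b a σ u₀ u → IsSPDESolution b a σ u₀ v →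
    ∀ t ∈ Icc 0 T, u t = v t
  stability : ∃ C : ℝ, ∀ u₀ ∈ D, ∀ u, IsSPDESolution b a σ u₀ u →
    ∀ t ∈ Icc 0 T, ‖u t‖ ≤ C * ‖u₀‖

end Time

end GaussField

end

noncomputable section

namespace GaussField

/-! ### Hermite polynomials and the standard Gaussian measure -/

/-! Both equations are reduced to deterministic identities for chaos coefficients. Let M_k
(`kernelFn`) be the adjoint of the field applied to the basis vector ξ_k, so that E(ξ_k X(t)) = ∫₀ᵗ
M_k. The Wick product with a first-chaos variable raises the degree by one, so the coefficient of
order γ of ∫₀ᵗ η ⋄ dX is ∑_k √γ_k ∫₀ᵗ M_k η_{γ-ε_k} (`skorokhodCoeff_processCoeff`). Both equations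
thus become systems that are triangular in the degree |γ|. Coefficients determine a field-measurable
variable by the Cameron–Martin theorem (`eq_zero_of_chaosCoeff_eq_zero`), which rests on the
Gaussian computation `integral_cexp_mul_chaosVar` of the coefficients of exp(zh).

For the linear equation, induction on |γ| gives the coefficient ∏_k (∫₀ᵗ M_k)^{γ_k}/√γ_k!. These are
the coefficients of exp(X(t) - E X(t)²/2), which proves existence and uniqueness together.

For the second equation, take the Fourier transform in x. At frequency y the coefficient of order γ
must be (2πiσy)^{|γ|} exp(-a(2πy)²t) ∏_k (∫₀ᵗ M_k)^{γ_k}/√γ_k! times the transform of u₀. This holds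
for every solution whatever the sign of a (`lineFourier_vectorCoeff_of_solution`): with compactly
supported test functions of the frequency, ∂ₓ² is a bounded operator and a Picard argument applies.
Uniqueness follows.

Summing squared moduli over γ produces the weight exp((2πy)²(σ² E X(t)² - 2at)) on the squared
transform of u₀. If at ≥ σ² E X(t)²/2 for all t, averaging u₀ over a Gaussian of variance 2r(t) and
translating by σX(t) has exactly the required coefficients, and is a contraction
(`isSPDESolution_heatSolution`). If the inequality fails at some t, square-integrability of a
solution forces the transform of u₀ to decay like a Gaussian (`integrable_of_solution`). Then u₀ is
analytic, so it cannot be a nonzero compactly supported function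
(`eq_zero_of_hasCompactSupport_of_integrable`). -/

open Polynomial in
theorem derivative_hermite_succ (n : ℕ) :
    derivative (hermite (n + 1)) = ((n + 1 : ℕ) : ℤ[X]) * hermite n := by
  induction n with
  | zero => simp
  | succ n ih =>
    have h2 : hermite (n + 1 + 1) = X * hermite (n + 1) - ((n + 1 : ℕ) : ℤ[X]) * hermite n := by
      rw [hermite_succ (n + 1), ih]
    rw [h2, derivative_sub, derivative_mul, derivative_mul, derivative_X, derivative_natCast, ih]
    have h1 := hermite_succ n
    rw [h1]
    push_cast
    ring

theorem integrable_polynomial_mul_cexp_gaussianReal (p : Polynomial ℂ) (z : ℂ) :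
    Integrable (fun x : ℝ => p.eval (x : ℂ) * Complex.exp (z * x)) (gaussianReal 0 1) := by
  induction p using Polynomial.induction_on' with
  | add p q hp hq =>
    simp only [Polynomial.eval_add, add_mul]
    exact hp.add hq
  | monomial n a =>
    have h := integrable_pow_mul_cexp_of_re_mem_interior_integrableExpSet
      (X := fun x : ℝ => x) (μ := gaussianReal 0 1) (z := z)
      (by simp) n
    simpa [Polynomial.eval_monomial, mul_assoc] using h.const_mul a

/-- Gaussian integration by parts. -/
theorem integral_id_mul_gaussianReal {f f' : ℝ → ℂ} (hf : ∀ x, HasDerivAt f (f' x) x)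
    (hi : Integrable f (gaussianReal 0 1)) (hi' : Integrable f' (gaussianReal 0 1))
    (hxi : Integrable (fun x : ℝ => (x : ℂ) * f x) (gaussianReal 0 1)) :
    ∫ x : ℝ, (x : ℂ) * f x ∂(gaussianReal 0 1) = ∫ x, f' x ∂(gaussianReal 0 1) := by
  have key : ∀ g : ℝ → ℂ, Integrable g (gaussianReal 0 1) →
      Integrable (fun x => g x * (gaussianPDFReal 0 1 x : ℂ)) := by
    intro g hg
    rw [gaussianReal_of_var_ne_zero _ one_ne_zero] at hg
    rw [integrable_withDensity_iff_integrable_smul' (measurable_gaussianPDF _ _)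
      (ae_of_all _ fun _ => gaussianPDF_lt_top)] at hg
    refine hg.congr (ae_of_all _ fun x => ?_)
    simp only [toReal_gaussianPDF, Complex.real_smul]
    ring
  -- The standard density ρ satisfies ρ' = -xρ, so the factor x is absorbed by integration by parts
  -- on the whole line.
  have hd : ∀ x : ℝ, HasDerivAt (fun x : ℝ => (gaussianPDFReal 0 1 x : ℂ))
      (-(x : ℂ) * (gaussianPDFReal 0 1 x : ℂ)) x := by
    intro x
    have h : HasDerivAt (gaussianPDFReal 0 1) (-x * gaussianPDFReal 0 1 x) x := by
      rw [gaussianPDFReal_def]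
      have h1 : HasDerivAt (fun x : ℝ => -(x - 0) ^ 2 / (2 * ((1 : ℝ≥0) : ℝ))) (-x) x := by
        have := (((hasDerivAt_id x).sub_const 0).pow 2).neg.div_const (2 * ((1 : ℝ≥0) : ℝ))
        refine this.congr_deriv ?_
        simp
        ring
      refine (h1.exp.const_mul _).congr_deriv ?_
      ring
    refine h.ofReal_comp.congr_deriv ?_
    push_cast
    ring
  have e := integral_mul_deriv_eq_deriv_mul_of_integrable (u := f) (u' := f')
    (fun x _ => hf x) (fun x _ => hd x)
    (by
      have := (key _ hxi).neg
      refine this.congr (ae_of_all _ fun x => ?_)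
      simp only [Pi.neg_apply, Pi.mul_apply]
      ring) (key _ hi') (key _ hi)
  rw [integral_gaussianReal_eq_integral_smul one_ne_zero,
    integral_gaussianReal_eq_integral_smul one_ne_zero]
  have e1 : ∀ x : ℝ, gaussianPDFReal 0 1 x • ((x : ℂ) * f x)
      = -(f x * (-(x : ℂ) * (gaussianPDFReal 0 1 x : ℂ))) := by
    intro x; simp only [Complex.real_smul]; ring
  have e2 : ∀ x : ℝ, gaussianPDFReal 0 1 x • f' x = f' x * (gaussianPDFReal 0 1 x : ℂ) := by
    intro x; simp only [Complex.real_smul]; ring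
  simp_rw [e1, e2, integral_neg, e, neg_neg]

/-- The complex value of the Hermite polynomial at a real point. -/
abbrev cHermite (n : ℕ) (x : ℝ) : ℂ := ((Polynomial.aeval x (Polynomial.hermite n) : ℝ) : ℂ)

theorem cHermite_eq_eval (n : ℕ) (x : ℝ) :
    cHermite n x = ((Polynomial.hermite n).map (Int.castRingHom ℂ)).eval (x : ℂ) := by
  have h : ((Polynomial.aeval x (Polynomial.hermite n) : ℝ) : ℂ)
      = Complex.ofRealHom (Polynomial.aeval x (Polynomial.hermite n)) := rfl
  rw [cHermite, h, Polynomial.aeval_def, Polynomial.hom_eval₂, Polynomial.eval_map]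
  congr 1

theorem cHermite_succ (n : ℕ) (x : ℝ) :
    cHermite (n + 1) x = x * cHermite n x
      - ((Polynomial.aeval x (Polynomial.derivative (Polynomial.hermite n)) : ℝ) : ℂ) := by
  simp only [cHermite, Polynomial.hermite_succ, map_sub, map_mul, Polynomial.aeval_X]
  push_cast
  rfl

theorem hasDerivAt_cHermite (n : ℕ) (x : ℝ) :
    HasDerivAt (cHermite n)
      ((Polynomial.aeval x (Polynomial.derivative (Polynomial.hermite n)) : ℝ) : ℂ) x :=
  (Polynomial.hasDerivAt_aeval (Polynomial.hermite n) x).ofReal_comp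

theorem hasDerivAt_cHermite_succ (n : ℕ) (x : ℝ) :
    HasDerivAt (cHermite (n + 1)) ((n + 1 : ℂ) * cHermite n x) x := by
  refine (hasDerivAt_cHermite (n + 1) x).congr_deriv ?_
  rw [derivative_hermite_succ]
  simp [cHermite]

/-- `E (H_{n+1} f) = E (H_n f')` for functions of exponential growth. -/
theorem integral_cHermite_succ_mul (n : ℕ) {f f' : ℝ → ℂ} (hf : ∀ x, HasDerivAt f (f' x) x)
    (hi : ∀ p : Polynomial ℂ,
      Integrable (fun x : ℝ => p.eval (x : ℂ) * f x) (gaussianReal 0 1))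
    (hi' : ∀ p : Polynomial ℂ,
      Integrable (fun x : ℝ => p.eval (x : ℂ) * f' x) (gaussianReal 0 1)) :
    ∫ x, cHermite (n + 1) x * f x ∂(gaussianReal 0 1)
      = ∫ x, cHermite n x * f' x ∂(gaussianReal 0 1) := by
  set q := (Polynomial.hermite n).map (Int.castRingHom ℂ) with hq
  have hd : ∀ x : ℝ, ((Polynomial.aeval x (Polynomial.derivative (Polynomial.hermite n)) : ℝ) : ℂ)
      = (Polynomial.derivative q).eval (x : ℂ) := by
    intro x
    rw [hq, Polynomial.derivative_map, Polynomial.eval_map, Polynomial.aeval_def,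
      ← Complex.ofRealHom_eq_coe, ← Complex.ofRealHom_eq_coe, Polynomial.hom_eval₂]
    congr 1
  have i1 : Integrable (fun x : ℝ => cHermite n x * f x) (gaussianReal 0 1) := by
    simp_rw [cHermite_eq_eval]; exact hi q
  have i2 : Integrable (fun x : ℝ => cHermite n x * f' x) (gaussianReal 0 1) := by
    simp_rw [cHermite_eq_eval]; exact hi' q
  have i3 : Integrable (fun x : ℝ => ((Polynomial.aeval x
      (Polynomial.derivative (Polynomial.hermite n)) : ℝ) : ℂ) * f x) (gaussianReal 0 1) := by
    simp_rw [hd]; exact hi _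
  have i4 : Integrable (fun x : ℝ => (x : ℂ) * (cHermite n x * f x)) (gaussianReal 0 1) := by
    refine (hi (Polynomial.X * q)).congr (ae_of_all _ fun x => ?_)
    simp only [Polynomial.eval_mul, Polynomial.eval_X, cHermite_eq_eval, ← hq]
    ring
  have st := integral_id_mul_gaussianReal
    (f := fun x => cHermite n x * f x) (fun x => (hasDerivAt_cHermite n x).mul (hf x))
    i1 (i3.add i2) i4
  calc ∫ x, cHermite (n + 1) x * f x ∂(gaussianReal 0 1)
      = ∫ x, ((x : ℂ) * (cHermite n x * f x) - ((Polynomial.aeval x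
      (Polynomial.derivative (Polynomial.hermite n)) : ℝ) : ℂ) * f x) ∂(gaussianReal 0 1) := by
        congr 1; ext x; rw [cHermite_succ]; ring
    _ = _ := by
        rw [integral_sub i4 i3, st, integral_add i3 i2]
        ring

/-- Each integration by parts lowers the Hermite index and brings out a factor z; after n of them
the Gaussian moment generating function remains. -/
theorem integral_cHermite_mul_cexp (n : ℕ) (z : ℂ) :
    ∫ x : ℝ, cHermite n x * Complex.exp (z * x) ∂(gaussianReal 0 1)
      = z ^ n * Complex.exp (z ^ 2 / 2) := by
  induction n with
  | zero =>
    have h := complexMGF_id_gaussianReal (μ := 0) (v := 1) z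
    simp only [complexMGF, id] at h
    simp only [cHermite, Polynomial.hermite_zero, map_one, Complex.ofReal_one, one_mul, h]
    simp
  | succ n ih =>
    rw [integral_cHermite_succ_mul n (f' := fun x : ℝ => z * Complex.exp (z * x))]
    · simp_rw [mul_left_comm _ z]
      rw [integral_const_mul, ih]
      ring
    · intro x
      have h : HasDerivAt (fun w : ℂ => Complex.exp (z * w)) (Complex.exp (z * x) * (z * 1)) (x : ℂ) :=
        ((hasDerivAt_id (x : ℂ)).const_mul z).cexp
      refine h.comp_ofReal.congr_deriv ?_
      ring
    · exact fun p => integrable_polynomial_mul_cexp_gaussianReal p z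
    · intro p
      refine ((integrable_polynomial_mul_cexp_gaussianReal p z).const_mul z).congr
        (ae_of_all _ fun x => ?_)
      ring

theorem integrable_polynomial_gaussianReal (p : Polynomial ℂ) :
    Integrable (fun x : ℝ => p.eval (x : ℂ)) (gaussianReal 0 1) := by
  simpa using integrable_polynomial_mul_cexp_gaussianReal p 0

theorem integrable_polynomial_mul_cHermite (p : Polynomial ℂ) (m : ℕ) :
    Integrable (fun x : ℝ => p.eval (x : ℂ) * cHermite m x) (gaussianReal 0 1) := by
  simp_rw [cHermite_eq_eval, ← Polynomial.eval_mul]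
  exact integrable_polynomial_gaussianReal _

/-- Integration by parts lowers both indices at once and gives a factor m + 1. When one index
reaches zero, the value is the previous formula at z = 0. -/
theorem integral_cHermite_mul_cHermite (n m : ℕ) :
    ∫ x, cHermite n x * cHermite m x ∂(gaussianReal 0 1)
      = if n = m then (Nat.factorial n : ℂ) else 0 := by
  have h0 : ∀ n : ℕ, ∫ x, cHermite n x * cHermite 0 x ∂(gaussianReal 0 1)
      = if n = 0 then 1 else 0 := by
    intro n
    have h := integral_cHermite_mul_cexp n 0
    simp only [zero_mul, Complex.exp_zero, mul_one] at h
    simp only [cHermite, Polynomial.hermite_zero, map_one, Complex.ofReal_one, mul_one] at h ⊢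
    rw [h]
    split_ifs with hn <;> simp [hn]
  induction n generalizing m with
  | zero =>
    simp_rw [mul_comm (cHermite 0 _), h0, eq_comm (a := m)]
    simp
  | succ n ih =>
    cases m with
    | zero => rw [h0]; simp
    | succ m =>
      rw [integral_cHermite_succ_mul n (hasDerivAt_cHermite_succ m)
        (fun p => integrable_polynomial_mul_cHermite p _)]
      · simp_rw [mul_left_comm _ ((m : ℂ) + 1)]
        rw [integral_const_mul, ih]
        by_cases h : n = m
        · subst h; simp [Nat.factorial_succ]
        · simp [h]
      · intro p
        refine ((integrable_polynomial_mul_cHermite p m).const_mul ((m : ℂ) + 1)).congr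
          (ae_of_all _ fun x => ?_)
        ring

end GaussField

namespace GaussField

section FirstChaos

variable {Ω H : Type*} [MeasurableSpace Ω] {P : Measure Ω}

/-! ### The field as a bounded operator, and the first chaos -/

section Field

variable [NormedAddCommGroup H] [NormedSpace ℝ H] {X : H → Ω → ℝ}

theorem IsZeroMeanGaussianField.memLp_two (hX : IsZeroMeanGaussianField P X) (f : H) :
    MemLp (X f) 2 P :=
  (hX.gaussian f).memLp_two

/-- The field as a linear map into `L₂(Ω)`. -/
def fieldLinearMap (hX : IsZeroMeanGaussianField P X) : H →ₗ[ℝ] Lp ℝ 2 P where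
  toFun f := (hX.memLp_two f).toLp (X f)
  map_add' f g := by
    apply Lp.ext
    filter_upwards [(hX.memLp_two (f + g)).coeFn_toLp, (hX.memLp_two f).coeFn_toLp,
      (hX.memLp_two g).coeFn_toLp, hX.linear 1 1 f g,
      Lp.coeFn_add ((hX.memLp_two f).toLp (X f)) ((hX.memLp_two g).toLp (X g))]
      with ω h1 h2 h3 h4 h5
    rw [h1, h5, Pi.add_apply, h2, h3]
    simpa using h4
  map_smul' c f := by
    apply Lp.ext
    filter_upwards [(hX.memLp_two (c • f)).coeFn_toLp, (hX.memLp_two f).coeFn_toLp,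
      hX.linear c 0 f 0, Lp.coeFn_smul c ((hX.memLp_two f).toLp (X f))]
      with ω h1 h2 h4 h5
    rw [h1, RingHom.id_apply, h5, Pi.smul_apply, h2]
    simpa using h4

theorem coeFn_fieldLinearMap (hX : IsZeroMeanGaussianField P X) (f : H) :
    fieldLinearMap hX f =ᵐ[P] X f :=
  (hX.memLp_two f).coeFn_toLp

/-- Continuity in probability is upgraded to boundedness into L₂ by the closed graph theorem: an L₂
limit is also a limit in probability, and the latter is unique. -/
theorem continuous_fieldLinearMap [CompleteSpace H] (hX : IsZeroMeanGaussianField P X) :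
    Continuous (fieldLinearMap hX) := by
  refine LinearMap.continuous_of_seq_closed_graph _ fun u x y hu hy => ?_
  have h1 := hX.continuous u x hu
  have h2 : TendstoInMeasure P (fun n => (fieldLinearMap hX (u n) : Ω → ℝ)) atTop y :=
    tendstoInMeasure_of_tendsto_Lp hy
  have h3 : TendstoInMeasure P (fun n => X (u n)) atTop y :=
    h2.congr_left fun n => coeFn_fieldLinearMap hX (u n)
  have h4 : X x =ᵐ[P] y := tendstoInMeasure_ae_unique h1 h3
  exact Lp.ext (h4.symm.trans (coeFn_fieldLinearMap hX x).symm)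

/-- The field as a bounded operator into `L₂(Ω)`. -/
def fieldCLM [CompleteSpace H] (hX : IsZeroMeanGaussianField P X) : H →L[ℝ] Lp ℝ 2 P :=
  ⟨fieldLinearMap hX, continuous_fieldLinearMap hX⟩

theorem coeFn_fieldCLM [CompleteSpace H] (hX : IsZeroMeanGaussianField P X) (f : H) :
    fieldCLM hX f =ᵐ[P] X f :=
  coeFn_fieldLinearMap hX f

theorem span_eq_range_fieldLinearMap (hX : IsZeroMeanGaussianField P X) :
    Submodule.span ℝ {ζ : Lp ℝ 2 P | ∃ f, ζ =ᵐ[P] X f} = LinearMap.range (fieldLinearMap hX) := by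
  have h : {ζ : Lp ℝ 2 P | ∃ f, ζ =ᵐ[P] X f}
      = (LinearMap.range (fieldLinearMap hX) : Set (Lp ℝ 2 P)) := by
    ext ζ
    constructor
    · rintro ⟨f, hf⟩
      exact ⟨f, Lp.ext ((coeFn_fieldLinearMap hX f).trans hf.symm)⟩
    · rintro ⟨f, rfl⟩
      exact ⟨f, coeFn_fieldLinearMap hX f⟩
  rw [h, Submodule.span_eq]

theorem firstChaos_eq_closure (hX : IsZeroMeanGaussianField P X) :
    firstChaos P X = (LinearMap.range (fieldLinearMap hX)).topologicalClosure := by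
  rw [firstChaos, span_eq_range_fieldLinearMap hX]

theorem fieldCLM_mem_firstChaos [CompleteSpace H] (hX : IsZeroMeanGaussianField P X) (f : H) :
    fieldCLM hX f ∈ firstChaos P X := by
  rw [firstChaos_eq_closure hX]
  exact Submodule.le_topologicalClosure _ ⟨f, rfl⟩

theorem fieldSigma_le (hX : IsZeroMeanGaussianField P X) :
    fieldSigma X ≤ (inferInstance : MeasurableSpace Ω) :=
  iSup_le fun f => (hX.measurable f).comap_le

omit [MeasurableSpace Ω] [NormedAddCommGroup H] [NormedSpace ℝ H] in
theorem measurable_fieldSigma (X : H → Ω → ℝ) (f : H) : Measurable[fieldSigma X] (X f) :=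
  (comap_measurable (X f)).mono (le_iSup (fun f => MeasurableSpace.comap (X f) inferInstance) f)
    le_rfl

end Field

/-- The characteristic function at a fixed point is Lipschitz in L₂, since |e^{ix} - e^{iy}| ≤ |x -
y| and the L₁ norm is at most the L₂ norm. This lets Gaussian laws pass to the closure that defines
the first chaos. -/
theorem continuous_integral_cexp [IsProbabilityMeasure P] (t : ℝ) :
    Continuous fun h : Lp ℝ 2 P => ∫ ω, Complex.exp (t * h ω * Complex.I) ∂P := by
  have hm : ∀ h : Lp ℝ 2 P, Integrable (fun ω => Complex.exp (t * h ω * Complex.I)) P := by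
    intro h
    refine Integrable.of_bound (C := 1) ?_ (ae_of_all _ fun ω => ?_)
    · have := (Lp.aestronglyMeasurable h).aemeasurable
      exact (by fun_prop : AEMeasurable (fun ω => Complex.exp (t * h ω * Complex.I)) P).aestronglyMeasurable
    · rw [← Complex.ofReal_mul, Complex.norm_exp_ofReal_mul_I]
  refine (LipschitzWith.of_dist_le_mul (K := ‖t‖₊) fun h g => ?_).continuous
  rw [dist_eq_norm, ← integral_sub (hm h) (hm g), dist_eq_norm]
  have hb : ∀ ω, ‖Complex.exp (t * h ω * Complex.I) - Complex.exp (t * g ω * Complex.I)‖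
      ≤ ‖t‖ * ‖h ω - g ω‖ := by
    intro ω
    have e : Complex.exp (t * h ω * Complex.I) - Complex.exp (t * g ω * Complex.I)
        = Complex.exp ((t * g ω : ℝ) * Complex.I)
          * (Complex.exp (Complex.I * (t * (h ω - g ω) : ℝ)) - 1) := by
      rw [mul_sub, ← Complex.exp_add]
      push_cast
      ring_nf
    rw [e, norm_mul, Complex.norm_exp_ofReal_mul_I, one_mul, ← norm_mul]
    exact Real.norm_exp_I_mul_ofReal_sub_one_le
  have hi : Integrable (fun ω => h ω - g ω) P :=
    ((Lp.memLp h).integrable one_le_two).sub ((Lp.memLp g).integrable one_le_two)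
  calc ‖∫ ω, (Complex.exp (t * h ω * Complex.I) - Complex.exp (t * g ω * Complex.I)) ∂P‖
      ≤ ∫ ω, ‖t‖ * ‖h ω - g ω‖ ∂P :=
        norm_integral_le_of_norm_le (hi.norm.const_mul _) (ae_of_all _ hb)
    _ = ‖t‖ * ∫ ω, ‖h ω - g ω‖ ∂P := integral_const_mul _ _
    _ ≤ ‖t‖ * ‖h - g‖ := by
        gcongr
        have e1 : ∫ ω, ‖h ω - g ω‖ ∂P = (eLpNorm (h - g : Lp ℝ 2 P) 1 P).toReal := by
          rw [eLpNorm_one_eq_lintegral_enorm, ← integral_norm_eq_lintegral_enorm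
            (Lp.aestronglyMeasurable _)]
          refine integral_congr_ae ?_
          filter_upwards [Lp.coeFn_sub h g] with ω hω
          rw [hω, Pi.sub_apply]
        rw [e1, Lp.norm_def]
        exact ENNReal.toReal_mono (Lp.eLpNorm_ne_top _)
          (eLpNorm_le_eLpNorm_of_exponent_le one_le_two (Lp.aestronglyMeasurable _))

variable [NormedAddCommGroup H] [NormedSpace ℝ H] {X : H → Ω → ℝ}

theorem integral_sq_eq_norm_sq (h : Lp ℝ 2 P) : ∫ ω, h ω ^ 2 ∂P = ‖h‖ ^ 2 := by
  rw [← real_inner_self_eq_norm_sq, L2.inner_def]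
  congr 1
  ext ω
  simp [sq]

theorem map_fieldLinearMap [IsProbabilityMeasure P] (hX : IsZeroMeanGaussianField P X) (f : H) :
    P.map (fieldLinearMap hX f) = gaussianReal 0 (‖fieldLinearMap hX f‖₊ ^ 2) := by
  have hg : HasGaussianLaw (fieldLinearMap hX f) P :=
    (hX.gaussian f).congr (coeFn_fieldLinearMap hX f).symm
  have hm : ∫ ω, fieldLinearMap hX f ω ∂P = 0 := by
    rw [integral_congr_ae (coeFn_fieldLinearMap hX f), hX.zero_mean f]
  rw [hg.map_eq_gaussianReal, hm, variance_of_integral_eq_zero hg.aemeasurable hm,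
    integral_sq_eq_norm_sq]
  congr 1
  ext
  simp

/-- Elements of the first chaos are centred Gaussian. -/
theorem map_of_mem_firstChaos [IsProbabilityMeasure P] (hX : IsZeroMeanGaussianField P X)
    {h : Lp ℝ 2 P} (hh : h ∈ firstChaos P X) : P.map h = gaussianReal 0 (‖h‖₊ ^ 2) := by
  have hmeas := (Lp.aestronglyMeasurable h).aemeasurable
  have : IsProbabilityMeasure (P.map h) := Measure.isProbabilityMeasure_map hmeas
  refine Measure.ext_of_charFun (funext fun t => ?_)
  rw [charFun_gaussianReal, charFun_apply_real, integral_map hmeas (by fun_prop)]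
  -- The Gaussian form of the characteristic function is a closed condition, so it suffices to check
  -- it on the range of the field.
  have hclosed : IsClosed {h : Lp ℝ 2 P | ∫ ω, Complex.exp (t * h ω * Complex.I) ∂P
      = Complex.exp (t * (0 : ℝ) * Complex.I - ((‖h‖₊ ^ 2 : ℝ≥0) : ℂ) * t ^ 2 / 2)} := by
    refine isClosed_eq (continuous_integral_cexp t) ?_
    have : Continuous fun h : Lp ℝ 2 P => ((‖h‖₊ ^ 2 : ℝ≥0) : ℂ) := by
      have : (fun h : Lp ℝ 2 P => ((‖h‖₊ ^ 2 : ℝ≥0) : ℂ)) = fun h => ((‖h‖ ^ 2 : ℝ) : ℂ) := by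
        ext h; simp
      rw [this]
      fun_prop
    fun_prop
  rw [firstChaos_eq_closure hX] at hh
  refine closure_minimal ?_ hclosed hh
  rintro _ ⟨f, rfl⟩
  have h1 := map_fieldLinearMap hX f
  have h2 := congrArg (fun μ => charFun μ t) h1
  rw [charFun_gaussianReal, charFun_apply_real, integral_map (Lp.aestronglyMeasurable _).aemeasurable
    (by fun_prop)] at h2
  exact h2

theorem hasGaussianLaw_of_mem_firstChaos [IsProbabilityMeasure P]
    (hX : IsZeroMeanGaussianField P X) {h : Lp ℝ 2 P} (hh : h ∈ firstChaos P X) :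
    HasGaussianLaw h P :=
  ⟨by rw [map_of_mem_firstChaos hX hh]; infer_instance⟩

theorem integral_of_mem_firstChaos [IsProbabilityMeasure P] (hX : IsZeroMeanGaussianField P X)
    {h : Lp ℝ 2 P} (hh : h ∈ firstChaos P X) : ∫ ω, h ω ∂P = 0 := by
  have e := integral_map (μ := P) (φ := h) (f := fun x : ℝ => x)
    (Lp.aestronglyMeasurable h).aemeasurable (by fun_prop)
  rw [← e, map_of_mem_firstChaos hX hh, integral_id_gaussianReal]

omit [NormedAddCommGroup H] [NormedSpace ℝ H] in
theorem strongDual_pi_ae_eq {κ : Type*} [Fintype κ] [DecidableEq κ] (L : StrongDual ℝ (κ → ℝ))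
    (Y : κ → Lp ℝ 2 P) : (fun ω => L fun i => Y i ω)
      =ᵐ[P] (∑ i, L (Pi.single i 1) • Y i : Lp ℝ 2 P) := by
  have h1 := Lp.coeFn_finsetSum (p := 2) (μ := P) Finset.univ fun i => L (Pi.single i 1) • Y i
  have h2 : ∀ i, (L (Pi.single i 1) • Y i : Lp ℝ 2 P) =ᵐ[P] L (Pi.single i 1) • (Y i : Ω → ℝ) :=
    fun i => Lp.coeFn_smul _ _
  filter_upwards [h1, ae_all_iff.2 h2] with ω h1 h2
  rw [h1, Finset.sum_apply]
  have h3 := L.toLinearMap.pi_apply_eq_sum_univ fun i => Y i ω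
  refine h3.trans ?_
  refine Finset.sum_congr rfl fun i _ => ?_
  rw [h2]
  have h4 : (fun j => if i = j then 1 else 0 : κ → ℝ) = Pi.single i 1 := by
    ext j; simp [Pi.single_apply, eq_comm]
  rw [h4]
  simp [mul_comm]

/-- Finite families in the first chaos are jointly Gaussian. -/
theorem hasGaussianLaw_pi [IsProbabilityMeasure P] (hX : IsZeroMeanGaussianField P X)
    {κ : Type*} [Fintype κ] (Y : κ → Lp ℝ 2 P) (hY : ∀ i, Y i ∈ firstChaos P X) :
    HasGaussianLaw (fun ω i => Y i ω) P := by
  classical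
  have hm : AEMeasurable (fun ω i => Y i ω) P :=
    aemeasurable_pi_lambda _ fun i => (Lp.aestronglyMeasurable (Y i)).aemeasurable
  refine ⟨isGaussian_of_isGaussian_map fun L => ?_⟩
  -- Joint Gaussianity is tested on linear functionals, and the first chaos is a linear space of
  -- Gaussian variables.
  have hmem : (∑ i, L (Pi.single i 1) • Y i : Lp ℝ 2 P) ∈ firstChaos P X :=
    Submodule.sum_mem _ fun i _ => Submodule.smul_mem _ _ (hY i)
  have hG := (hasGaussianLaw_of_mem_firstChaos hX hmem).congr (strongDual_pi_ae_eq L Y).symm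
  rw [AEMeasurable.map_map_of_aemeasurable (by fun_prop) hm]
  exact hG.isGaussian_map

/-- For centred variables the covariance is the L₂ inner product, and jointly Gaussian uncorrelated
variables are independent. -/
theorem iIndepFun_of_mem_firstChaos [IsProbabilityMeasure P] (hX : IsZeroMeanGaussianField P X)
    {κ : Type*} [Fintype κ] (Y : κ → Lp ℝ 2 P) (hY : ∀ i, Y i ∈ firstChaos P X)
    (ho : ∀ i j, i ≠ j → inner ℝ (Y i) (Y j) = 0) :
    iIndepFun (fun i => (Y i : Ω → ℝ)) P := by
  refine (hasGaussianLaw_pi hX Y hY).iIndepFun_of_covariance_eq_zero fun i j hij => ?_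
  rw [covariance_eq_sub (Lp.memLp _) (Lp.memLp _), integral_of_mem_firstChaos hX (hY i), zero_mul, sub_zero]
  have := ho i j hij
  rw [L2.inner_def] at this
  rw [← this]
  congr 1
  ext ω
  simp [mul_comm]

end FirstChaos

end GaussField

namespace GaussField

section ChaosVar

variable {Ω H : Type*} [MeasurableSpace Ω] {P : Measure Ω} [NormedAddCommGroup H]
  [NormedSpace ℝ H] {X : H → Ω → ℝ} {ι : Type*}

/-! ### The Hermite variables `ξ_α` -/

/-- The normalised monomial `∏ k, m k ^ α k / √(α k)!`. -/
def multiPow (m : ι → ℝ) (α : ι →₀ ℕ) : ℝ :=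
  α.prod fun k n => m k ^ n / √(Nat.factorial n : ℝ)

omit [NormedAddCommGroup H] [NormedSpace ℝ H] in
theorem chaosVar_eq_prod (b : HilbertBasis ι ℝ (firstChaos P X)) {α : ι →₀ ℕ} {s : Finset ι}
    (h : α.support ⊆ s) (ω : Ω) :
    chaosVar b α ω = ∏ k ∈ s, Polynomial.aeval ((b k : Lp ℝ 2 P) ω) (Polynomial.hermite (α k))
      / √(Nat.factorial (α k) : ℝ) :=
  Finsupp.prod_of_support_subset α h _ fun i _ => by simp

omit [NormedAddCommGroup H] [NormedSpace ℝ H] in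
theorem aestronglyMeasurable_chaosVar (b : HilbertBasis ι ℝ (firstChaos P X)) (α : ι →₀ ℕ) :
    AEStronglyMeasurable (chaosVar b α) P := by
  have h : chaosVar b α = fun ω => ∏ k ∈ α.support,
      Polynomial.aeval ((b k : Lp ℝ 2 P) ω) (Polynomial.hermite (α k))
      / √(Nat.factorial (α k) : ℝ) := funext fun ω => chaosVar_eq_prod b subset_rfl ω
  rw [h]
  refine Finset.aestronglyMeasurable_fun_prod _ fun k _ => ?_
  have h1 : Continuous fun x : ℝ => Polynomial.aeval x (Polynomial.hermite (α k))
      / √(Nat.factorial (α k) : ℝ) := by fun_prop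
  exact h1.comp_aestronglyMeasurable (Lp.aestronglyMeasurable _)

omit [NormedAddCommGroup H] [NormedSpace ℝ H] in
theorem inner_basis_eq (b : HilbertBasis ι ℝ (firstChaos P X)) [DecidableEq ι] (i j : ι) :
    inner ℝ (b i : Lp ℝ 2 P) (b j : Lp ℝ 2 P) = if i = j then 1 else 0 := by
  rw [← Submodule.coe_inner]
  exact orthonormal_iff_ite.1 b.orthonormal i j

variable [IsProbabilityMeasure P]

theorem map_basis (hX : IsZeroMeanGaussianField P X) (b : HilbertBasis ι ℝ (firstChaos P X))
    (k : ι) : P.map (b k : Lp ℝ 2 P) = gaussianReal 0 1 := by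
  rw [map_of_mem_firstChaos hX (b k).2]
  have h : ‖(b k : Lp ℝ 2 P)‖₊ = 1 := NNReal.eq (b.orthonormal.1 k)
  rw [h, one_pow]

theorem integral_comp_basis (hX : IsZeroMeanGaussianField P X)
    (b : HilbertBasis ι ℝ (firstChaos P X)) (k : ι) {f : ℝ → ℂ} (hf : Continuous f) :
    ∫ ω, f ((b k : Lp ℝ 2 P) ω) ∂P = ∫ x, f x ∂(gaussianReal 0 1) := by
  rw [← map_basis hX b k, integral_map (Lp.aestronglyMeasurable _).aemeasurable
    hf.aestronglyMeasurable]

theorem continuous_cHermite (n : ℕ) : Continuous (cHermite n) := by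
  unfold cHermite
  fun_prop

/-- Independence of the ξ_k factors the expectation over the union of the two supports, and each
factor is a one-dimensional Hermite orthogonality relation. Indices where one entry vanishes
contribute H₀ = 1 for that entry. -/
theorem integral_chaosVar_mul_chaosVar (hX : IsZeroMeanGaussianField P X)
    (b : HilbertBasis ι ℝ (firstChaos P X)) [DecidableEq ι] (α β : ι →₀ ℕ) :
    ∫ ω, chaosVar b α ω * chaosVar b β ω ∂P = if α = β then 1 else 0 := by
  set s := α.support ∪ β.support with hs
  let f : s → ℝ → ℂ := fun k x => (cHermite (α k) x / (√(Nat.factorial (α k) : ℝ) : ℂ))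
    * (cHermite (β k) x / (√(Nat.factorial (β k) : ℝ) : ℂ))
  have hfc : ∀ k, Continuous (f k) := fun k =>
    ((continuous_cHermite _).div_const _).mul ((continuous_cHermite _).div_const _)
  have hind := iIndepFun_of_mem_firstChaos hX (fun k : s => (b k : Lp ℝ 2 P)) (fun k => (b k).2)
    (fun i j hij => by
      rw [inner_basis_eq, if_neg]
      exact fun h => hij (Subtype.ext h))
  have e := hind.integral_fun_prod_comp (f := f)
    (fun k => (Lp.aestronglyMeasurable _).aemeasurable) (fun k => (hfc k).aestronglyMeasurable)
  have e1 : ∀ k : s, ∫ ω, f k ((b k : Lp ℝ 2 P) ω) ∂P = if α k = β k then 1 else 0 := by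
    intro k
    rw [integral_comp_basis hX b k (hfc k)]
    have : ∀ x, f k x = ((√(Nat.factorial (α k) : ℝ) : ℂ)⁻¹ * (√(Nat.factorial (β k) : ℝ) : ℂ)⁻¹)
        * (cHermite (α k) x * cHermite (β k) x) := by
      intro x; simp only [f, div_eq_mul_inv]; ring
    simp_rw [this]
    rw [integral_const_mul, integral_cHermite_mul_cHermite]
    split_ifs with h
    · rw [← h, ← mul_inv, ← Complex.ofReal_mul, Real.mul_self_sqrt (by positivity)]
      rw [Complex.ofReal_natCast]
      exact inv_mul_cancel₀ (by exact_mod_cast Nat.factorial_ne_zero _)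
    · simp
  have e2 : ∀ ω, ((chaosVar b α ω * chaosVar b β ω : ℝ) : ℂ)
      = ∏ k : s, f k ((b k : Lp ℝ 2 P) ω) := by
    intro ω
    rw [chaosVar_eq_prod b (s := s) Finset.subset_union_left,
      chaosVar_eq_prod b (s := s) Finset.subset_union_right, ← Finset.prod_mul_distrib,
      ← Finset.prod_coe_sort s]
    push_cast
    rfl
  have e3 : ((∫ ω, chaosVar b α ω * chaosVar b β ω ∂P : ℝ) : ℂ) = if α = β then 1 else 0 := by
    rw [← integral_complex_ofReal]
    simp_rw [e2]
    rw [e]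
    simp_rw [e1]
    split_ifs with h
    · subst h; simp
    · obtain ⟨k, hk⟩ := DFunLike.ne_iff.1 h
      have hks : k ∈ s := by
        rw [hs, Finset.mem_union, Finsupp.mem_support_iff, Finsupp.mem_support_iff]
        by_contra! hc
        exact hk (hc.1.trans hc.2.symm)
      exact Finset.prod_eq_zero (Finset.mem_univ ⟨k, hks⟩) (by simp [hk])
  split_ifs at e3 ⊢ <;> exact_mod_cast e3

theorem memLp_chaosVar (hX : IsZeroMeanGaussianField P X)
    (b : HilbertBasis ι ℝ (firstChaos P X)) (α : ι →₀ ℕ) : MemLp (chaosVar b α) 2 P := by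
  classical
  rw [memLp_two_iff_integrable_sq (aestronglyMeasurable_chaosVar b α)]
  refine Integrable.of_integral_ne_zero ?_
  have := integral_chaosVar_mul_chaosVar hX b α α
  simp_rw [← sq] at this
  rw [this]
  simp

theorem integrable_exp_of_mem_firstChaos (hX : IsZeroMeanGaussianField P X)
    {h : Lp ℝ 2 P} (hh : h ∈ firstChaos P X) (t : ℝ) :
    Integrable (fun ω => Real.exp (t * h ω)) P := by
  have h1 := integrable_exp_mul_gaussianReal (μ := 0) (v := ‖h‖₊ ^ 2) t
  rw [← map_of_mem_firstChaos hX hh] at h1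
  exact h1.comp_aemeasurable (Lp.aestronglyMeasurable h).aemeasurable

theorem memLp_cexp_of_mem_firstChaos (hX : IsZeroMeanGaussianField P X)
    {h : Lp ℝ 2 P} (hh : h ∈ firstChaos P X) (z : ℂ) :
    MemLp (fun ω => Complex.exp (z * h ω)) 2 P := by
  have hm : AEStronglyMeasurable (fun ω => Complex.exp (z * h ω)) P :=
    (by fun_prop : Continuous fun x : ℝ => Complex.exp (z * x)).comp_aestronglyMeasurable
      (Lp.aestronglyMeasurable h)
  rw [memLp_two_iff_integrable_sq_norm hm]
  refine (integrable_exp_of_mem_firstChaos hX hh (2 * z.re)).congr (ae_of_all _ fun ω => ?_)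
  simp only [Complex.norm_exp, Complex.mul_re, Complex.ofReal_re, Complex.ofReal_im, mul_zero,
    sub_zero, ← Real.exp_nat_mul]
  push_cast
  ring_nf

theorem integral_cexp_of_mem_firstChaos (hX : IsZeroMeanGaussianField P X)
    {h : Lp ℝ 2 P} (hh : h ∈ firstChaos P X) (z : ℂ) :
    ∫ ω, Complex.exp (z * h ω) ∂P = Complex.exp (z ^ 2 * (‖h‖ ^ 2 : ℝ) / 2) := by
  have := complexMGF_gaussianReal (map_of_mem_firstChaos hX hh) z
  rw [complexMGF] at this
  rw [this]
  congr 1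
  push_cast
  ring

/-- The chaos coefficients of `exp (z h)`, `h` in the first chaos. -/
theorem integral_cexp_mul_chaosVar (hX : IsZeroMeanGaussianField P X)
    (b : HilbertBasis ι ℝ (firstChaos P X)) {h : Lp ℝ 2 P} (hh : h ∈ firstChaos P X)
    (z : ℂ) (α : ι →₀ ℕ) :
    ∫ ω, Complex.exp (z * h ω) * (chaosVar b α ω : ℂ) ∂P
      = Complex.exp (z ^ 2 * (‖h‖ ^ 2 : ℝ) / 2) * z ^ α.degree
        * (multiPow (fun k => inner ℝ (b k : Lp ℝ 2 P) h) α : ℂ) := by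
  classical
  set s := α.support with hs
  set m : ι → ℝ := fun k => inner ℝ (b k : Lp ℝ 2 P) h with hm
  -- The projection of h onto the coordinates that occur in α. The residual h - g is orthogonal to
  -- these coordinates, hence independent of them.
  set g : Lp ℝ 2 P := ∑ k ∈ s, m k • (b k : Lp ℝ 2 P) with hg
  have hgi : ∀ k ∈ s, inner ℝ (b k : Lp ℝ 2 P) g = m k := by
    intro k hk
    rw [hg, inner_sum]
    simp_rw [inner_smul_right, inner_basis_eq]
    simp [hk]
  have hgg : inner ℝ g g = ∑ k ∈ s, m k ^ 2 := by
    conv_lhs => rw [hg]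
    rw [sum_inner]
    refine Finset.sum_congr rfl fun k hk => ?_
    rw [real_inner_smul_left, hgi k hk, sq]
  have hgh : inner ℝ g h = ∑ k ∈ s, m k ^ 2 := by
    rw [hg, sum_inner]
    refine Finset.sum_congr rfl fun k hk => ?_
    rw [real_inner_smul_left, sq]
  have hnorm : ‖h‖ ^ 2 = ‖h - g‖ ^ 2 + ∑ k ∈ s, m k ^ 2 := by
    rw [norm_sub_sq_real, real_inner_comm, hgh, ← real_inner_self_eq_norm_sq g, hgg]
    ring
  -- The index `none` carries the residual. The expectation becomes the residual's exponential
  -- moment times one Hermite-exponential integral per coordinate.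
  let Y : Option s → Lp ℝ 2 P := fun o => o.elim (h - g) fun k => (b k : Lp ℝ 2 P)
  have hY : ∀ i, Y i ∈ firstChaos P X := by
    rintro (_ | k)
    · exact Submodule.sub_mem _ hh
        (Submodule.sum_mem _ fun k _ => Submodule.smul_mem _ _ (b k).2)
    · exact (b k).2
  have ho : ∀ i j, i ≠ j → inner ℝ (Y i) (Y j) = 0 := by
    have h0 : ∀ k ∈ s, inner ℝ (b k : Lp ℝ 2 P) (h - g) = 0 := by
      intro k hk
      rw [inner_sub_right, hgi k hk, sub_self]
    rintro (_ | i) (_ | j) hij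
    · exact absurd rfl hij
    · simp only [Y, Option.elim]
      rw [real_inner_comm]; exact h0 j j.2
    · exact h0 i i.2
    · simp only [Y, Option.elim]
      rw [inner_basis_eq, if_neg]
      exact fun h => hij (congrArg some (Subtype.ext h))
  let f : Option s → ℝ → ℂ := fun o => o.elim (fun x => Complex.exp (z * x)) fun k x =>
    cHermite (α k) x / (√(Nat.factorial (α k) : ℝ) : ℂ) * Complex.exp ((z * m k) * x)
  have hfc : ∀ i, Continuous (f i) := by
    rintro (_ | k)
    · simp only [f, Option.elim]; fun_prop
    · simp only [f, Option.elim]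
      exact ((continuous_cHermite _).div_const _).mul (by fun_prop)
  have e := (iIndepFun_of_mem_firstChaos hX Y hY ho).integral_fun_prod_comp (f := f)
    (fun i => (Lp.aestronglyMeasurable _).aemeasurable) (fun i => (hfc i).aestronglyMeasurable)
  have e1 : (fun ω => Complex.exp (z * h ω) * (chaosVar b α ω : ℂ))
      =ᵐ[P] fun ω => ∏ i, f i (Y i ω) := by
    have hae : ∀ᵐ ω ∂P, h ω = (h - g : Lp ℝ 2 P) ω + ∑ k ∈ s, m k * (b k : Lp ℝ 2 P) ω := by
      have a1 := Lp.coeFn_sub h g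
      have a2 : (g : Ω → ℝ) =ᵐ[P] fun ω => ∑ k ∈ s, m k * (b k : Lp ℝ 2 P) ω := by
        have h1 := Lp.coeFn_finsetSum (p := 2) (μ := P) s fun k => m k • (b k : Lp ℝ 2 P)
        have h2 : ∀ k : s, (m k • (b k : Lp ℝ 2 P) : Lp ℝ 2 P) =ᵐ[P]
          m k • ((b k : Lp ℝ 2 P) : Ω → ℝ) := fun k => Lp.coeFn_smul _ _
        filter_upwards [h1, ae_all_iff.2 h2] with ω h1 h2
        rw [hg, h1, Finset.sum_apply]
        refine Finset.sum_congr rfl fun k hk => ?_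
        rw [h2 ⟨k, hk⟩]
        simp
      filter_upwards [a1, a2] with ω a1 a2
      rw [a1, Pi.sub_apply, a2]
      ring
    filter_upwards [hae] with ω hω
    rw [Fintype.prod_option, chaosVar_eq_prod b subset_rfl, hω]
    simp only [f, Y, Option.elim]
    rw [Finset.prod_mul_distrib, ← Complex.exp_sum]
    push_cast
    rw [mul_add, Complex.exp_add, Finset.mul_sum, ← Finset.prod_coe_sort s,
      ← Finset.sum_coe_sort s]
    simp_rw [mul_assoc]
    ring_nf
  rw [integral_congr_ae e1, e, Fintype.prod_option]
  simp only [f, Y, Option.elim]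
  rw [integral_cexp_of_mem_firstChaos hX (h := h - g) (hY none)]
  have e2 : ∀ k : s, ∫ ω, cHermite (α k) ((b k : Lp ℝ 2 P) ω) / (√(Nat.factorial (α k) : ℝ) : ℂ)
      * Complex.exp ((z * m k) * ((b k : Lp ℝ 2 P) ω : ℝ)) ∂P
      = z ^ α k * (m k ^ α k / √(Nat.factorial (α k) : ℝ) : ℝ)
        * Complex.exp (z ^ 2 * (m k ^ 2 : ℝ) / 2) := by
    intro k
    refine (integral_comp_basis hX b k (hfc (some k))).trans ?_
    have : ∀ x : ℝ, cHermite (α k) x / (√(Nat.factorial (α k) : ℝ) : ℂ)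
      * Complex.exp ((z * m k) * x) = (√(Nat.factorial (α k) : ℝ) : ℂ)⁻¹
        * (cHermite (α k) x * Complex.exp ((z * m k) * x)) := by
      intro x; ring
    simp only [f, Option.elim, this]
    rw [integral_const_mul, integral_cHermite_mul_cexp]
    push_cast
    ring_nf
  simp_rw [e2]
  rw [Finset.prod_coe_sort s fun k => z ^ α k * (m k ^ α k / √(Nat.factorial (α k) : ℝ) : ℝ)
        * Complex.exp (z ^ 2 * (m k ^ 2 : ℝ) / 2), Finset.prod_mul_distrib,
    Finset.prod_mul_distrib, Finset.prod_pow_eq_pow_sum, ← Complex.exp_sum, hnorm]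
  have e3 : ((multiPow m α : ℝ) : ℂ)
      = ∏ k ∈ s, ((m k ^ α k / √(Nat.factorial (α k) : ℝ) : ℝ) : ℂ) := by
    rw [multiPow, Finsupp.prod, Complex.ofReal_prod]
  rw [e3, Finsupp.degree_apply]
  push_cast
  rw [mul_add, add_div, Complex.exp_add, Finset.mul_sum, Finset.sum_div]
  ring

end ChaosVar

end GaussField

namespace GaussField

/-! ### Sums over boxes of multi-indices -/

section Box

variable {ι : Type*}

/-- The multi-indices supported in `s` with all entries below `n`. -/
def multiBox (s : Finset ι) (n : ℕ) : Finset (ι →₀ ℕ) := s.finsupp fun _ => Finset.range n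

theorem support_subset_of_mem_multiBox {s : Finset ι} {n : ℕ} {α : ι →₀ ℕ}
    (h : α ∈ multiBox s n) : α.support ⊆ s :=
  (Finset.mem_finsupp_iff.1 h).1

theorem sum_multiBox_prod (s : Finset ι) (n : ℕ) (f : ι → ℕ → ℝ) :
    ∑ α ∈ multiBox s n, ∏ k ∈ s, f k (α k) = ∏ k ∈ s, ∑ j ∈ Finset.range n, f k j := by
  classical
  rw [Finset.prod_sum, multiBox, Finset.finsupp, Finset.sum_map]
  refine Finset.sum_congr rfl fun p hp => ?_
  rw [← Finset.prod_attach]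
  refine Finset.prod_congr rfl fun k _ => ?_
  simp [Finsupp.indicator_of_mem k.2]

theorem multiPow_eq_prod (m : ι → ℝ) {α : ι →₀ ℕ} {s : Finset ι} (h : α.support ⊆ s) :
    multiPow m α = ∏ k ∈ s, m k ^ α k / √(Nat.factorial (α k) : ℝ) :=
  Finsupp.prod_of_support_subset α h _ fun i _ => by simp

theorem multiPow_const_mul (c : ℝ) (m : ι → ℝ) (α : ι →₀ ℕ) :
    multiPow (fun k => c * m k) α = c ^ α.degree * multiPow m α := by
  rw [multiPow_eq_prod _ subset_rfl, multiPow_eq_prod _ subset_rfl, Finsupp.degree_apply,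
    ← Finset.prod_pow_eq_pow_sum, ← Finset.prod_mul_distrib]
  refine Finset.prod_congr rfl fun k _ => ?_
  rw [mul_pow, mul_div_assoc]

theorem sum_multiBox_multiPow_sq (m : ι → ℝ) (s : Finset ι) (n : ℕ) :
    ∑ α ∈ multiBox s n, multiPow m α ^ 2
      = ∏ k ∈ s, ∑ j ∈ Finset.range n, (m k ^ 2) ^ j / (Nat.factorial j : ℝ) := by
  rw [← sum_multiBox_prod]
  refine Finset.sum_congr rfl fun α hα => ?_
  rw [multiPow_eq_prod m (support_subset_of_mem_multiBox hα), ← Finset.prod_pow]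
  refine Finset.prod_congr rfl fun k _ => ?_
  rw [div_pow, Real.sq_sqrt (by positivity), ← pow_mul, ← pow_mul, mul_comm 2]

/-- A box sum factors into partial sums of exponential series. This is the Parseval sum of a
stochastic exponential, restricted to finitely many coordinates; it serves both completeness and the
necessity of the condition on a and σ. -/
theorem tendsto_sum_multiBox (m : ι → ℝ) (s : Finset ι) :
    Tendsto (fun n => ∑ α ∈ multiBox s n, multiPow m α ^ 2) atTop
      (𝓝 (Real.exp (∑ k ∈ s, m k ^ 2))) := by
  simp_rw [sum_multiBox_multiPow_sq]
  rw [Real.exp_sum]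
  refine tendsto_finsetProd _ fun k _ => ?_
  rw [Real.exp_eq_exp_ℝ]
  exact (NormedSpace.expSeries_div_hasSum_exp (m k ^ 2)).tendsto_sum_nat

end Box

/-- The exact remainder in Bessel's inequality, needed to see that the remainder of exp(ih) tends to
zero. -/
theorem norm_sub_sum_inner_sq {𝕜 E ι : Type*} [RCLike 𝕜] [NormedAddCommGroup E]
    [InnerProductSpace 𝕜 E] {v : ι → E} (hv : Orthonormal 𝕜 v) (x : E) (s : Finset ι) :
    ‖x - ∑ i ∈ s, inner 𝕜 (v i) x • v i‖ ^ 2 = ‖x‖ ^ 2 - ∑ i ∈ s, ‖inner 𝕜 (v i) x‖ ^ 2 := by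
  have h₂ : (∑ i ∈ s, ∑ j ∈ s, inner 𝕜 (v i) x * inner 𝕜 x (v j) * inner 𝕜 (v j) (v i))
      = (∑ k ∈ s, inner 𝕜 (v k) x * inner 𝕜 x (v k) : 𝕜) :=
    hv.inner_left_right_finset
  have h₃ : ∀ z : 𝕜, RCLike.re (z * (starRingEnd 𝕜) z) = ‖z‖ ^ 2 := by
    intro z
    simp only [RCLike.mul_conj]
    norm_cast
  rw [@norm_sub_sq 𝕜, sub_add]
  simp only [@InnerProductSpace.norm_sq_eq_re_inner 𝕜 E, inner_sum, sum_inner]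
  simp only [inner_smul_right, two_mul, inner_smul_left, inner_conj_symm, ← mul_assoc, h₂,
    add_sub_cancel_right, sub_right_inj]
  simp only [map_sum, ← inner_conj_symm x, ← h₃]

section Completeness

variable {Ω H : Type*} [MeasurableSpace Ω] {P : Measure Ω} [NormedAddCommGroup H]
  [NormedSpace ℝ H] {X : H → Ω → ℝ} {ι : Type*} [IsProbabilityMeasure P]

/-! ### Completeness of the chaos basis -/

omit [IsProbabilityMeasure P] in
theorem inner_ofReal_compLp (f : Lp ℝ 2 P) (g : Lp ℂ 2 P) :
    inner ℂ (Complex.ofRealCLM.compLp f) g = ∫ ω, (f ω : ℂ) * g ω ∂P := by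
  rw [L2.inner_def]
  refine integral_congr_ae ?_
  filter_upwards [Complex.ofRealCLM.coeFn_compLp f] with ω h
  rw [h]
  simp [mul_comm]

/-- The random variable `ξ_α` as an element of `L₂(Ω)`. -/
def chaosLp (hX : IsZeroMeanGaussianField P X) (b : HilbertBasis ι ℝ (firstChaos P X))
    (α : ι →₀ ℕ) : Lp ℝ 2 P :=
  (memLp_chaosVar hX b α).toLp (chaosVar b α)

theorem coeFn_chaosLp (hX : IsZeroMeanGaussianField P X)
    (b : HilbertBasis ι ℝ (firstChaos P X)) (α : ι →₀ ℕ) :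
    chaosLp hX b α =ᵐ[P] chaosVar b α :=
  (memLp_chaosVar hX b α).coeFn_toLp

theorem inner_chaosLp (hX : IsZeroMeanGaussianField P X)
    (b : HilbertBasis ι ℝ (firstChaos P X)) (α : ι →₀ ℕ) (ζ : Lp ℝ 2 P) :
    inner ℝ (chaosLp hX b α) ζ = chaosCoeff b ζ α := by
  rw [L2.inner_def, chaosCoeff]
  refine integral_congr_ae ?_
  filter_upwards [coeFn_chaosLp hX b α] with ω h
  rw [h]
  simp

omit [NormedAddCommGroup H] [NormedSpace ℝ H] [IsProbabilityMeasure P] in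
theorem chaosCoeff_congr (b : HilbertBasis ι ℝ (firstChaos P X)) {ζ η : Ω → ℝ}
    (h : ζ =ᵐ[P] η) (α : ι →₀ ℕ) : chaosCoeff b ζ α = chaosCoeff b η α := by
  refine integral_congr_ae ?_
  filter_upwards [h] with ω h
  rw [h]

theorem orthonormal_chaosLp (hX : IsZeroMeanGaussianField P X)
    (b : HilbertBasis ι ℝ (firstChaos P X)) : Orthonormal ℝ (chaosLp hX b) := by
  classical
  rw [orthonormal_iff_ite]
  intro α β
  rw [inner_chaosLp, chaosCoeff_congr b (coeFn_chaosLp hX b β), chaosCoeff]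
  simp_rw [mul_comm (chaosVar b β _)]
  exact integral_chaosVar_mul_chaosVar hX b α β

theorem orthonormal_ofReal_chaosLp (hX : IsZeroMeanGaussianField P X)
    (b : HilbertBasis ι ℝ (firstChaos P X)) :
    Orthonormal ℂ fun α => Complex.ofRealCLM.compLp (chaosLp hX b α) := by
  classical
  rw [orthonormal_iff_ite]
  intro α β
  rw [inner_ofReal_compLp]
  have h : ∫ ω, ((chaosLp hX b α ω : ℝ) : ℂ) * (Complex.ofRealCLM.compLp (chaosLp hX b β) ω) ∂P
      = ((inner ℝ (chaosLp hX b α) (chaosLp hX b β) : ℝ) : ℂ) := by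
    rw [L2.inner_def, ← integral_complex_ofReal]
    refine integral_congr_ae ?_
    filter_upwards [Complex.ofRealCLM.coeFn_compLp (chaosLp hX b β)] with ω h
    rw [h]
    simp [mul_comm]
  rw [h, orthonormal_iff_ite.1 (orthonormal_chaosLp hX b)]
  split_ifs <;> simp

omit [NormedAddCommGroup H] [NormedSpace ℝ H] [IsProbabilityMeasure P] in
theorem hasSum_inner_basis_sq (b : HilbertBasis ι ℝ (firstChaos P X)) {h : Lp ℝ 2 P}
    (hh : h ∈ firstChaos P X) :
    HasSum (fun k => inner ℝ (b k : Lp ℝ 2 P) h ^ 2) (‖h‖ ^ 2) := by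
  have := b.hasSum_inner_mul_inner ⟨h, hh⟩ ⟨h, hh⟩
  rw [real_inner_self_eq_norm_sq] at this
  refine this.congr_fun fun k => ?_
  rw [real_inner_comm (b k) ⟨h, hh⟩, sq, Submodule.coe_inner]

/-- A square-integrable variable without chaos coefficients is orthogonal to `exp (i h)`. -/
theorem integral_mul_cexp_eq_zero (hX : IsZeroMeanGaussianField P X)
    (b : HilbertBasis ι ℝ (firstChaos P X)) {ζ : Lp ℝ 2 P} (hζ : ∀ α, chaosCoeff b ζ α = 0)
    {h : Lp ℝ 2 P} (hh : h ∈ firstChaos P X) :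
    ∫ ω, (ζ ω : ℂ) * Complex.exp (Complex.I * h ω) ∂P = 0 := by
  set m : ι → ℝ := fun k => inner ℝ (b k : Lp ℝ 2 P) h with hm
  have hL := memLp_cexp_of_mem_firstChaos hX hh Complex.I
  set f : Lp ℂ 2 P := hL.toLp _ with hf
  have hfae : f =ᵐ[P] fun ω => Complex.exp (Complex.I * h ω) := hL.coeFn_toLp
  set ζc : Lp ℂ 2 P := Complex.ofRealCLM.compLp ζ with hζc
  set v : (ι →₀ ℕ) → Lp ℂ 2 P := fun α => Complex.ofRealCLM.compLp (chaosLp hX b α) with hv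
  have hgoal : ∫ ω, (ζ ω : ℂ) * Complex.exp (Complex.I * h ω) ∂P = inner ℂ ζc f := by
    rw [hζc, inner_ofReal_compLp]
    refine integral_congr_ae ?_
    filter_upwards [hfae] with ω h1
    rw [h1]
  have hnormf : ‖f‖ ^ 2 = 1 := by
    have h1 : inner ℂ f f = (1 : ℂ) := by
      rw [L2.inner_def]
      have : ∀ᵐ ω ∂P, inner ℂ (f ω) (f ω) = (1 : ℂ) := by
        filter_upwards [hfae] with ω h1
        rw [h1, inner_self_eq_norm_sq_to_K, mul_comm, Complex.norm_exp_ofReal_mul_I]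
        simp
      rw [integral_congr_ae this]
      simp
    rw [← inner_self_eq_norm_sq (𝕜 := ℂ), h1]
    simp
  -- At z = i the factor z^{|α|} has modulus one, so only the Gaussian factor and the monomial
  -- survive.
  have hcoef : ∀ α, ‖inner ℂ (v α) f‖ ^ 2 = Real.exp (-‖h‖ ^ 2) * multiPow m α ^ 2 := by
    intro α
    have h1 : inner ℂ (v α) f = Complex.exp (Complex.I ^ 2 * (‖h‖ ^ 2 : ℝ) / 2)
        * Complex.I ^ α.degree * (multiPow m α : ℂ) := by
      rw [hv, inner_ofReal_compLp, ← integral_cexp_mul_chaosVar hX b hh]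
      refine integral_congr_ae ?_
      filter_upwards [hfae, coeFn_chaosLp hX b α] with ω h1 h2
      rw [h1, h2, mul_comm]
    have h2 : Complex.exp (Complex.I ^ 2 * (‖h‖ ^ 2 : ℝ) / 2)
        = ((Real.exp (-‖h‖ ^ 2 / 2) : ℝ) : ℂ) := by
      rw [Complex.ofReal_exp, Complex.I_sq]; push_cast; ring_nf
    rw [h1, norm_mul, norm_mul, norm_pow, Complex.norm_I, one_pow, mul_one, mul_pow, h2,
      Complex.norm_real, Complex.norm_real, Real.norm_eq_abs, Real.norm_eq_abs, sq_abs, sq_abs,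
      ← Real.exp_nat_mul]
    congr 2
    push_cast; ring
  have hort : ∀ α, inner ℂ ζc (v α) = 0 := by
    intro α
    rw [hζc, inner_ofReal_compLp]
    have : ∫ ω, (ζ ω : ℂ) * (v α ω) ∂P = ((chaosCoeff b ζ α : ℝ) : ℂ) := by
      rw [chaosCoeff, ← integral_complex_ofReal]
      refine integral_congr_ae ?_
      filter_upwards [Complex.ofRealCLM.coeFn_compLp (chaosLp hX b α), coeFn_chaosLp hX b α]
        with ω h1 h2
      rw [hv, h1, h2]
      simp
    rw [this, hζ, Complex.ofReal_zero]
  -- ζ is orthogonal to every chaos partial sum of f = exp(ih), so it may be paired with the Bessel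
  -- remainder alone, by Cauchy–Schwarz.
  have hbound : ∀ A : Finset (ι →₀ ℕ), ‖inner ℂ ζc f‖ ^ 2
      ≤ ‖ζc‖ ^ 2 * (1 - Real.exp (-‖h‖ ^ 2) * ∑ α ∈ A, multiPow m α ^ 2) := by
    intro A
    have h1 := norm_sub_sum_inner_sq (orthonormal_ofReal_chaosLp hX b) f A
    have h2 : inner ℂ ζc f = inner ℂ ζc (f - ∑ α ∈ A, inner ℂ (v α) f • v α) := by
      rw [inner_sub_right, inner_sum]
      simp_rw [inner_smul_right, hort]
      simp
    rw [h2, Finset.mul_sum]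
    simp_rw [← hcoef]
    rw [← hnormf, ← h1, ← mul_pow]
    gcongr
    exact norm_inner_le_norm _ _
  -- First the box height tends to infinity for fixed s, then s exhausts the basis. By Parseval ∑
  -- m_k² tends to ‖h‖², and the remainder vanishes.
  have hb2 : ∀ s : Finset ι, ‖inner ℂ ζc f‖ ^ 2
      ≤ ‖ζc‖ ^ 2 * (1 - Real.exp (-‖h‖ ^ 2) * Real.exp (∑ k ∈ s, m k ^ 2)) := fun s =>
    ge_of_tendsto' (((tendsto_sum_multiBox m s).const_mul _).const_sub 1 |>.const_mul _)
      fun n => hbound (multiBox s n)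
  have hb3 : ‖inner ℂ ζc f‖ ^ 2 ≤ ‖ζc‖ ^ 2 * (1 - Real.exp (-‖h‖ ^ 2) * Real.exp (‖h‖ ^ 2)) := by
    have ht : Tendsto (fun s : Finset ι => ∑ k ∈ s, m k ^ 2) atTop (𝓝 (‖h‖ ^ 2)) :=
      hasSum_inner_basis_sq b hh
    exact ge_of_tendsto' ((((Real.continuous_exp.tendsto _).comp ht).const_mul _).const_sub 1
      |>.const_mul _) hb2
  rw [← Real.exp_add, neg_add_cancel, Real.exp_zero, sub_self, mul_zero] at hb3
  rw [hgoal, ← norm_eq_zero]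
  exact pow_eq_zero_iff two_ne_zero |>.1 (le_antisymm hb3 (by positivity))

/-- Splitting the signed measure ζ dμ into two finite positive measures makes uniqueness theorems
for measures applicable to it. -/
theorem integral_withDensity_sub {μ : Measure Ω} [IsFiniteMeasure μ] {ζ : Ω → ℝ}
    (hm : Measurable ζ) (hi : Integrable ζ μ) {g : Ω → ℂ} (hg : AEStronglyMeasurable g μ) {C : ℝ}
    (hb : ∀ ω, ‖g ω‖ ≤ C) :
    ∫ ω, g ω ∂(μ.withDensity fun ω => ENNReal.ofReal (ζ ω))
      - ∫ ω, g ω ∂(μ.withDensity fun ω => ENNReal.ofReal (-ζ ω)) = ∫ ω, (ζ ω : ℂ) * g ω ∂μ := by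
  have key : ∀ η : Ω → ℝ, Measurable η → Integrable η μ →
      Integrable (fun ω => (ENNReal.ofReal (η ω)).toReal • g ω) μ := by
    intro η hη hηi
    have h1 : Integrable (fun ω => max (η ω) 0) μ := hηi.pos_part
    have : Integrable (fun ω => g ω * ((max (η ω) 0 : ℝ) : ℂ)) μ :=
      h1.ofReal.bdd_mul hg (ae_of_all _ hb)
    refine this.congr (ae_of_all _ fun ω => ?_)
    simp [ENNReal.toReal_ofReal', mul_comm]
  rw [integral_withDensity_eq_integral_toReal_smul (by fun_prop) (ae_of_all _ fun _ => by simp),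
    integral_withDensity_eq_integral_toReal_smul (by fun_prop) (ae_of_all _ fun _ => by simp),
    ← integral_sub (key ζ hm hi) (key (fun ω => -ζ ω) hm.neg hi.neg)]
  congr 1
  ext ω
  rw [← sub_smul, ENNReal.toReal_ofReal', ENNReal.toReal_ofReal', max_zero_sub_max_neg_zero_eq_self]
  simp

omit [MeasurableSpace Ω] [NormedAddCommGroup H] [NormedSpace ℝ H] in
theorem fieldSigma_eq_comap (X : H → Ω → ℝ) :
    fieldSigma X = MeasurableSpace.comap (fun ω f => X f ω) MeasurableSpace.pi := by
  rw [MeasurableSpace.pi, MeasurableSpace.comap_iSup]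
  simp_rw [MeasurableSpace.comap_comp]
  rfl

/-- The Cameron–Martin theorem: the chaos coefficients determine a square-integrable random
variable that is measurable with respect to the field. -/
theorem eq_zero_of_chaosCoeff_eq_zero [CompleteSpace H] (hX : IsZeroMeanGaussianField P X)
    (b : HilbertBasis ι ℝ (firstChaos P X)) {ζ : Lp ℝ 2 P} (hζm : ζ ∈ chaosSpaceOf ℝ P X)
    (hζ : ∀ α, chaosCoeff b ζ α = 0) : ζ = 0 := by
  classical
  have hmeas : Measurable (ζ : Ω → ℝ) := (Lp.stronglyMeasurable ζ).measurable
  have hint : Integrable (ζ : Ω → ℝ) P := (Lp.memLp ζ).integrable one_le_two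
  set νp := P.withDensity fun ω => ENNReal.ofReal (ζ ω) with hνp
  set νm := P.withDensity fun ω => ENNReal.ofReal (-ζ ω) with hνm
  have : IsFiniteMeasure νp := isFiniteMeasure_withDensity_ofReal hint.2
  have : IsFiniteMeasure νm := isFiniteMeasure_withDensity_ofReal hint.neg.2
  set Φ : Ω → H → ℝ := fun ω f => X f ω with hΦ
  have hΦm : Measurable Φ := measurable_pi_lambda _ hX.measurable
  -- The difference of the two characteristic functions at L is E(ζ e^{ih}), with h a linear
  -- combination of field values; it vanishes since ζ has no chaos coefficients.
  have hfin : ∀ I : Finset H, (νp.map Φ).map I.restrict = (νm.map Φ).map I.restrict := by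
    intro I
    have hr : Measurable (I.restrict (π := fun _ : H => ℝ)) := Finset.measurable_restrict I
    refine Measure.ext_of_charFunDual (funext fun L => ?_)
    rw [charFunDual_apply, charFunDual_apply, Measure.map_map hr hΦm, Measure.map_map hr hΦm,
      integral_map (hr.comp hΦm).aemeasurable (by fun_prop),
      integral_map (hr.comp hΦm).aemeasurable (by fun_prop), ← sub_eq_zero,
      integral_withDensity_sub hmeas hint (C := 1)]
    · set h : Lp ℝ 2 P := ∑ i : I, L (Pi.single i 1) • fieldCLM hX i with hh
      have hmem : h ∈ firstChaos P X := Submodule.sum_mem _ fun i _ =>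
        Submodule.smul_mem _ _ (fieldCLM_mem_firstChaos hX _)
      rw [← integral_mul_cexp_eq_zero hX b hζ hmem]
      refine integral_congr_ae ?_
      have h1 := strongDual_pi_ae_eq L (fun i : I => fieldCLM hX (i : H))
      have h2 : ∀ i : I, fieldCLM hX (i : H) =ᵐ[P] X i := fun i => coeFn_fieldCLM hX _
      filter_upwards [h1, ae_all_iff.2 h2] with ω h1 h2
      have h3 : (I.restrict ∘ Φ) ω = fun i : I => fieldCLM hX (i : H) ω := by
        ext i; rw [h2]; rfl
      rw [h3, h1, mul_comm Complex.I]
    · have : Measurable fun ω => L ((I.restrict ∘ Φ) ω) :=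
        L.continuous.measurable.comp (hr.comp hΦm)
      exact (by fun_prop : Measurable fun ω => Complex.exp (L ((I.restrict ∘ Φ) ω) * Complex.I)
        ).aestronglyMeasurable
    · intro ω
      rw [Complex.norm_exp_ofReal_mul_I]
  -- Finite-dimensional marginals determine a finite measure on the product space, so ζ integrates
  -- to zero over every event generated by the field.
  have heq : νp.map Φ = νm.map Φ :=
    IsProjectiveLimit.unique (P := fun I => (νm.map Φ).map I.restrict) hfin fun I => rfl
  have hz := lpMeas.ae_eq_zero_of_forall_setIntegral_eq_zero (𝕜 := ℝ) (fieldSigma_le hX)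
    ⟨ζ, hζm⟩ two_ne_zero ENNReal.ofNat_ne_top (fun s _ _ => hint.integrableOn) (by
      intro s hs _
      rw [fieldSigma_eq_comap] at hs
      obtain ⟨A, hA, rfl⟩ := hs
      have h1 : ∫ x, A.indicator (fun _ => (1 : ℂ)) x ∂(νp.map Φ)
          = ∫ x, A.indicator (fun _ => (1 : ℂ)) x ∂(νm.map Φ) := by rw [heq]
      have hA1 : Measurable (A.indicator fun _ => (1 : ℂ)) := measurable_const.indicator hA
      rw [integral_map hΦm.aemeasurable hA1.aestronglyMeasurable,
        integral_map hΦm.aemeasurable hA1.aestronglyMeasurable, ← sub_eq_zero,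
        integral_withDensity_sub hmeas hint (g := fun ω => A.indicator (fun _ => (1 : ℂ)) (Φ ω))
          (hA1.comp hΦm).aestronglyMeasurable (C := 1)] at h1
      · have h2 : ∀ ω, (ζ ω : ℂ) * A.indicator (fun _ => (1 : ℂ)) (Φ ω)
            = (((Φ ⁻¹' A).indicator (fun ω => ζ ω) ω : ℝ) : ℂ) := by
          intro ω
          by_cases h : Φ ω ∈ A
          · rw [indicator_of_mem h, indicator_of_mem (show ω ∈ Φ ⁻¹' A from h), mul_one]
          · rw [indicator_of_notMem h, indicator_of_notMem (show ω ∉ Φ ⁻¹' A from h)]; simp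
        simp only [h2] at h1
        rw [integral_complex_ofReal, integral_indicator (hΦm hA)] at h1
        exact_mod_cast h1
      · intro ω
        by_cases h : Φ ω ∈ A <;> simp [h])
  exact Lp.ext (hz.trans (Lp.coeFn_zero _ _ _).symm)

theorem eq_of_chaosCoeff_eq [CompleteSpace H] (hX : IsZeroMeanGaussianField P X)
    (b : HilbertBasis ι ℝ (firstChaos P X)) {ζ η : Lp ℝ 2 P} (hζm : ζ ∈ chaosSpaceOf ℝ P X)
    (hηm : η ∈ chaosSpaceOf ℝ P X) (h : ∀ α, chaosCoeff b ζ α = chaosCoeff b η α) : ζ = η := by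
  rw [← sub_eq_zero]
  refine eq_zero_of_chaosCoeff_eq_zero hX b (Submodule.sub_mem _ hζm hηm) fun α => ?_
  rw [← inner_chaosLp hX, inner_sub_right, inner_chaosLp, inner_chaosLp, h, sub_self]

end Completeness

end GaussField

namespace GaussField

/-- Expand ‖F x - F y‖² into inner products. The criterion suits `chi`, `wickExp`, `heatShift` and
`heatSolution`, whose inner products are explicit. -/
theorem continuous_of_continuous_inner {α E : Type*} [TopologicalSpace α] [NormedAddCommGroup E]
    [InnerProductSpace ℝ E] {F : α → E}
    (h : Continuous fun p : α × α => inner ℝ (F p.1) (F p.2)) : Continuous F := by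
  rw [continuous_iff_continuousAt]
  intro y
  rw [ContinuousAt, tendsto_iff_norm_sub_tendsto_zero]
  have h1 : Continuous fun x => √(inner ℝ (F x) (F x) - 2 * inner ℝ (F x) (F y)
      + inner ℝ (F y) (F y)) := by
    have a1 : Continuous fun x => inner ℝ (F x) (F x) := h.comp (continuous_id.prodMk continuous_id)
    have a2 : Continuous fun x => inner ℝ (F x) (F y) := h.comp (continuous_id.prodMk continuous_const)
    fun_prop
  have h2 := h1.tendsto y
  have h3 : inner ℝ (F y) (F y) - 2 * inner ℝ (F y) (F y) + inner ℝ (F y) (F y) = (0 : ℝ) := by ring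
  rw [h3, Real.sqrt_zero] at h2
  refine h2.congr fun x => ?_
  rw [← real_inner_sub_sub_self, real_inner_self_eq_norm_sq, Real.sqrt_sq (norm_nonneg _)]

section WickExponential

variable {Ω H : Type*} [MeasurableSpace Ω] {P : Measure Ω} [NormedAddCommGroup H]
  [NormedSpace ℝ H] {X : H → Ω → ℝ} {ι : Type*} [IsProbabilityMeasure P]

/-! ### Stochastic exponentials -/

theorem memLp_exp_of_mem_firstChaos (hX : IsZeroMeanGaussianField P X) {h : Lp ℝ 2 P}
    (hh : h ∈ firstChaos P X) (c : ℝ) : MemLp (fun ω => Real.exp (h ω - c)) 2 P := by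
  have hm : AEStronglyMeasurable (fun ω => Real.exp (h ω - c)) P :=
    (by fun_prop : Continuous fun x : ℝ => Real.exp (x - c)).comp_aestronglyMeasurable
      (Lp.aestronglyMeasurable h)
  rw [memLp_two_iff_integrable_sq hm]
  refine ((integrable_exp_of_mem_firstChaos hX hh 2).const_mul (Real.exp (-2 * c))).congr
    (ae_of_all _ fun ω => ?_)
  simp only [sq, ← Real.exp_add]
  ring_nf

/-- The stochastic exponential `exp (h - ‖h‖² / 2)`. -/
def wickExp (hX : IsZeroMeanGaussianField P X) (h : firstChaos P X) : Lp ℝ 2 P :=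
  (memLp_exp_of_mem_firstChaos hX h.2 (‖h‖ ^ 2 / 2)).toLp _

theorem coeFn_wickExp (hX : IsZeroMeanGaussianField P X) (h : firstChaos P X) :
    wickExp hX h =ᵐ[P] fun ω => Real.exp ((h : Lp ℝ 2 P) ω - ‖h‖ ^ 2 / 2) :=
  (memLp_exp_of_mem_firstChaos hX h.2 (‖h‖ ^ 2 / 2)).coeFn_toLp

theorem integral_exp_of_mem_firstChaos (hX : IsZeroMeanGaussianField P X) {h : Lp ℝ 2 P}
    (hh : h ∈ firstChaos P X) : ∫ ω, Real.exp (h ω) ∂P = Real.exp (‖h‖ ^ 2 / 2) := by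
  have h1 := integral_cexp_of_mem_firstChaos hX hh 1
  have h2 : ∀ ω, Complex.exp (1 * h ω) = ((Real.exp (h ω) : ℝ) : ℂ) := fun ω => by
    rw [one_mul, Complex.ofReal_exp]
  simp_rw [h2] at h1
  rw [integral_complex_ofReal] at h1
  have h3 : Complex.exp (1 ^ 2 * (‖h‖ ^ 2 : ℝ) / 2) = ((Real.exp (‖h‖ ^ 2 / 2) : ℝ) : ℂ) := by
    rw [Complex.ofReal_exp]; push_cast; ring_nf
  rw [h3] at h1
  exact_mod_cast h1

/-- E exp(h + g) = exp(‖h + g‖²/2), and the two normalisations cancel everything but the cross term.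
-/
theorem inner_wickExp (hX : IsZeroMeanGaussianField P X) (h g : firstChaos P X) :
    inner ℝ (wickExp hX h) (wickExp hX g) = Real.exp (inner ℝ h g) := by
  rw [L2.inner_def]
  have h1 : (fun ω => inner ℝ (wickExp hX h ω) (wickExp hX g ω)) =ᵐ[P]
      fun ω => Real.exp (-‖h‖ ^ 2 / 2 - ‖g‖ ^ 2 / 2)
        * Real.exp (((h + g : firstChaos P X) : Lp ℝ 2 P) ω) := by
    filter_upwards [coeFn_wickExp hX h, coeFn_wickExp hX g,
      Lp.coeFn_add (h : Lp ℝ 2 P) (g : Lp ℝ 2 P)] with ω h1 h2 h3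
    rw [h1, h2, Submodule.coe_add, h3, Pi.add_apply, ← Real.exp_add]
    simp only [RCLike.inner_apply, conj_trivial, ← Real.exp_add]
    ring_nf
  rw [integral_congr_ae h1, integral_const_mul, integral_exp_of_mem_firstChaos hX (h + g).2,
    ← Real.exp_add]
  have h2 : ‖((h + g : firstChaos P X) : Lp ℝ 2 P)‖ = ‖h + g‖ := rfl
  rw [h2, norm_add_sq_real]
  ring_nf

theorem continuous_wickExp (hX : IsZeroMeanGaussianField P X) : Continuous (wickExp hX) := by
  refine continuous_of_continuous_inner ?_
  simp_rw [inner_wickExp]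
  fun_prop

/-- The case z = 1 of `integral_cexp_mul_chaosVar`: the normalisation exp(-‖h‖²/2) cancels the
Gaussian factor. -/
theorem chaosCoeff_wickExp (hX : IsZeroMeanGaussianField P X)
    (b : HilbertBasis ι ℝ (firstChaos P X)) (h : firstChaos P X) (α : ι →₀ ℕ) :
    chaosCoeff b (wickExp hX h) α = multiPow (fun k => inner ℝ (b k) h) α := by
  have h1 := integral_cexp_mul_chaosVar hX b h.2 1 α
  have h2 : ((chaosCoeff b (wickExp hX h) α : ℝ) : ℂ)
      = Complex.exp (-(‖h‖ ^ 2 / 2 : ℝ))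
        * ∫ ω, Complex.exp (1 * (h : Lp ℝ 2 P) ω) * (chaosVar b α ω : ℂ) ∂P := by
    rw [chaosCoeff, ← integral_complex_ofReal, ← integral_const_mul]
    refine integral_congr_ae ?_
    filter_upwards [coeFn_wickExp hX h] with ω h1
    rw [h1, sub_eq_add_neg, Real.exp_add]
    push_cast
    ring_nf
  rw [h1, one_pow, one_pow, mul_one, one_mul, ← mul_assoc, ← Complex.exp_add] at h2
  have h3 : ((-(‖h‖ ^ 2 / 2 : ℝ) : ℝ) : ℂ) + ((‖(h : Lp ℝ 2 P)‖ ^ 2 : ℝ) : ℂ) / 2 = 0 := by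
    rw [Submodule.coe_norm]; push_cast; ring
  rw [← Complex.ofReal_neg] at h2
  rw [h3, Complex.exp_zero, one_mul] at h2
  exact_mod_cast h2

end WickExponential

/-! ### Chaos coefficients of the field and of the Skorokhod integral -/

section Skorokhod

variable {Ω H : Type*} [MeasurableSpace Ω] {P : Measure Ω} [NormedAddCommGroup H]
  [NormedSpace ℝ H] [CompleteSpace H] {X : H → Ω → ℝ} {ι : Type*} [IsProbabilityMeasure P]

omit [NormedAddCommGroup H] [NormedSpace ℝ H] [CompleteSpace H] [IsProbabilityMeasure P] in
theorem chaosVar_single_one (b : HilbertBasis ι ℝ (firstChaos P X)) (k : ι) (ω : Ω) :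
    chaosVar b (Finsupp.single k 1) ω = (b k : Lp ℝ 2 P) ω := by
  rw [chaosVar, Finsupp.prod_single_index (by simp)]
  simp

omit [CompleteSpace H] in
theorem chaosLp_single_one (hX : IsZeroMeanGaussianField P X)
    (b : HilbertBasis ι ℝ (firstChaos P X)) (k : ι) :
    chaosLp hX b (Finsupp.single k 1) = (b k : Lp ℝ 2 P) := by
  refine Lp.ext ((coeFn_chaosLp hX b _).trans (ae_of_all _ fun ω => ?_))
  exact chaosVar_single_one b k ω

omit [CompleteSpace H] in
/-- The elements of the first chaos have no coefficients outside order one. -/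
theorem chaosCoeff_eq_zero_of_mem_firstChaos (hX : IsZeroMeanGaussianField P X)
    (b : HilbertBasis ι ℝ (firstChaos P X)) {h : Lp ℝ 2 P} (hh : h ∈ firstChaos P X)
    {β : ι →₀ ℕ} (hβ : ∀ k, β ≠ Finsupp.single k 1) : chaosCoeff b h β = 0 := by
  classical
  have h1 : HasSum (fun k => b.repr ⟨h, hh⟩ k • b k) ⟨h, hh⟩ := b.hasSum_repr _
  have h2 : HasSum (fun k => b.repr ⟨h, hh⟩ k • (b k : Lp ℝ 2 P)) h :=
    h1.map (firstChaos P X).subtype continuous_subtype_val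
  have h3 := h2.map (innerSL ℝ (chaosLp hX b β)) (innerSL ℝ (chaosLp hX b β)).continuous
  rw [← inner_chaosLp hX]
  refine h3.unique ?_
  convert hasSum_zero using 2 with k
  simp only [Function.comp, innerSL_apply_apply, inner_smul_right]
  rw [← chaosLp_single_one hX b k, orthonormal_iff_ite.1 (orthonormal_chaosLp hX b),
    if_neg (hβ k), mul_zero]

theorem chaosCoeff_field_single (hX : IsZeroMeanGaussianField P X)
    (b : HilbertBasis ι ℝ (firstChaos P X)) (f : H) (k : ι) :
    chaosCoeff b (X f) (Finsupp.single k 1) = inner ℝ (b k : Lp ℝ 2 P) (fieldCLM hX f) := by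
  rw [← chaosCoeff_congr b (coeFn_fieldCLM hX f), ← inner_chaosLp hX, chaosLp_single_one]

theorem chaosCoeff_field_eq_zero (hX : IsZeroMeanGaussianField P X)
    (b : HilbertBasis ι ℝ (firstChaos P X)) (f : H) {β : ι →₀ ℕ}
    (hβ : ∀ k, β ≠ Finsupp.single k 1) : chaosCoeff b (X f) β = 0 := by
  rw [← chaosCoeff_congr b (coeFn_fieldCLM hX f)]
  exact chaosCoeff_eq_zero_of_mem_firstChaos hX b (fieldCLM_mem_firstChaos hX f) hβ

omit [CompleteSpace H] in
theorem chaosCoeff_chaosVar (hX : IsZeroMeanGaussianField P X)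
    (b : HilbertBasis ι ℝ (firstChaos P X)) [DecidableEq ι] (α β : ι →₀ ℕ) :
    chaosCoeff b (chaosVar b α) β = if α = β then 1 else 0 :=
  integral_chaosVar_mul_chaosVar hX b α β

theorem multiFactorial_eq_prod {α : ι →₀ ℕ} {s : Finset ι} (h : α.support ⊆ s) :
    multiFactorial α = ∏ k ∈ s, Nat.factorial (α k) :=
  Finsupp.prod_of_support_subset α h _ fun i _ => by simp

theorem multiFactorial_ne_zero (α : ι →₀ ℕ) : multiFactorial α ≠ 0 := by
  rw [multiFactorial_eq_prod subset_rfl]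
  exact Finset.prod_ne_zero_iff.2 fun k _ => Nat.factorial_ne_zero _

theorem multiFactorial_add_single [DecidableEq ι] (α : ι →₀ ℕ) (k : ι) :
    multiFactorial (α + Finsupp.single k 1) = (α k + 1) * multiFactorial α := by
  have h1 : (α + Finsupp.single k 1).support ⊆ insert k α.support := by
    intro i hi
    rw [Finset.mem_insert, Finsupp.mem_support_iff]
    by_contra! hc
    rw [Finsupp.mem_support_iff] at hi
    simp [hc.2, hc.1.symm] at hi
  rw [multiFactorial_eq_prod h1, multiFactorial_eq_prod (Finset.subset_insert k α.support),
    ← Finset.mul_prod_erase _ _ (Finset.mem_insert_self k α.support),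
    ← Finset.mul_prod_erase _ _ (Finset.mem_insert_self k α.support), ← mul_assoc]
  congr 1
  · simp [Nat.factorial_succ]
  · refine Finset.prod_congr rfl fun i hi => ?_
    have : k ≠ i := (Finset.ne_of_mem_erase hi).symm
    simp [this]

-- The field variable has coefficients only at the indices ε_k, and ξ_α only at α, so a nonzero Wick
-- coefficient requires γ = ε_k + α, with weight √(γ!/α!) = √γ_k. The sum of conditionals over k
-- anticipates the later summation over α.
open Classical in
theorem wickCoeff_field_chaosVar (hX : IsZeroMeanGaussianField P X)
    (b : HilbertBasis ι ℝ (firstChaos P X)) (f : H) (α γ : ι →₀ ℕ) :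
    wickCoeff (chaosCoeff b (X f)) (chaosCoeff b (chaosVar b α)) γ
      = ∑ k ∈ γ.support, if γ = Finsupp.single k 1 + α then
          √(γ k : ℝ) * inner ℝ (b k : Lp ℝ 2 P) (fieldCLM hX f) else 0 := by
  rw [wickCoeff]
  by_cases hγ : ∃ k, γ = Finsupp.single k 1 + α
  · obtain ⟨k, hk⟩ := hγ
    have hγk : γ k = α k + 1 := by rw [hk]; simp [add_comm]
    rw [Finset.sum_eq_single (Finsupp.single k 1, α), Finset.sum_eq_single k]
    · rw [if_pos hk, chaosCoeff_field_single hX, chaosCoeff_chaosVar hX, if_pos rfl, mul_one,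
        mul_comm]
      congr 2
      have h1 : multiFactorial γ = (α k + 1) * multiFactorial α := by
        rw [hk, add_comm, multiFactorial_add_single]
      have h2 : multiFactorial (Finsupp.single k 1) = 1 := by
        rw [multiFactorial, Finsupp.prod_single_index] <;> simp
      have h3 : (multiFactorial α : ℝ) ≠ 0 := by exact_mod_cast multiFactorial_ne_zero α
      rw [h1, h2, hγk]
      push_cast
      field_simp
    · intro i _ hi
      refine if_neg fun h => hi ?_
      have := add_right_cancel (hk.symm.trans h)
      exact ((Finsupp.single_left_inj one_ne_zero).1 this).symm
    · intro h
      rw [Finsupp.mem_support_iff, hγk] at h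
      exact absurd (Nat.succ_ne_zero _) h
    · rintro ⟨p, q⟩ hpq hne
      rw [Finset.HasAntidiagonal.mem_antidiagonal] at hpq
      simp only at hpq ⊢
      rw [chaosCoeff_chaosVar hX]
      by_cases h : α = q
      · subst h
        exact absurd (by rw [add_right_cancel (hpq.trans hk)]) hne
      · rw [if_neg h, mul_zero, zero_mul]
    · intro h
      exact absurd (Finset.HasAntidiagonal.mem_antidiagonal.2 hk.symm) h
  · push Not at hγ
    rw [Finset.sum_eq_zero, Finset.sum_eq_zero]
    · exact fun k _ => if_neg (hγ k)
    · rintro ⟨p, q⟩ hpq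
      rw [Finset.HasAntidiagonal.mem_antidiagonal] at hpq
      simp only at hpq ⊢
      rw [chaosCoeff_chaosVar hX]
      by_cases h : α = q
      · subst h
        rw [chaosCoeff_field_eq_zero hX b f fun k hk => hγ k (by rw [← hpq, hk]), zero_mul, zero_mul]
      · rw [if_neg h, mul_zero, zero_mul]

/-- The coefficients of the Skorokhod integral. -/
theorem skorokhodCoeff_eq (hX : IsZeroMeanGaussianField P X)
    (b : HilbertBasis ι ℝ (firstChaos P X)) (η : (ι →₀ ℕ) → H) (γ : ι →₀ ℕ) :
    skorokhodCoeff b η γ = ∑ k ∈ γ.support, √(γ k : ℝ)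
      * inner ℝ (b k : Lp ℝ 2 P) (fieldCLM hX (η (γ - Finsupp.single k 1))) := by
  classical
  rw [skorokhodCoeff]
  simp_rw [wickCoeff_field_chaosVar hX b]
  have hle : ∀ k ∈ γ.support, Finsupp.single k 1 ≤ γ := by
    intro k hk
    rw [Finsupp.single_le_iff]
    exact Nat.one_le_iff_ne_zero.2 (Finsupp.mem_support_iff.1 hk)
  have hiff : ∀ k ∈ γ.support, ∀ α, γ = Finsupp.single k 1 + α ↔ α = γ - Finsupp.single k 1 := by
    intro k hk α
    constructor
    · intro h; rw [h]; simp
    · intro h; rw [h, add_tsub_cancel_of_le (hle k hk)]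
  -- Only the indices γ - ε_k with k in the support of γ contribute, so the `finsum` is a genuine
  -- finite sum. The truncated subtraction is exact there because γ_k ≥ 1.
  have hsup : (Function.support fun α => ∑ k ∈ γ.support, if γ = Finsupp.single k 1 + α then
      √(γ k : ℝ) * inner ℝ (b k : Lp ℝ 2 P) (fieldCLM hX (η α)) else 0)
      ⊆ (γ.support.image fun k => γ - Finsupp.single k 1 : Finset (ι →₀ ℕ)) := by
    intro α hα
    obtain ⟨k, hk, hk'⟩ := Finset.exists_ne_zero_of_sum_ne_zero hα
    rw [Finset.coe_image]
    refine ⟨k, hk, ?_⟩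
    by_contra hc
    exact hk' (if_neg fun h => hc (((hiff k hk α).1 h).symm))
  rw [finsum_eq_sum_of_support_subset _ hsup, Finset.sum_comm]
  refine Finset.sum_congr rfl fun k hk => ?_
  rw [Finset.sum_eq_single (γ - Finsupp.single k 1)]
  · rw [if_pos ((hiff k hk _).2 rfl)]
  · intro α _ hα
    exact if_neg fun h => hα ((hiff k hk α).1 h)
  · intro h
    exact absurd (Finset.mem_image_of_mem _ hk) h

end Skorokhod

end GaussField

namespace GaussField

/-! ### Powers of indefinite integrals -/

section Primitive

variable {ι : Type*}

theorem absolutelyContinuousOnInterval_finsetProd {a b : ℝ} (s : Finset ι) {f : ι → ℝ → ℝ}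
    (hf : ∀ k ∈ s, AbsolutelyContinuousOnInterval (f k) a b) :
    AbsolutelyContinuousOnInterval (fun t => ∏ k ∈ s, f k t) a b := by
  classical
  induction s using Finset.induction_on with
  | empty =>
    simp only [Finset.prod_empty]
    exact contDiffOn_const.absolutelyContinuousOnInterval
  | insert k s hk ih =>
    simp_rw [Finset.prod_insert hk]
    exact (hf k (Finset.mem_insert_self _ _)).fun_mul
      (ih fun j hj => hf j (Finset.mem_insert_of_mem hj))

/-- The identity γ_k/√γ_k! = √γ_k/√(γ_k - 1)! turns the product rule into the weights √γ_k of the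
Skorokhod integral. -/
theorem hasDerivAt_multiPow {m : ι → ℝ → ℝ} {e : ι → ℝ} {t : ℝ} (γ : ι →₀ ℕ)
    (h : ∀ k ∈ γ.support, HasDerivAt (m k) (e k) t) :
    HasDerivAt (fun s => multiPow (fun k => m k s) γ)
      (∑ k ∈ γ.support, √(γ k : ℝ) * e k
        * multiPow (fun k => m k t) (γ - Finsupp.single k 1)) t := by
  classical
  have h1 : ∀ s, multiPow (fun k => m k s) γ
      = ∏ k ∈ γ.support, m k s ^ γ k / √(Nat.factorial (γ k) : ℝ) :=
    fun s => multiPow_eq_prod _ subset_rfl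
  simp_rw [h1]
  have h2 := HasDerivAt.fun_finsetProd (u := γ.support)
    (f := fun k s => m k s ^ γ k / √(Nat.factorial (γ k) : ℝ))
    (fun k hk => ((h k hk).pow (γ k)).div_const (√(Nat.factorial (γ k) : ℝ)))
  refine h2.congr_deriv (Finset.sum_congr rfl fun k hk => ?_)
  have hk0 : γ k ≠ 0 := Finsupp.mem_support_iff.1 hk
  obtain ⟨n, hn⟩ := Nat.exists_eq_succ_of_ne_zero hk0
  have hsub : (γ - Finsupp.single k 1).support ⊆ γ.support := by
    intro j hj
    rw [Finsupp.mem_support_iff] at hj ⊢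
    intro h0
    exact hj (by simp [h0])
  rw [multiPow_eq_prod _ hsub, ← Finset.mul_prod_erase _ _ hk, smul_eq_mul, mul_comm]
  have h3 : ∏ j ∈ γ.support.erase k, m j t ^ (γ - Finsupp.single k 1 : ι →₀ ℕ) j
      / √(Nat.factorial ((γ - Finsupp.single k 1 : ι →₀ ℕ) j) : ℝ)
      = ∏ j ∈ γ.support.erase k, m j t ^ γ j / √(Nat.factorial (γ j) : ℝ) := by
    refine Finset.prod_congr rfl fun j hj => ?_
    have : k ≠ j := (Finset.ne_of_mem_erase hj).symm
    simp [this]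
  rw [h3, ← mul_assoc]
  congr 1
  have h4 : (γ - Finsupp.single k 1 : ι →₀ ℕ) k = n := by simp [hn]
  rw [h4, hn, Nat.succ_sub_one, Nat.factorial_succ]
  push_cast
  rw [Real.sqrt_mul (by positivity)]
  have h5 : √((n : ℝ) + 1) ≠ 0 := by positivity
  have h6 : √(Nat.factorial n : ℝ) ≠ 0 := by positivity
  have h7 : √((n : ℝ) + 1) ^ 2 = n + 1 := Real.sq_sqrt (by positivity)
  field_simp
  rw [h7]
  ring

/-- The integral equations satisfied by the coefficients of a stochastic exponential. -/
theorem exp_mul_multiPow_integral_eq {T : ℝ} {e : ι → ℝ → ℝ}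
    (he : ∀ k, IntervalIntegrable (e k) volume 0 T) (c : ℝ) (γ : ι →₀ ℕ) [Decidable (γ = 0)] {t : ℝ}
    (ht : t ∈ Icc 0 T) :
    Real.exp (c * t) * multiPow (fun k => ∫ s in (0 : ℝ)..t, e k s) γ
      = (if γ = 0 then 1 else 0) + ∫ s in (0 : ℝ)..t,
        (c * (Real.exp (c * s) * multiPow (fun k => ∫ s in (0 : ℝ)..s, e k s) γ)
          + ∑ k ∈ γ.support, √(γ k : ℝ) * e k s * (Real.exp (c * s)
            * multiPow (fun k => ∫ s in (0 : ℝ)..s, e k s) (γ - Finsupp.single k 1))) := by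
  have hsub : uIcc 0 t ⊆ uIcc 0 T := by
    rw [uIcc_of_le ht.1, uIcc_of_le (ht.1.trans ht.2)]
    exact Icc_subset_Icc_right ht.2
  have het : ∀ k, IntervalIntegrable (e k) volume 0 t := fun k => (he k).mono_set hsub
  -- The kernels e k are merely integrable, so the fundamental theorem of calculus is used for
  -- absolutely continuous functions; the derivative exists only almost everywhere.
  have hac : AbsolutelyContinuousOnInterval
      (fun s => Real.exp (c * s) * multiPow (fun k => ∫ s in (0 : ℝ)..s, e k s) γ) 0 t := by
    refine AbsolutelyContinuousOnInterval.fun_mul ?_ ?_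
    · have : ContDiff ℝ 1 fun s => Real.exp (c * s) := by fun_prop
      exact this.contDiffOn.absolutelyContinuousOnInterval
    · have h1 : ∀ s, multiPow (fun k => ∫ s in (0 : ℝ)..s, e k s) γ = ∏ k ∈ γ.support,
          -- Powers are spelled as repeated products so that the product rule for absolute
          -- continuity applies.
          (∏ _j ∈ Finset.range (γ k), ∫ s in (0 : ℝ)..s, e k s) * (√(Nat.factorial (γ k) : ℝ))⁻¹ := by
        intro s
        rw [multiPow_eq_prod _ subset_rfl]
        simp [div_eq_mul_inv]
      simp_rw [h1]
      refine absolutelyContinuousOnInterval_finsetProd _ fun k _ => ?_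
      exact (absolutelyContinuousOnInterval_finsetProd _ fun j _ =>
        (het k).absolutelyContinuousOnInterval_intervalIntegral left_mem_uIcc).fun_mul
          contDiffOn_const.absolutelyContinuousOnInterval
  have hftc := hac.integral_deriv_eq_sub
  have h0 : Real.exp (c * 0) * multiPow (fun k => ∫ s in (0 : ℝ)..0, e k s) γ
      = if γ = 0 then 1 else 0 := by
    simp only [mul_zero, Real.exp_zero, intervalIntegral.integral_same, one_mul]
    split_ifs with h
    · rw [h]; simp [multiPow]
    · obtain ⟨k, hk⟩ := Finsupp.support_nonempty_iff.2 h
      rw [multiPow_eq_prod _ subset_rfl]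
      refine Finset.prod_eq_zero hk ?_
      rw [zero_pow (Finsupp.mem_support_iff.1 hk), zero_div]
  rw [h0] at hftc
  rw [← sub_eq_iff_eq_add', ← hftc]
  refine intervalIntegral.integral_congr_ae ?_
  have hd : ∀ᵐ s, ∀ k ∈ γ.support, s ∈ uIcc 0 t →
      HasDerivAt (fun s => ∫ s in (0 : ℝ)..s, e k s) (e k s) s := by
    refine (ae_ball_iff γ.support.countable_toSet).2 fun k _ => ?_
    filter_upwards [(het k).ae_hasDerivAt_integral] with s hs hst
    exact hs hst 0 left_mem_uIcc
  filter_upwards [hd] with s hs hst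
  have hst' := uIoc_subset_uIcc hst
  have h1 := hasDerivAt_multiPow γ fun k hk => hs k hk hst'
  have h2 : HasDerivAt (fun s => Real.exp (c * s)) (Real.exp (c * s) * (c * 1)) s :=
    ((hasDerivAt_id s).const_mul c).exp
  rw [(h2.fun_mul h1).deriv, Finset.mul_sum]
  congr 1
  · ring
  · exact Finset.sum_congr rfl fun k _ => by ring

/-- The function `exp (c t) ∏ k, (∫₀ᵗ e k) ^ γ k / √(γ k)!`. -/
def expPow (e : ι → ℝ → ℝ) (c : ℝ) (γ : ι →₀ ℕ) (t : ℝ) : ℝ :=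
  Real.exp (c * t) * multiPow (fun k => ∫ s in (0 : ℝ)..t, e k s) γ

theorem continuousOn_multiPow_integral {T : ℝ} {e : ι → ℝ → ℝ}
    (he : ∀ k, IntervalIntegrable (e k) volume 0 T) (γ : ι →₀ ℕ) :
    ContinuousOn (fun t => multiPow (fun k => ∫ s in (0 : ℝ)..t, e k s) γ) (uIcc 0 T) := by
  have h : ∀ t, multiPow (fun k => ∫ s in (0 : ℝ)..t, e k s) γ
      = ∏ k ∈ γ.support, (∫ s in (0 : ℝ)..t, e k s) ^ γ k / √(Nat.factorial (γ k) : ℝ) :=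
    fun t => multiPow_eq_prod _ subset_rfl
  simp_rw [h]
  refine continuousOn_finsetProd _ fun k _ => ?_
  exact ((intervalIntegral.continuousOn_primitive_interval' (he k) left_mem_uIcc).pow _).div_const _

theorem continuousOn_expPow {T : ℝ} {e : ι → ℝ → ℝ}
    (he : ∀ k, IntervalIntegrable (e k) volume 0 T) (c : ℝ) (γ : ι →₀ ℕ) :
    ContinuousOn (expPow e c γ) (uIcc 0 T) :=
  (by fun_prop : Continuous fun t => Real.exp (c * t)).continuousOn.mul
    (continuousOn_multiPow_integral he γ)

/-- The scalar model of both equations: c = 0 gives the coefficients of the linear equation, and c =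
-a(2πy)² those of the second equation at frequency y. -/
theorem expPow_eq {T : ℝ} {e : ι → ℝ → ℝ}
    (he : ∀ k, IntervalIntegrable (e k) volume 0 T) (c : ℝ) (γ : ι →₀ ℕ) [Decidable (γ = 0)] {t : ℝ}
    (ht : t ∈ Icc 0 T) :
    expPow e c γ t = (if γ = 0 then 1 else 0) + c * (∫ s in (0 : ℝ)..t, expPow e c γ s)
      + ∑ k ∈ γ.support, √(γ k : ℝ) * ∫ s in (0 : ℝ)..t,
          e k s * expPow e c (γ - Finsupp.single k 1) s := by
  have hsub : uIcc 0 t ⊆ uIcc 0 T := by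
    rw [uIcc_of_le ht.1, uIcc_of_le (ht.1.trans ht.2)]
    exact Icc_subset_Icc_right ht.2
  have het : ∀ k, IntervalIntegrable (e k) volume 0 t := fun k => (he k).mono_set hsub
  have hi : ∀ k ∈ γ.support, IntervalIntegrable (fun s => √(γ k : ℝ) *
      (e k s * expPow e c (γ - Finsupp.single k 1) s)) volume 0 t := fun k _ =>
    ((het k).mul_continuousOn (continuousOn_expPow het c _)).const_mul _
  have h := exp_mul_multiPow_integral_eq he c γ ht
  rw [expPow, h, add_assoc]
  congr 1
  simp_rw [← intervalIntegral.integral_const_mul]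
  rw [← intervalIntegral.integral_finsetSum hi, ← intervalIntegral.integral_add]
  · refine intervalIntegral.integral_congr fun s _ => ?_
    simp only [expPow, mul_assoc]
  · exact ((continuousOn_expPow het c γ).intervalIntegrable).const_mul c
  · have := IntervalIntegrable.sum _ hi
    rwa [Finset.sum_fn] at this

theorem degree_sub_single_add_one {γ : ι →₀ ℕ} {k : ι} (hk : k ∈ γ.support) :
    (γ - Finsupp.single k 1).degree + 1 = γ.degree := by
  have h1 : Finsupp.single k 1 ≤ γ := by
    rw [Finsupp.single_le_iff]
    exact Nat.one_le_iff_ne_zero.2 (Finsupp.mem_support_iff.1 hk)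
  conv_rhs => rw [← tsub_add_cancel_of_le h1]
  rw [map_add, Finsupp.degree_single]

end Primitive

/-! ### The field over `L₂((0,T))` -/

section Time

variable {Ω : Type*} [MeasurableSpace Ω] {P : Measure Ω} {T : ℝ} {X : L2Time T → Ω → ℝ}
  {ι : Type*} [IsProbabilityMeasure P]

theorem coeFn_toL2Time {f : ℝ → ℝ} (hf : MemLp f 2 (timeMeasure T)) :
    toL2Time T f =ᵐ[timeMeasure T] f := by
  rw [toL2Time, dif_pos hf]
  exact hf.coeFn_toLp

theorem intervalIntegral_eq_timeMeasure {E : Type*} [NormedAddCommGroup E] [NormedSpace ℝ E]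
    {t : ℝ} (ht : t ∈ Icc 0 T) (f : ℝ → E) :
    ∫ s, (Icc 0 t).indicator f s ∂(timeMeasure T) = ∫ s in (0 : ℝ)..t, f s := by
  rw [integral_indicator measurableSet_Icc, Measure.restrict_restrict measurableSet_Icc,
    intervalIntegral.integral_of_le ht.1]
  refine setIntegral_congr_set ?_
  have h : Icc 0 t =ᵐ[volume] Ioc 0 t := Ioc_ae_eq_Icc.symm
  have h1 : (Icc 0 t ∩ Ioo 0 T : Set ℝ) =ᵐ[volume] (Ioc 0 t ∩ Icc 0 T : Set ℝ) :=
    h.inter Ioo_ae_eq_Icc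
  have h2 : Ioc 0 t ⊆ Icc 0 T := fun s hs => ⟨hs.1.le, hs.2.trans ht.2⟩
  rwa [inter_eq_left.2 h2] at h1

theorem intervalIntegrable_of_integrable_timeMeasure {E : Type*} [NormedAddCommGroup E]
    {f : ℝ → E} (hf : Integrable f (timeMeasure T)) {t : ℝ} (ht : t ∈ Icc 0 T) :
    IntervalIntegrable f volume 0 t := by
  rw [intervalIntegrable_iff_integrableOn_Ioo_of_le ht.1]
  exact IntegrableOn.mono_set hf (Ioo_subset_Ioo_right ht.2)

theorem inner_toL2Time_indicator (e : L2Time T) {f : ℝ → ℝ} (hf : MemLp f 2 (timeMeasure T))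
    {t : ℝ} (ht : t ∈ Icc 0 T) :
    inner ℝ e (toL2Time T ((Icc 0 t).indicator f)) = ∫ s in (0 : ℝ)..t, e s * f s := by
  rw [← intervalIntegral_eq_timeMeasure ht, L2.inner_def]
  refine integral_congr_ae ?_
  filter_upwards [coeFn_toL2Time (hf.indicator (measurableSet_Icc (a := 0) (b := t)))] with s hs
  rw [hs]
  by_cases h : s ∈ Icc 0 t
  · simp [indicator_of_mem h, mul_comm]
  · simp [indicator_of_notMem h]

theorem integrable_L2Time (e : L2Time T) : Integrable e (timeMeasure T) :=
  (Lp.memLp e).integrable one_le_two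

/-- The density of the `k`-th coordinate of the field. -/
def kernelFn (hX : IsZeroMeanGaussianField P X) (b : HilbertBasis ι ℝ (firstChaos P X)) (k : ι) :
    L2Time T :=
  ContinuousLinearMap.adjoint (fieldCLM hX) (b k : Lp ℝ 2 P)

omit [IsProbabilityMeasure P] in
theorem inner_basis_fieldCLM (hX : IsZeroMeanGaussianField P X)
    (b : HilbertBasis ι ℝ (firstChaos P X)) (k : ι) {f : ℝ → ℝ} (hf : MemLp f 2 (timeMeasure T))
    {t : ℝ} (ht : t ∈ Icc 0 T) :
    inner ℝ (b k : Lp ℝ 2 P) (fieldCLM hX (toL2Time T ((Icc 0 t).indicator f)))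
      = ∫ s in (0 : ℝ)..t, kernelFn hX b k s * f s := by
  rw [← ContinuousLinearMap.adjoint_inner_left]
  exact inner_toL2Time_indicator _ hf ht

omit [IsProbabilityMeasure P] in
theorem inner_basis_chi (hX : IsZeroMeanGaussianField P X)
    (b : HilbertBasis ι ℝ (firstChaos P X)) (k : ι) {t : ℝ} (ht : t ∈ Icc 0 T) :
    inner ℝ (b k : Lp ℝ 2 P) (fieldCLM hX (chi T t))
      = ∫ s in (0 : ℝ)..t, kernelFn hX b k s := by
  rw [chi, inner_basis_fieldCLM hX b k (memLp_const 1) ht]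
  simp

omit [IsProbabilityMeasure P] in
theorem intervalIntegrable_kernelFn (hX : IsZeroMeanGaussianField P X)
    (b : HilbertBasis ι ℝ (firstChaos P X)) (k : ι) (hT : 0 ≤ T) :
    IntervalIntegrable (kernelFn hX b k) volume 0 T :=
  intervalIntegrable_of_integrable_timeMeasure (integrable_L2Time _) ⟨hT, le_rfl⟩

/-- The clamping to [0,T] covers all real s and t, which makes `chi` continuous on the whole line
and not only on [0,T]. -/
theorem inner_chi (s t : ℝ) :
    inner ℝ (chi T s) (chi T t) = max (min (min s t) T) 0 := by
  have h1 : ∀ r : ℝ, chi T r =ᵐ[timeMeasure T] (Icc 0 r).indicator fun _ => 1 := fun r =>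
    coeFn_toL2Time ((memLp_const 1).indicator measurableSet_Icc)
  have h2 : (fun x => inner ℝ (chi T s x) (chi T t x))
      =ᵐ[timeMeasure T] (Icc 0 s ∩ Icc 0 t).indicator fun _ => (1 : ℝ) := by
    filter_upwards [h1 s, h1 t] with x hs ht
    rw [hs, ht]
    by_cases h1 : x ∈ Icc 0 s <;> by_cases h2 : x ∈ Icc 0 t <;> simp [h1, h2, indicator, -mem_Icc]
  rw [L2.inner_def, integral_congr_ae h2,
    integral_indicator_const _ (measurableSet_Icc.inter measurableSet_Icc), smul_eq_mul, mul_one,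
    measureReal_restrict_apply (measurableSet_Icc.inter measurableSet_Icc)]
  have h3 : (Icc 0 s ∩ Icc 0 t ∩ Ioo 0 T : Set ℝ) =ᵐ[volume] (Icc 0 (min (min s t) T) : Set ℝ) := by
    have : (Icc 0 s ∩ Icc 0 t ∩ Icc 0 T : Set ℝ) = Icc 0 (min (min s t) T) := by
      rw [Icc_inter_Icc, Icc_inter_Icc]; simp
    rw [← this]
    exact (ae_eq_refl _).inter Ioo_ae_eq_Icc
  rw [measureReal_congr h3, Real.volume_real_Icc, sub_zero]

theorem continuous_chi : Continuous (chi T) := by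
  refine continuous_of_continuous_inner ?_
  simp_rw [inner_chi]
  fun_prop

omit [IsProbabilityMeasure P] in
theorem assocProcess_ae_eq (hX : IsZeroMeanGaussianField P X) (t : ℝ) :
    fieldCLM hX (chi T t) =ᵐ[P] assocProcess X t :=
  coeFn_fieldCLM hX _

omit [IsProbabilityMeasure P] in
theorem secondMoment_eq (hX : IsZeroMeanGaussianField P X) (t : ℝ) :
    secondMoment P X t = ‖fieldCLM hX (chi T t)‖ ^ 2 := by
  rw [← integral_sq_eq_norm_sq, secondMoment]
  refine integral_congr_ae ?_
  filter_upwards [assocProcess_ae_eq hX t] with ω h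
  rw [h]

theorem memLp_chaosCoeff (hX : IsZeroMeanGaussianField P X)
    (b : HilbertBasis ι ℝ (firstChaos P X)) {η : ℝ → Lp ℝ 2 P} (hη : MemLp η 2 (timeMeasure T))
    (α : ι →₀ ℕ) : MemLp (fun s => chaosCoeff b (η s) α) 2 (timeMeasure T) := by
  simp_rw [← inner_chaosLp hX]
  exact (innerSL ℝ (chaosLp hX b α)).comp_memLp' hη

/-- The chaos coefficients of the Skorokhod integral of a process. -/
theorem skorokhodCoeff_processCoeff (hX : IsZeroMeanGaussianField P X)
    (b : HilbertBasis ι ℝ (firstChaos P X)) {η : ℝ → Lp ℝ 2 P} (hη : MemLp η 2 (timeMeasure T))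
    {t : ℝ} (ht : t ∈ Icc 0 T) (γ : ι →₀ ℕ) :
    skorokhodCoeff b (processCoeff b η t) γ = ∑ k ∈ γ.support, √(γ k : ℝ)
      * ∫ s in (0 : ℝ)..t, kernelFn hX b k s
        * chaosCoeff b (η s) (γ - Finsupp.single k 1) := by
  rw [skorokhodCoeff_eq hX]
  refine Finset.sum_congr rfl fun k _ => ?_
  rw [processCoeff, inner_basis_fieldCLM hX b k (memLp_chaosCoeff hX b hη _) ht]

end Time

end GaussField

namespace GaussField

/-! ### The linear equation -/

section Linear

variable {Ω : Type*} [MeasurableSpace Ω] {P : Measure Ω} {T : ℝ} {X : L2Time T → Ω → ℝ}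
  {ι : Type*} [IsProbabilityMeasure P]

theorem chaosCoeff_sub (hX : IsZeroMeanGaussianField P X)
    (b : HilbertBasis ι ℝ (firstChaos P X)) (ζ η : Lp ℝ 2 P) (γ : ι →₀ ℕ) :
    chaosCoeff b (ζ - η : Lp ℝ 2 P) γ = chaosCoeff b ζ γ - chaosCoeff b η γ := by
  simp_rw [← inner_chaosLp hX, inner_sub_right]

theorem chaosCoeff_smul (hX : IsZeroMeanGaussianField P X)
    (b : HilbertBasis ι ℝ (firstChaos P X)) (c : ℝ) (ζ : Lp ℝ 2 P) (γ : ι →₀ ℕ) :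
    chaosCoeff b (c • ζ : Lp ℝ 2 P) γ = c * chaosCoeff b ζ γ := by
  simp_rw [← inner_chaosLp hX, real_inner_smul_right]

theorem chaosCoeff_const (hX : IsZeroMeanGaussianField P X)
    (b : HilbertBasis ι ℝ (firstChaos P X)) (c : ℝ) (γ : ι →₀ ℕ) [Decidable (γ = 0)] :
    chaosCoeff b (Lp.const 2 P c : Lp ℝ 2 P) γ = if γ = 0 then c else 0 := by
  classical
  have h : (Lp.const 2 P c : Lp ℝ 2 P) = c • chaosLp hX b 0 := by
    apply Lp.ext
    filter_upwards [Lp.coeFn_const (p := 2) (μ := P) c, Lp.coeFn_smul c (chaosLp hX b 0),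
      coeFn_chaosLp hX b 0] with ω h1 h2 h3
    rw [h1, h2, Pi.smul_apply, h3]
    simp [chaosVar]
  rw [h, chaosCoeff_smul hX, ← inner_chaosLp hX,
    orthonormal_iff_ite.1 (orthonormal_chaosLp hX b)]
  split_ifs <;> simp

omit [IsProbabilityMeasure P] in
theorem mem_chaosSpaceOf_iff {E : Type*} [NormedAddCommGroup E] [NormedSpace ℝ E]
    {ζ : Lp E 2 P} : ζ ∈ chaosSpaceOf E P X ↔ AEStronglyMeasurable[fieldSigma X] ζ P :=
  mem_lpMeas_iff_aestronglyMeasurable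

theorem const_mem_chaosSpaceOf {E : Type*} [NormedAddCommGroup E] [NormedSpace ℝ E] (c : E) :
    (Lp.const 2 P c : Lp E 2 P) ∈ chaosSpaceOf E P X := by
  rw [mem_chaosSpaceOf_iff]
  exact ⟨fun _ => c, stronglyMeasurable_const, Lp.coeFn_const (p := 2) (μ := P) c⟩

/-- The stochastic exponential of the associated process. -/
def expProcess (hX : IsZeroMeanGaussianField P X) (t : ℝ) : Lp ℝ 2 P :=
  wickExp hX ⟨fieldCLM hX (chi T t), fieldCLM_mem_firstChaos hX _⟩

theorem coeFn_expProcess (hX : IsZeroMeanGaussianField P X) (t : ℝ) :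
    expProcess hX t =ᵐ[P] fun ω =>
      Real.exp (assocProcess X t ω - 1 / 2 * secondMoment P X t) := by
  filter_upwards [coeFn_wickExp hX ⟨fieldCLM hX (chi T t), fieldCLM_mem_firstChaos hX _⟩,
    assocProcess_ae_eq hX t] with ω h1 h2
  rw [expProcess, h1, ← h2, secondMoment_eq hX]
  congr 2
  change ‖fieldCLM hX (chi T t)‖ ^ 2 / 2 = _
  ring

theorem expProcess_mem_chaosSpaceOf (hX : IsZeroMeanGaussianField P X) (t : ℝ) :
    expProcess hX t ∈ chaosSpaceOf ℝ P X := by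
  rw [mem_chaosSpaceOf_iff]
  refine ⟨_, ?_, coeFn_expProcess hX t⟩
  have h : Measurable[fieldSigma X] (assocProcess X t) := measurable_fieldSigma X _
  exact (Real.measurable_exp.comp (h.sub_const _)).stronglyMeasurable

theorem continuous_expProcess (hX : IsZeroMeanGaussianField P X) :
    Continuous (expProcess (T := T) hX) :=
  (continuous_wickExp hX).comp
    (((fieldCLM hX).continuous.comp continuous_chi).subtype_mk _)

theorem memLp_of_continuous {E : Type*} [NormedAddCommGroup E] {u : ℝ → E} (hu : Continuous u) :
    MemLp u 2 (timeMeasure T) := by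
  obtain ⟨C, hC⟩ := (isCompact_Icc (a := (0 : ℝ)) (b := T)).exists_bound_of_continuousOn
    hu.continuousOn
  refine MemLp.of_bound hu.aestronglyMeasurable C ?_
  filter_upwards [ae_restrict_mem measurableSet_Ioo] with s hs
  exact hC s (Ioo_subset_Icc_self hs)

theorem chaosCoeff_expProcess (hX : IsZeroMeanGaussianField P X)
    (b : HilbertBasis ι ℝ (firstChaos P X)) {t : ℝ} (ht : t ∈ Icc 0 T) (γ : ι →₀ ℕ) :
    chaosCoeff b (expProcess hX t) γ = expPow (fun k => kernelFn hX b k) 0 γ t := by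
  rw [expProcess, chaosCoeff_wickExp, expPow, zero_mul, Real.exp_zero, one_mul]
  congr 1
  ext k
  rw [Submodule.coe_inner]
  exact inner_basis_chi hX b k ht

/-- The coefficients of the stochastic exponential are monomials in the primitives of the kernels,
so the equation at each γ is `expPow_eq` with c = 0. -/
theorem solvesLinearAt_expProcess (hX : IsZeroMeanGaussianField P X)
    (b : HilbertBasis ι ℝ (firstChaos P X)) {t : ℝ} (ht : t ∈ Icc 0 T) :
    SolvesLinearAt b (expProcess hX) t := by
  classical
  have hm := memLp_of_continuous (T := T) (continuous_expProcess (T := T) hX)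
  refine ⟨hm, ae_of_all _ fun s => expProcess_mem_chaosSpaceOf hX s,
    Submodule.sub_mem _ (expProcess_mem_chaosSpaceOf hX t) (const_mem_chaosSpaceOf _), fun γ => ?_⟩
  rw [chaosCoeff_sub hX, chaosCoeff_const hX, chaosCoeff_expProcess hX b ht,
    skorokhodCoeff_processCoeff hX b hm ht,
    expPow_eq (fun k => intervalIntegrable_kernelFn hX b k (ht.1.trans ht.2)) 0 γ ht, zero_mul,
    add_zero, add_sub_cancel_left]
  refine Finset.sum_congr rfl fun k _ => ?_
  congr 1
  refine intervalIntegral.integral_congr fun s hs => ?_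
  rw [uIcc_of_le ht.1] at hs
  rw [chaosCoeff_expProcess hX b ⟨hs.1, hs.2.trans ht.2⟩]

theorem intervalIntegral_congr_timeMeasure {E : Type*} [NormedAddCommGroup E] [NormedSpace ℝ E]
    {f g : ℝ → E} {t : ℝ} (ht : t ∈ Icc 0 T)
    (h : ∀ᵐ s ∂(timeMeasure T), s ∈ Icc 0 t → f s = g s) :
    ∫ s in (0 : ℝ)..t, f s = ∫ s in (0 : ℝ)..t, g s := by
  rw [← intervalIntegral_eq_timeMeasure ht, ← intervalIntegral_eq_timeMeasure ht]
  refine integral_congr_ae ?_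
  filter_upwards [h] with s hs
  by_cases h : s ∈ Icc 0 t
  · simp only [indicator_of_mem h, hs h]
  · simp only [indicator_of_notMem h]

/-- Strong induction on the degree: the right-hand side at γ involves only coefficients of degree
|γ| - 1. They occur under time integrals, so the equation is needed only for almost every earlier
time, besides the time t itself. -/
theorem chaosCoeff_of_solvesLinearAt (hX : IsZeroMeanGaussianField P X)
    (b : HilbertBasis ι ℝ (firstChaos P X)) {u : ℝ → Lp ℝ 2 P}
    (hu : ∀ᵐ t ∂(timeMeasure T), SolvesLinearAt b u t) (γ : ι →₀ ℕ) :
    ∀ t ∈ Icc 0 T, SolvesLinearAt b u t →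
      chaosCoeff b (u t) γ = expPow (fun k => kernelFn hX b k) 0 γ t := by
  classical
  induction hn : γ.degree using Nat.strong_induction_on generalizing γ with
  | _ n ih =>
  intro t ht h
  have h1 := h.coeff_eq γ
  rw [chaosCoeff_sub hX, chaosCoeff_const hX, skorokhodCoeff_processCoeff hX b h.memLp ht,
    sub_eq_iff_eq_add'] at h1
  rw [h1, expPow_eq (fun k => intervalIntegrable_kernelFn hX b k (ht.1.trans ht.2)) 0 γ ht,
    zero_mul, add_zero]
  congr 1
  refine Finset.sum_congr rfl fun k hk => ?_
  congr 1
  refine intervalIntegral_congr_timeMeasure ht ?_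
  filter_upwards [hu] with s hs hst
  have hd := degree_sub_single_add_one hk
  rw [ih _ (by omega) (γ - Finsupp.single k 1) rfl s ⟨hst.1, hst.2.trans ht.2⟩ hs]

theorem ae_eq_exp_of_solvesLinearAt (hX : IsZeroMeanGaussianField P X)
    (b : HilbertBasis ι ℝ (firstChaos P X)) {u : ℝ → Lp ℝ 2 P}
    (hu : ∀ᵐ t ∂(timeMeasure T), SolvesLinearAt b u t) {t : ℝ} (ht : t ∈ Icc 0 T)
    (h : SolvesLinearAt b u t) :
    u t =ᵐ[P] fun ω => Real.exp (assocProcess X t ω - 1 / 2 * secondMoment P X t) := by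
  have hmem : u t ∈ chaosSpaceOf ℝ P X := by
    have := Submodule.add_mem _ h.mem_chaosSpace (const_mem_chaosSpaceOf (X := X) (1 : ℝ))
    rwa [sub_add_cancel] at this
  rw [eq_of_chaosCoeff_eq hX b hmem (expProcess_mem_chaosSpaceOf hX t) fun γ => by
    rw [chaosCoeff_of_solvesLinearAt hX b hu γ t ht h, chaosCoeff_expProcess hX b ht]]
  exact coeFn_expProcess hX t

/-- The solution of the linear equation is the stochastic exponential. -/
theorem linear_equation (hX : IsZeroMeanGaussianField P X)
    (b : HilbertBasis ι ℝ (firstChaos P X)) :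
    (∃ u : ℝ → Lp ℝ 2 P, ∀ t ∈ Icc 0 T, SolvesLinearAt b u t) ∧
      (∀ u : ℝ → Lp ℝ 2 P, (∀ t ∈ Icc 0 T, SolvesLinearAt b u t) →
        ∀ t ∈ Icc 0 T, u t =ᵐ[P] fun ω =>
          Real.exp (assocProcess X t ω - 1 / 2 * secondMoment P X t)) ∧
      (∀ u : ℝ → Lp ℝ 2 P, (∀ᵐ t ∂(timeMeasure T), SolvesLinearAt b u t) →
        ∀ᵐ t ∂(timeMeasure T), u t =ᵐ[P] fun ω =>
          Real.exp (assocProcess X t ω - 1 / 2 * secondMoment P X t)) := by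
  refine ⟨⟨expProcess hX, fun t ht => solvesLinearAt_expProcess hX b ht⟩, fun u hu t ht => ?_,
    fun u hu => ?_⟩
  · refine ae_eq_exp_of_solvesLinearAt hX b ?_ ht (hu t ht)
    filter_upwards [ae_restrict_mem measurableSet_Ioo] with s hs
    exact hu s (Ioo_subset_Icc_self hs)
  · filter_upwards [hu, ae_restrict_mem measurableSet_Ioo] with t ht hs
    exact ae_eq_exp_of_solvesLinearAt hX b hu (Ioo_subset_Icc_self hs) ht

end Linear

end GaussField

namespace GaussField

/-! ### Chaos coefficients of vector-valued random elements -/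

section VectorChaos

variable {Ω H E : Type*} [MeasurableSpace Ω] {P : Measure Ω} [NormedAddCommGroup H]
  [NormedSpace ℝ H] {X : H → Ω → ℝ} {ι : Type*} [IsProbabilityMeasure P]
  [NormedAddCommGroup E] [InnerProductSpace ℝ E]

/-- The chaos coefficient `E (ζ ξ_γ)` of a random element of a Hilbert space. -/
def vectorCoeff (b : HilbertBasis ι ℝ (firstChaos P X)) (ζ : Lp E 2 P) (γ : ι →₀ ℕ) : E :=
  ∫ ω, chaosVar b γ ω • ζ ω ∂P

theorem integrable_chaosVar_smul (hX : IsZeroMeanGaussianField P X)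
    (b : HilbertBasis ι ℝ (firstChaos P X)) (ζ : Lp E 2 P) (γ : ι →₀ ℕ) :
    Integrable (fun ω => chaosVar b γ ω • ζ ω) P :=
  memLp_one_iff_integrable.1 (MemLp.smul (Lp.memLp ζ) (memLp_chaosVar hX b γ))

theorem inner_vectorCoeff (hX : IsZeroMeanGaussianField P X) [CompleteSpace E]
    (b : HilbertBasis ι ℝ (firstChaos P X)) (ζ : Lp E 2 P) (γ : ι →₀ ℕ) (f : E) :
    inner ℝ f (vectorCoeff b ζ γ) = chaosCoeff b ((innerSL ℝ f).compLp ζ) γ := by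
  rw [vectorCoeff, ← integral_inner (integrable_chaosVar_smul hX b ζ γ), chaosCoeff]
  refine integral_congr_ae ?_
  filter_upwards [(innerSL ℝ f).coeFn_compLp ζ] with ω h
  rw [h, real_inner_smul_right, mul_comm]
  rfl

theorem inner_chaosLp_smul (hX : IsZeroMeanGaussianField P X) [CompleteSpace E]
    (b : HilbertBasis ι ℝ (firstChaos P X)) (ζ : Lp E 2 P) (γ : ι →₀ ℕ) (f : E) :
    inner ℝ ((ContinuousLinearMap.toSpanSingleton ℝ f).compLp (chaosLp hX b γ)) ζ
      = inner ℝ f (vectorCoeff b ζ γ) := by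
  rw [vectorCoeff, ← integral_inner (integrable_chaosVar_smul hX b ζ γ), L2.inner_def]
  refine integral_congr_ae ?_
  filter_upwards [(ContinuousLinearMap.toSpanSingleton ℝ f).coeFn_compLp (chaosLp hX b γ),
    coeFn_chaosLp hX b γ] with ω h1 h2
  rw [h1, h2, real_inner_smul_right]
  simp [real_inner_smul_left]

theorem vectorCoeff_chaosLp_smul (hX : IsZeroMeanGaussianField P X) [CompleteSpace E]
    (b : HilbertBasis ι ℝ (firstChaos P X)) [DecidableEq ι] (γ δ : ι →₀ ℕ) (f : E) :
    vectorCoeff b ((ContinuousLinearMap.toSpanSingleton ℝ f).compLp (chaosLp hX b δ)) γ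
      = if γ = δ then f else 0 := by
  have h : vectorCoeff b ((ContinuousLinearMap.toSpanSingleton ℝ f).compLp (chaosLp hX b δ)) γ
      = ∫ ω, (chaosVar b γ ω * chaosVar b δ ω) • f ∂P := by
    refine integral_congr_ae ?_
    filter_upwards [(ContinuousLinearMap.toSpanSingleton ℝ f).coeFn_compLp (chaosLp hX b δ),
      coeFn_chaosLp hX b δ] with ω h1 h2
    rw [h1, h2]
    simp [mul_smul]
  rw [h, integral_smul_const, integral_chaosVar_mul_chaosVar hX b γ δ]
  split_ifs <;> simp

/-- Bessel's inequality. -/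
theorem sum_norm_vectorCoeff_sq_le (hX : IsZeroMeanGaussianField P X) [CompleteSpace E]
    (b : HilbertBasis ι ℝ (firstChaos P X)) (ζ : Lp E 2 P) (s : Finset (ι →₀ ℕ)) :
    ∑ γ ∈ s, ‖vectorCoeff b ζ γ‖ ^ 2 ≤ ‖ζ‖ ^ 2 := by
  classical
  set F : (ι →₀ ℕ) → Lp E 2 P := fun γ =>
    (ContinuousLinearMap.toSpanSingleton ℝ (vectorCoeff b ζ γ)).compLp (chaosLp hX b γ) with hF
  have h1 : inner ℝ (∑ γ ∈ s, F γ) ζ = ∑ γ ∈ s, ‖vectorCoeff b ζ γ‖ ^ 2 := by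
    rw [sum_inner]
    refine Finset.sum_congr rfl fun γ _ => ?_
    rw [hF, inner_chaosLp_smul, real_inner_self_eq_norm_sq]
  have h2 : ‖∑ γ ∈ s, F γ‖ ^ 2 = ∑ γ ∈ s, ‖vectorCoeff b ζ γ‖ ^ 2 := by
    rw [← real_inner_self_eq_norm_sq, sum_inner]
    refine Finset.sum_congr rfl fun γ hγ => ?_
    rw [inner_sum, Finset.sum_eq_single_of_mem γ hγ]
    · rw [hF, inner_chaosLp_smul, vectorCoeff_chaosLp_smul, if_pos rfl,
        real_inner_self_eq_norm_sq]
    · intro δ _ hδ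
      rw [hF, inner_chaosLp_smul, vectorCoeff_chaosLp_smul, if_neg hδ.symm, inner_zero_right]
  -- The partial chaos sum has the same inner product with ζ as with itself; nonnegativity of the
  -- squared distance gives the bound.
  have h3 := norm_sub_sq_real (∑ γ ∈ s, F γ) ζ
  rw [h1, h2] at h3
  nlinarith [sq_nonneg ‖∑ γ ∈ s, F γ - ζ‖]

theorem norm_vectorCoeff_le (hX : IsZeroMeanGaussianField P X) [CompleteSpace E]
    (b : HilbertBasis ι ℝ (firstChaos P X)) (ζ : Lp E 2 P) (γ : ι →₀ ℕ) :
    ‖vectorCoeff b ζ γ‖ ≤ ‖ζ‖ := by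
  have := sum_norm_vectorCoeff_sq_le hX b ζ {γ}
  rw [Finset.sum_singleton] at this
  exact (sq_le_sq₀ (norm_nonneg _) (norm_nonneg _)).1 this

omit [NormedAddCommGroup H] [NormedSpace ℝ H] [IsProbabilityMeasure P] in
theorem compLp_mem_chaosSpaceOf {F : Type*} [NormedAddCommGroup F] [NormedSpace ℝ F]
    (L : E →L[ℝ] F) {ζ : Lp E 2 P} (hζ : ζ ∈ chaosSpaceOf E P X) :
    L.compLp ζ ∈ chaosSpaceOf F P X := by
  rw [chaosSpaceOf, mem_lpMeas_iff_aestronglyMeasurable] at hζ ⊢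
  exact (L.continuous.comp_aestronglyMeasurable hζ).congr (EventuallyEq.symm (L.coeFn_compLp ζ))

/-- A random element that is measurable with respect to the field is determined by its chaos
coefficients. -/
theorem eq_of_vectorCoeff_eq [CompleteSpace H] [CompleteSpace E] [SecondCountableTopology E]
    (hX : IsZeroMeanGaussianField P X) (b : HilbertBasis ι ℝ (firstChaos P X)) {ζ η : Lp E 2 P}
    (hζ : ζ ∈ chaosSpaceOf E P X) (hη : η ∈ chaosSpaceOf E P X)
    (h : ∀ γ, vectorCoeff b ζ γ = vectorCoeff b η γ) : ζ = η := by
  have key : (fun ω => ζ ω - η ω) =ᵐ[P] 0 := by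
    refine ae_eq_zero_of_forall_inner (𝕜 := ℝ) fun f => ?_
    have h1 : (innerSL ℝ f).compLp ζ = (innerSL ℝ f).compLp η :=
      eq_of_chaosCoeff_eq hX b (compLp_mem_chaosSpaceOf _ hζ) (compLp_mem_chaosSpaceOf _ hη)
        fun γ => by rw [← inner_vectorCoeff hX, ← inner_vectorCoeff hX, h]
    filter_upwards [(innerSL ℝ f).coeFn_compLp ζ, (innerSL ℝ f).coeFn_compLp η] with ω h2 h3
    rw [h1, h3, innerSL_apply_apply, innerSL_apply_apply] at h2
    rw [inner_sub_right, h2, sub_self, Pi.zero_apply]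
  apply Lp.ext
  filter_upwards [key] with ω hω
  exact sub_eq_zero.1 hω

end VectorChaos

end GaussField

namespace GaussField

/-! ### Fourier transform on the line -/

section Fourier

open FourierTransform

theorem integral_smul_fourier_Lp (χ : 𝓢(ℝ, ℂ)) (g : Lp ℂ 2 (volume : Measure ℝ)) :
    ∫ y, χ y * (𝓕 g : Lp ℂ 2 (volume : Measure ℝ)) y = ∫ x, 𝓕 χ x * g x := by
  have h := congrArg (fun F : TemperedDistribution ℝ ℂ => F χ) (Lp.fourier_toTemperedDistribution_eq g)
  simp only [TemperedDistribution.fourier_apply, Lp.toTemperedDistribution_apply] at h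
  exact h.symm

/-- The Fourier transform of a real square-integrable function. -/
def lineFourier (f : L2Line) : Lp ℂ 2 (volume : Measure ℝ) := 𝓕 (Complex.ofRealCLM.compLp f)

theorem inner_ofReal_compLp_ofReal {α : Type*} [MeasurableSpace α] {μ : Measure α} (f g : Lp ℝ 2 μ) :
    inner ℂ (Complex.ofRealCLM.compLp f) (Complex.ofRealCLM.compLp g) = (inner ℝ f g : ℂ) := by
  rw [inner_ofReal_compLp, L2.inner_def, ← integral_complex_ofReal]
  refine integral_congr_ae ?_
  filter_upwards [Complex.ofRealCLM.coeFn_compLp g] with ω h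
  rw [h]
  simp [mul_comm]

theorem inner_lineFourier (f g : L2Line) :
    inner ℂ (lineFourier f) (lineFourier g) = (inner ℝ f g : ℂ) := by
  rw [lineFourier, lineFourier, Lp.inner_fourier_eq, inner_ofReal_compLp_ofReal]

theorem norm_lineFourier (f : L2Line) : ‖lineFourier f‖ = ‖f‖ := by
  have h := inner_lineFourier f f
  rw [real_inner_self_eq_norm_sq, inner_self_eq_norm_sq_to_K] at h
  have h' : ‖lineFourier f‖ ^ 2 = ‖f‖ ^ 2 := by
    apply Complex.ofReal_injective; simpa using h
  exact (sq_eq_sq₀ (norm_nonneg _) (norm_nonneg _)).1 h'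

theorem lineFourier_injective : Function.Injective lineFourier := by
  intro f g h
  have h1 : lineFourier (f - g) = lineFourier f - lineFourier g := by
    have h2 : Complex.ofRealCLM.compLp (f - g)
        = Complex.ofRealCLM.compLp f - Complex.ofRealCLM.compLp g :=
      (Complex.ofRealCLM.compLpL 2 volume).map_sub f g
    rw [lineFourier, h2]
    exact (Lp.fourierTransformₗᵢ ℝ ℂ).map_sub _ _
  rw [← sub_eq_zero, ← norm_eq_zero, ← norm_lineFourier, h1, h, sub_self, norm_zero]

/-- The real part of a Schwartz function. -/
def schwartzRe (ψ : 𝓢(ℝ, ℂ)) : 𝓢(ℝ, ℝ) := ψ.postcompCLM Complex.reCLM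

/-- The imaginary part of a Schwartz function. -/
def schwartzIm (ψ : 𝓢(ℝ, ℂ)) : 𝓢(ℝ, ℝ) := ψ.postcompCLM Complex.imCLM

/-- The pairing of the Fourier transform of a square-integrable function with a Schwartz
function of the frequency. -/
def freqPairing (χ : 𝓢(ℝ, ℂ)) (f : L2Line) : ℂ := ∫ y, χ y * lineFourier f y

theorem freqPairing_eq (χ : 𝓢(ℝ, ℂ)) (f : L2Line) :
    freqPairing χ f = ∫ x, 𝓕 χ x * (f x : ℂ) := by
  rw [freqPairing, lineFourier, integral_smul_fourier_Lp]
  refine integral_congr_ae ?_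
  filter_upwards [Complex.ofRealCLM.coeFn_compLp f] with x h
  rw [h]
  rfl

theorem inner_toLp_eq (φ : 𝓢(ℝ, ℝ)) (f : L2Line) :
    inner ℝ (φ.toLp 2 volume) f = ∫ x, φ x * f x := by
  rw [L2.inner_def]
  refine integral_congr_ae ?_
  filter_upwards [φ.coeFn_toLp 2 volume] with x h
  rw [h]
  simp [mul_comm]

theorem integrable_schwartz_mul {𝕜 : Type*} [RCLike 𝕜] (φ : 𝓢(ℝ, 𝕜)) (f : Lp 𝕜 2 (volume : Measure ℝ)) :
    Integrable fun x => φ x * f x :=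
  (φ.memLp 2 volume).integrable_mul (Lp.memLp f)

/-- The bridge between the weak equation, tested with real Schwartz functions of x, and complex test
functions of the frequency. -/
theorem freqPairing_eq_inner (χ : 𝓢(ℝ, ℂ)) (f : L2Line) :
    freqPairing χ f = (inner ℝ ((schwartzRe (𝓕 χ)).toLp 2 volume) f : ℝ)
      + (inner ℝ ((schwartzIm (𝓕 χ)).toLp 2 volume) f : ℝ) * Complex.I := by
  rw [freqPairing_eq, inner_toLp_eq, inner_toLp_eq, ← integral_complex_ofReal,
    ← integral_complex_ofReal, ← integral_mul_const, ← integral_add]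
  · refine integral_congr_ae (ae_of_all _ fun x => ?_)
    apply Complex.ext <;> simp [schwartzRe, schwartzIm]
  · exact (integrable_schwartz_mul _ f).ofReal
  · exact (integrable_schwartz_mul _ f).ofReal.mul_const _

/-- By Plancherel the bound involves χ itself. This controls repeated multiplication of χ by the
symbol of ∂ₓ². -/
theorem norm_freqPairing_le (χ : 𝓢(ℝ, ℂ)) (f : L2Line) :
    ‖freqPairing χ f‖ ≤ ‖χ.toLp 2 volume‖ * ‖f‖ := by
  have h : freqPairing χ f
      = inner ℂ (star (χ.toLp 2 volume : Lp ℂ 2 (volume : Measure ℝ))) (lineFourier f) := by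
    rw [freqPairing, L2.inner_def]
    refine integral_congr_ae ?_
    filter_upwards [χ.coeFn_toLp 2 volume, Lp.coeFn_star (χ.toLp 2 volume)] with x h1 h2
    rw [h2, Pi.star_apply, h1]
    simp [mul_comm]
  rw [h]
  refine (norm_inner_le_norm _ _).trans (le_of_eq ?_)
  rw [norm_lineFourier]
  congr 1
  refine congrArg ENNReal.toReal (eLpNorm_congr_norm_ae ?_)
  filter_upwards [Lp.coeFn_star (χ.toLp 2 (volume : Measure ℝ))] with x h2
  rw [h2, Pi.star_apply, norm_star]

/-- Multiplication of a Schwartz function by a multiple of the variable. -/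
def mulVar (c : ℂ) (χ : 𝓢(ℝ, ℂ)) : 𝓢(ℝ, ℂ) :=
  SchwartzMap.smulLeftCLM ℂ (fun y : ℝ => c * (y : ℂ)) χ

theorem mulVar_apply (c : ℂ) (χ : 𝓢(ℝ, ℂ)) (y : ℝ) : mulVar c χ y = c * y * χ y := by
  have : (fun y : ℝ => c * (y : ℂ)).HasTemperateGrowth := by fun_prop
  rw [mulVar, SchwartzMap.smulLeftCLM_apply_apply this, smul_eq_mul]

theorem derivCLM_fourier (χ : 𝓢(ℝ, ℂ)) :
    SchwartzMap.derivCLM ℝ ℂ (𝓕 χ) = 𝓕 (mulVar (-2 * Real.pi * Complex.I) χ) := by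
  ext x
  have h1 : Integrable fun x : ℝ => x • χ x := by
    refine (mulVar 1 χ).integrable.congr (ae_of_all _ fun x => ?_)
    simp [mulVar_apply]
  rw [SchwartzMap.derivCLM_apply, SchwartzMap.fourier_coe, Real.deriv_fourier χ.integrable h1,
    SchwartzMap.fourier_coe]
  refine congrArg (fun F : ℝ → ℂ => 𝓕 F x) ?_
  ext y
  rw [mulVar_apply, smul_eq_mul]

theorem derivCLM_schwartzRe (ψ : 𝓢(ℝ, ℂ)) :
    SchwartzMap.derivCLM ℝ ℝ (schwartzRe ψ) = schwartzRe (SchwartzMap.derivCLM ℝ ℂ ψ) := by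
  ext x
  rw [SchwartzMap.derivCLM_apply]
  exact (Complex.reCLM.hasFDerivAt.comp_hasDerivAt x ψ.differentiableAt.hasDerivAt).deriv

theorem derivCLM_schwartzIm (ψ : 𝓢(ℝ, ℂ)) :
    SchwartzMap.derivCLM ℝ ℝ (schwartzIm ψ) = schwartzIm (SchwartzMap.derivCLM ℝ ℂ ψ) := by
  ext x
  rw [SchwartzMap.derivCLM_apply]
  exact (Complex.imCLM.hasFDerivAt.comp_hasDerivAt x ψ.differentiableAt.hasDerivAt).deriv

/-- Compactly supported test functions of the frequency suffice, and g only has to be locally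
integrable, so symbols of arbitrary growth are allowed. -/
theorem lineFourier_ae_eq {f : L2Line} {g : ℝ → ℂ} (hg : LocallyIntegrable g)
    (h : ∀ χ : 𝓢(ℝ, ℂ), HasCompactSupport χ → freqPairing χ f = ∫ y, χ y * g y) :
    lineFourier f =ᵐ[volume] g := by
  refine ae_eq_of_integral_contDiff_smul_eq
    ((Lp.memLp (lineFourier f)).locallyIntegrable one_le_two) hg fun φ hφ hc => ?_
  have hc' : HasCompactSupport fun x => (φ x : ℂ) := hc.comp_left Complex.ofReal_zero
  have hs : ContDiff ℝ (⊤ : ℕ∞) fun x => (φ x : ℂ) := Complex.ofRealCLM.contDiff.comp hφ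
  exact h (hc'.toSchwartzMap hs) hc'

/-- Every Schwartz function is the real part of the Fourier transform of a Schwartz function. -/
theorem inner_toLp_eq_freqPairing (φ : 𝓢(ℝ, ℝ)) (f : L2Line) :
    (inner ℝ (φ.toLp 2 volume) f : ℂ)
      = freqPairing (𝓕⁻ (φ.postcompCLM Complex.ofRealCLM)) f := by
  rw [freqPairing_eq, FourierTransform.fourier_fourierInv_eq, inner_toLp_eq,
    ← integral_complex_ofReal]
  refine integral_congr_ae (ae_of_all _ fun x => ?_)
  simp

end Fourier

end GaussField

namespace GaussField

/-! ### The chaos coefficients of a solution in the frequency domain -/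

section Picard

/-- An iterated integral inequality with geometric growth has only the zero solution. -/
theorem eq_zero_of_iterated_integral {a : ℂ} {K T : ℝ} (hT : 0 ≤ T) (hK : 0 ≤ K) {c : ℕ → ℝ → ℂ}
    {g : ℝ → ℝ} (hg : IntervalIntegrable g volume 0 T)
    (hc : ∀ n, ∀ t ∈ Icc 0 T, c n t = a * ∫ s in (0 : ℝ)..t, c (n + 1) s)
    (hb : ∀ n, ∀ s ∈ Icc 0 T, ‖c n s‖ ≤ K ^ n * g s) {t : ℝ} (ht : t ∈ Icc 0 T) : c 0 t = 0 := by
  set B := ∫ s in (0 : ℝ)..T, g s with hB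
  have hg0 : ∀ s ∈ Icc 0 T, 0 ≤ g s := fun s hs => by
    have := hb 0 s hs
    rw [pow_zero, one_mul] at this
    exact (norm_nonneg _).trans this
  have hB0 : 0 ≤ B := intervalIntegral.integral_nonneg hT hg0
  -- The first iteration replaces the merely integrable g by its total integral B; each further one
  -- integrates a monomial in time, and the factorial beats the geometric growth.
  have step : ∀ j n, ∀ t ∈ Icc 0 T,
      ‖c n t‖ ≤ ‖a‖ ^ (j + 1) * K ^ (n + j + 1) * B * (t ^ j / (Nat.factorial j : ℝ)) := by
    intro j
    induction j with
    | zero =>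
      intro n t ht
      rw [hc n t ht, norm_mul]
      have hsub : uIcc 0 t ⊆ uIcc 0 T := by
        rw [uIcc_of_le ht.1, uIcc_of_le hT]
        exact Icc_subset_Icc_right ht.2
      have h1 : ‖∫ s in (0 : ℝ)..t, c (n + 1) s‖ ≤ ∫ s in (0 : ℝ)..t, K ^ (n + 1) * g s := by
        refine intervalIntegral.norm_integral_le_of_norm_le ht.1 (ae_of_all _ fun s hs => ?_)
          ((hg.mono_set hsub).const_mul _)
        exact hb (n + 1) s ⟨hs.1.le, hs.2.trans ht.2⟩
      have h2 : ∫ s in (0 : ℝ)..t, g s ≤ B := by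
        refine intervalIntegral.integral_mono_interval le_rfl ht.1 ht.2 ?_ hg
        refine (ae_restrict_iff' measurableSet_Ioc).2 (ae_of_all _ fun s hs => ?_)
        exact hg0 s ⟨hs.1.le, hs.2⟩
      rw [intervalIntegral.integral_const_mul] at h1
      calc ‖a‖ * ‖∫ s in (0 : ℝ)..t, c (n + 1) s‖
          ≤ ‖a‖ * (K ^ (n + 1) * B) := by gcongr; exact h1.trans (by gcongr)
        _ = _ := by simp; ring
    | succ j ih =>
      intro n t ht
      rw [hc n t ht, norm_mul]
      have h1 : ‖∫ s in (0 : ℝ)..t, c (n + 1) s‖ ≤ ∫ s in (0 : ℝ)..t,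
          ‖a‖ ^ (j + 1) * K ^ (n + 1 + j + 1) * B * (s ^ j / (Nat.factorial j : ℝ)) := by
        refine intervalIntegral.norm_integral_le_of_norm_le ht.1 (ae_of_all _ fun s hs => ?_)
          (Continuous.intervalIntegrable (by fun_prop) _ _)
        exact ih (n + 1) s ⟨hs.1.le, hs.2.trans ht.2⟩
      rw [intervalIntegral.integral_const_mul, intervalIntegral.integral_div, integral_pow] at h1
      refine (mul_le_mul_of_nonneg_left h1 (norm_nonneg a)).trans (le_of_eq ?_)
      rw [Nat.factorial_succ]
      push_cast
      have : (Nat.factorial j : ℝ) ≠ 0 := by positivity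
      have : (j : ℝ) + 1 ≠ 0 := by positivity
      field_simp
      ring
  have lim : Tendsto (fun j : ℕ => ‖a‖ * K * B * ((‖a‖ * K * t) ^ j / (Nat.factorial j : ℝ))) atTop
      (𝓝 (‖a‖ * K * B * 0)) :=
    (FloorSemiring.tendsto_pow_div_factorial_atTop _).const_mul _
  rw [mul_zero] at lim
  rw [← norm_le_zero_iff]
  refine ge_of_tendsto' lim fun j => (step j 0 t ht).trans (le_of_eq ?_)
  rw [mul_pow, mul_pow]
  ring

end Picard

/-! ### The candidate coefficients as frequency integrals -/

section Candidate

variable {ι : Type*}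

/-- The symbol growth allowed in the frequency integrals on the time interval `[0,T]`. -/
def FreqDecay (a T : ℝ) (w : ℝ → ℂ) : Prop :=
  ∀ n : ℕ, Integrable fun y : ℝ => (y : ℂ) ^ n
    * ((max 1 (Real.exp (-a * (2 * Real.pi * y) ^ 2 * T)) : ℝ) : ℂ) * w y

/-- The frequency integral that represents the chaos coefficients of the solution. -/
def freqCoeff (e : ι → ℝ → ℝ) (a σ : ℝ) (w : ℝ → ℂ) (γ : ι →₀ ℕ) (t : ℝ) : ℂ :=
  ∫ y : ℝ, (2 * Real.pi * Complex.I * σ * y) ^ γ.degree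
    * (expPow e (-a * (2 * Real.pi * y) ^ 2) γ t : ℂ) * w y

theorem exp_mul_le_max {c t T : ℝ} (ht : t ∈ Icc 0 T) : Real.exp (c * t) ≤ max 1 (Real.exp (c * T)) := by
  rcases le_total c 0 with h | h
  · exact le_max_of_le_left (Real.exp_le_one_iff.2 (mul_nonpos_of_nonpos_of_nonneg h ht.1))
  · exact le_max_of_le_right (Real.exp_le_exp.2 (mul_le_mul_of_nonneg_left ht.2 h))

/-- B is uniform in c, which will be -a(2πy)² with y varying. The possible growth, for a < 0, is
isolated in the factor that `FreqDecay` absorbs. -/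
theorem exists_abs_expPow_le {T : ℝ} (hT : 0 ≤ T) {e : ι → ℝ → ℝ}
    (he : ∀ k, IntervalIntegrable (e k) volume 0 T) (γ : ι →₀ ℕ) :
    ∃ B, 0 ≤ B ∧ ∀ c, ∀ t ∈ Icc 0 T, |expPow e c γ t| ≤ B * max 1 (Real.exp (c * T)) := by
  obtain ⟨B, hB⟩ := (isCompact_uIcc (a := (0 : ℝ)) (b := T)).exists_bound_of_continuousOn
    (continuousOn_multiPow_integral he γ)
  rw [uIcc_of_le hT] at hB
  have hB0 : 0 ≤ B := (norm_nonneg _).trans (hB 0 ⟨le_rfl, hT⟩)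
  refine ⟨B, hB0, fun c t ht => ?_⟩
  rw [expPow, abs_mul, Real.abs_exp, mul_comm]
  exact mul_le_mul (hB t ht) (exp_mul_le_max ht) (Real.exp_nonneg _) hB0

theorem FreqDecay.pow_mul {a T : ℝ} {w : ℝ → ℂ} (h : FreqDecay a T w) (c : ℂ) (m : ℕ) :
    FreqDecay a T fun y => (c * y) ^ m * w y := by
  intro n
  refine ((h (n + m)).const_mul (c ^ m)).congr (ae_of_all _ fun y => ?_)
  simp only [mul_pow, pow_add]
  ring

theorem FreqDecay.integrable {a T : ℝ} {w : ℝ → ℂ} (h : FreqDecay a T w)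
    (hwm : AEStronglyMeasurable w) : Integrable w := by
  refine (h 0).mono hwm (ae_of_all _ fun y => ?_)
  rw [pow_zero, one_mul, norm_mul, Complex.norm_real, Real.norm_eq_abs,
    abs_of_pos (lt_max_of_lt_left one_pos)]
  exact le_mul_of_one_le_left (norm_nonneg _) (le_max_left _ _)

/-- Fubini's theorem for the frequency integrals. -/
theorem freqCoeff_swap {T : ℝ} {e : ι → ℝ → ℝ}
    (he : ∀ k, IntervalIntegrable (e k) volume 0 T) {a : ℝ} (σ : ℝ) {w : ℝ → ℂ}
    (hwm : AEStronglyMeasurable w) (hw : FreqDecay a T w) {g : ℝ → ℝ}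
    (hg : IntervalIntegrable g volume 0 T) (γ : ι →₀ ℕ) {t : ℝ} (ht : t ∈ Icc 0 T) :
    IntervalIntegrable (fun s => (g s : ℂ) * freqCoeff e a σ w γ s) volume 0 t ∧
    Integrable (fun y : ℝ => (2 * Real.pi * Complex.I * σ * y) ^ γ.degree
      * ((∫ s in (0 : ℝ)..t, g s * expPow e (-a * (2 * Real.pi * y) ^ 2) γ s : ℝ) : ℂ) * w y) ∧
    ∫ y : ℝ, (2 * Real.pi * Complex.I * σ * y) ^ γ.degree
      * ((∫ s in (0 : ℝ)..t, g s * expPow e (-a * (2 * Real.pi * y) ^ 2) γ s : ℝ) : ℂ) * w y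
      = ∫ s in (0 : ℝ)..t, (g s : ℂ) * freqCoeff e a σ w γ s := by
  have hT := ht.1.trans ht.2
  obtain ⟨B, hB0, hB⟩ := exists_abs_expPow_le hT he γ
  set μ : Measure ℝ := volume.restrict (Ioc 0 t) with hμ
  set F : ℝ × ℝ → ℂ := fun p => (g p.1 : ℂ) * ((2 * Real.pi * Complex.I * σ * p.2) ^ γ.degree
    * (expPow e (-a * (2 * Real.pi * p.2) ^ 2) γ p.1 : ℂ) * w p.2) with hF
  have hsub : Ioc 0 t ⊆ uIcc 0 T := by
    rw [uIcc_of_le hT]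
    exact fun s hs => ⟨hs.1.le, hs.2.trans ht.2⟩
  have hgt : Integrable g μ := by
    rw [intervalIntegrable_iff_integrableOn_Ioc_of_le hT] at hg
    exact hg.mono_set (Ioc_subset_Ioc_right ht.2)
  have hm : AEStronglyMeasurable (fun s => multiPow (fun k => ∫ r in (0 : ℝ)..s, e k r) γ) μ :=
    ((continuousOn_multiPow_integral he γ).mono hsub).aestronglyMeasurable measurableSet_Ioc
  have hFm : AEStronglyMeasurable F (μ.prod volume) := by
    have h1 : AEStronglyMeasurable (fun p : ℝ × ℝ => (g p.1 : ℂ)) (μ.prod volume) :=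
      (Complex.continuous_ofReal.comp_aestronglyMeasurable hgt.1).comp_fst
    have h2 : AEStronglyMeasurable (fun p : ℝ × ℝ => w p.2) (μ.prod volume) := hwm.comp_snd
    have h3 : AEStronglyMeasurable (fun p : ℝ × ℝ =>
        (expPow e (-a * (2 * Real.pi * p.2) ^ 2) γ p.1 : ℂ)) (μ.prod volume) := by
      refine Complex.continuous_ofReal.comp_aestronglyMeasurable
        (AEStronglyMeasurable.mul ?_ hm.comp_fst)
      exact (Continuous.aestronglyMeasurable (by fun_prop))
    have h4 : AEStronglyMeasurable (fun p : ℝ × ℝ =>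
        (2 * Real.pi * Complex.I * σ * p.2 : ℂ) ^ γ.degree) (μ.prod volume) :=
      Continuous.aestronglyMeasurable (by fun_prop)
    exact h1.mul ((h4.mul h3).mul h2)
  have hFi : Integrable F (μ.prod volume) := by
    -- The dominating function is a product of an integrable function of time and one of frequency,
    -- since the bound on `expPow` is uniform in time.
    have hb := (hgt.norm.const_mul (‖(2 * Real.pi * Complex.I * σ : ℂ) ^ γ.degree‖ * B)).mul_prod
      (hw γ.degree).norm
    refine hb.mono' hFm ?_
    have : ∀ᵐ p ∂(μ.prod (volume : Measure ℝ)), p.1 ∈ Ioc 0 t :=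
      Measure.quasiMeasurePreserving_fst.ae (ae_restrict_mem measurableSet_Ioc)
    filter_upwards [this] with p hp
    have h5 := hB (-a * (2 * Real.pi * p.2) ^ 2) p.1 ⟨hp.1.le, hp.2.trans ht.2⟩
    simp only [hF, norm_mul, norm_pow, Complex.norm_real, mul_pow]
    simp only [mul_pow, Real.norm_eq_abs] at h5 ⊢
    have h6 : |max 1 (Real.exp (-a * ((2 : ℝ) ^ 2 * Real.pi ^ 2 * p.2 ^ 2) * T))|
      = max 1 (Real.exp (-a * ((2 : ℝ) ^ 2 * Real.pi ^ 2 * p.2 ^ 2) * T)) := abs_of_pos (by positivity)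
    rw [h6]
    calc _ = |g p.1| * (‖(2 : ℂ)‖ ^ γ.degree * |Real.pi| ^ γ.degree * ‖Complex.I‖ ^ γ.degree
          * |σ| ^ γ.degree) * |p.2| ^ γ.degree * ‖w p.2‖
            * |expPow e (-a * ((2 : ℝ) ^ 2 * Real.pi ^ 2 * p.2 ^ 2)) γ p.1| := by ring
      _ ≤ |g p.1| * (‖(2 : ℂ)‖ ^ γ.degree * |Real.pi| ^ γ.degree * ‖Complex.I‖ ^ γ.degree
          * |σ| ^ γ.degree) * |p.2| ^ γ.degree * ‖w p.2‖
            * (B * max 1 (Real.exp (-a * ((2 : ℝ) ^ 2 * Real.pi ^ 2 * p.2 ^ 2) * T))) := by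
          gcongr
      _ = _ := by ring
  have e1 : ∀ y : ℝ, ∫ s, F (s, y) ∂μ = (2 * Real.pi * Complex.I * σ * y) ^ γ.degree
      * ((∫ s in (0 : ℝ)..t, g s * expPow e (-a * (2 * Real.pi * y) ^ 2) γ s : ℝ) : ℂ) * w y := by
    intro y
    rw [intervalIntegral.integral_of_le ht.1, ← integral_complex_ofReal, ← integral_const_mul,
      ← integral_mul_const]
    refine integral_congr_ae (ae_of_all _ fun s => ?_)
    simp only [hF]
    push_cast
    ring
  have e2 : ∀ s : ℝ, ∫ y, F (s, y) = (g s : ℂ) * freqCoeff e a σ w γ s := by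
    intro s
    rw [freqCoeff, ← integral_const_mul]
  refine ⟨?_, ?_, ?_⟩
  · rw [intervalIntegrable_iff_integrableOn_Ioc_of_le ht.1]
    exact hFi.integral_prod_left.congr (ae_of_all _ e2)
  · exact hFi.integral_prod_right.congr (ae_of_all _ e1)
  · simp_rw [← e1, ← e2]
    rw [intervalIntegral.integral_of_le ht.1]
    exact (integral_integral_swap (f := fun s y => F (s, y)) hFi).symm

/-- `expPow_eq` is integrated against w, with Fubini in each term. The factor c = -a(2πy)² equals
a(2πiy)², the symbol of a∂ₓ², and one of the |γ| factors 2πiσy is moved into w, matching the drop of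
the degree to |γ| - 1. -/
theorem freqCoeff_eq {T : ℝ} {e : ι → ℝ → ℝ}
    (he : ∀ k, IntervalIntegrable (e k) volume 0 T) {a : ℝ} (σ : ℝ) {w : ℝ → ℂ}
    (hwm : AEStronglyMeasurable w) (hw : FreqDecay a T w) (γ : ι →₀ ℕ) [Decidable (γ = 0)]
    {t : ℝ} (ht : t ∈ Icc 0 T) :
    freqCoeff e a σ w γ t = (if γ = 0 then ∫ y, w y else 0)
      + a * (∫ s in (0 : ℝ)..t, freqCoeff e a σ (fun y => (2 * Real.pi * Complex.I * y) ^ 2 * w y) γ s)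
      + ∑ k ∈ γ.support, (√(γ k : ℝ) : ℂ) * ∫ s in (0 : ℝ)..t, (e k s : ℂ)
        * freqCoeff e a σ (fun y => (2 * Real.pi * Complex.I * σ * y) ^ 1 * w y)
            (γ - Finsupp.single k 1) s := by
  classical
  have hm : ∀ (c : ℂ) (m : ℕ), AEStronglyMeasurable fun y : ℝ => (c * y) ^ m * w y := fun c m =>
    (Continuous.aestronglyMeasurable (by fun_prop)).mul hwm
  have A := freqCoeff_swap he σ (hm (2 * Real.pi * Complex.I) 2)
    (hw.pow_mul (2 * Real.pi * Complex.I) 2) (g := fun _ => 1) intervalIntegrable_const γ ht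
  have C := fun k => freqCoeff_swap he σ (hm (2 * Real.pi * Complex.I * σ) 1)
    (hw.pow_mul (2 * Real.pi * Complex.I * σ) 1) (he k) (γ - Finsupp.single k 1) ht
  simp only [Complex.ofReal_one, one_mul] at A
  rw [← A.2.2]
  simp_rw [← (C _).2.2, ← integral_const_mul]
  rw [← integral_finsetSum _ fun k _ => (C k).2.1.const_mul _]
  have h0 : (if γ = 0 then ∫ y, w y else 0) = ∫ y, (if γ = 0 then w y else 0) := by
    split_ifs <;> simp
  have hwi : Integrable w := hw.integrable hwm
  have h0i : Integrable fun y => (if γ = 0 then w y else 0) := by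
    split_ifs
    · exact hwi
    · exact integrable_zero _ _ _
  rw [h0, ← integral_add h0i (A.2.1.const_mul _), freqCoeff]
  refine Eq.trans (integral_congr_ae (ae_of_all _ fun y => ?_)) (integral_add
    (h0i.add (A.2.1.const_mul (a : ℂ)))
    (integrable_finsetSum γ.support fun k _ => (C k).2.1.const_mul (√(γ k : ℝ) : ℂ)))
  have h1 := expPow_eq he (-a * (2 * Real.pi * y) ^ 2) γ ht
  beta_reduce
  rw [h1]
  push_cast
  have h2 : ∀ k ∈ γ.support, (2 * Real.pi * Complex.I * σ * y) ^ γ.degree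
      = (2 * Real.pi * Complex.I * σ * y) ^ (γ - Finsupp.single k 1).degree
        * (2 * Real.pi * Complex.I * σ * y) := by
    intro k hk
    rw [← pow_succ, degree_sub_single_add_one hk]
  rw [mul_add, mul_add, add_mul, add_mul, Finset.mul_sum, Finset.sum_mul]
  congr 1
  · congr 1
    · by_cases h : γ = 0
      · simp [h]
      · simp [h]
    · simp only [mul_pow, Complex.I_sq]
      ring
  · refine Finset.sum_congr rfl fun k hk => ?_
    rw [h2 k hk]
    ring

end Candidate

end GaussField

namespace GaussField

/-! ### Chaos coefficients of a solution -/

section Solution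

open FourierTransform

variable {Ω : Type*} [MeasurableSpace Ω] {P : Measure Ω} {T : ℝ} {X : L2Time T → Ω → ℝ}
  {ι : Type*} [IsProbabilityMeasure P]

theorem memLp_inner_vectorCoeff (hX : IsZeroMeanGaussianField P X)
    (b : HilbertBasis ι ℝ (firstChaos P X)) {u : ℝ → Lp L2Line 2 P}
    (hu : MemLp u 2 (timeMeasure T)) (f : L2Line) (γ : ι →₀ ℕ) :
    MemLp (fun s => inner ℝ f (vectorCoeff b (u s) γ)) 2 (timeMeasure T) := by
  simp_rw [← inner_chaosLp_smul hX]
  exact (innerSL ℝ _).comp_memLp' hu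

theorem memLp_freqPairing (hX : IsZeroMeanGaussianField P X)
    (b : HilbertBasis ι ℝ (firstChaos P X)) {u : ℝ → Lp L2Line 2 P}
    (hu : MemLp u 2 (timeMeasure T)) (χ : 𝓢(ℝ, ℂ)) (γ : ι →₀ ℕ) :
    MemLp (fun s => freqPairing χ (vectorCoeff b (u s) γ)) 2 (timeMeasure T) := by
  have h1 : MemLp (fun s => ((inner ℝ ((schwartzRe (𝓕 χ)).toLp 2 volume)
      (vectorCoeff b (u s) γ) : ℝ) : ℂ)) 2 (timeMeasure T) :=
    (memLp_inner_vectorCoeff hX b hu _ γ).ofReal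
  have h2 : MemLp (fun s => ((inner ℝ ((schwartzIm (𝓕 χ)).toLp 2 volume)
      (vectorCoeff b (u s) γ) : ℝ) : ℂ) * Complex.I) 2 (timeMeasure T) :=
    (memLp_inner_vectorCoeff hX b hu _ γ).ofReal.mul_const Complex.I
  exact (h1.add h2).ae_eq (ae_of_all _ fun s => (freqPairing_eq_inner χ _).symm)

theorem intervalIntegrable_of_memLp {E : Type*} [NormedAddCommGroup E] {f : ℝ → E}
    (hf : MemLp f 2 (timeMeasure T)) {t : ℝ} (ht : t ∈ Icc 0 T) :
    IntervalIntegrable f volume 0 t :=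
  intervalIntegrable_of_integrable_timeMeasure (hf.integrable one_le_two) ht

theorem inner_vectorCoeff_pairing (hX : IsZeroMeanGaussianField P X)
    (b : HilbertBasis ι ℝ (firstChaos P X)) (φ : 𝓢(ℝ, ℝ)) (ζ : Lp L2Line 2 P) (γ : ι →₀ ℕ) :
    chaosCoeff b (pairing φ ζ) γ = inner ℝ (φ.toLp 2 volume) (vectorCoeff b ζ γ) :=
  (inner_vectorCoeff hX b ζ γ _).symm

omit [IsProbabilityMeasure P] in
theorem memLp_pairing {u : ℝ → Lp L2Line 2 P} (hu : MemLp u 2 (timeMeasure T)) (φ : 𝓢(ℝ, ℝ)) :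
    MemLp (fun s => pairing φ (u s)) 2 (timeMeasure T) :=
  ((innerSL ℝ (φ.toLp 2 volume)).compLpL 2 P).comp_memLp' hu

theorem chaosCoeff_intervalIntegral (hX : IsZeroMeanGaussianField P X)
    (b : HilbertBasis ι ℝ (firstChaos P X)) {η : ℝ → Lp ℝ 2 P} {t : ℝ}
    (hη : IntervalIntegrable η volume 0 t) (γ : ι →₀ ℕ) :
    chaosCoeff b (∫ s in (0 : ℝ)..t, η s : Lp ℝ 2 P) γ = ∫ s in (0 : ℝ)..t, chaosCoeff b (η s) γ := by
  simp_rw [← inner_chaosLp hX]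
  exact ((innerSL ℝ (chaosLp hX b γ)).intervalIntegral_comp_comm hη).symm

/-- The chaos coefficients of the equation, tested with a Schwartz function. -/
theorem chaosCoeff_equation_iff (hX : IsZeroMeanGaussianField P X)
    (b : HilbertBasis ι ℝ (firstChaos P X)) {a σ : ℝ} {u₀ : L2Line} {u : ℝ → Lp L2Line 2 P}
    (hu : MemLp u 2 (timeMeasure T)) {t : ℝ} (ht : t ∈ Icc 0 T) (φ : 𝓢(ℝ, ℝ)) (γ : ι →₀ ℕ)
    [Decidable (γ = 0)] :
    chaosCoeff b (pairing φ (u t) - Lp.const 2 P (inner ℝ (φ.toLp 2 volume) u₀)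
        - a • ∫ s in (0 : ℝ)..t,
            pairing (SchwartzMap.derivCLM ℝ ℝ (SchwartzMap.derivCLM ℝ ℝ φ)) (u s) : Lp ℝ 2 P) γ
      = skorokhodCoeff b (processCoeff b
          (fun s => -σ • pairing (SchwartzMap.derivCLM ℝ ℝ φ) (u s)) t) γ ↔
    inner ℝ (φ.toLp 2 volume) (vectorCoeff b (u t) γ)
      = (if γ = 0 then inner ℝ (φ.toLp 2 volume) u₀ else 0)
        + a * (∫ s in (0 : ℝ)..t,
          inner ℝ ((SchwartzMap.derivCLM ℝ ℝ (SchwartzMap.derivCLM ℝ ℝ φ)).toLp 2 volume)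
            (vectorCoeff b (u s) γ))
        + ∑ k ∈ γ.support, √(γ k : ℝ) * ∫ s in (0 : ℝ)..t, kernelFn hX b k s
          * (-σ * inner ℝ ((SchwartzMap.derivCLM ℝ ℝ φ).toLp 2 volume)
            (vectorCoeff b (u s) (γ - Finsupp.single k 1))) := by
  have hint := intervalIntegrable_of_memLp
    (memLp_pairing hu (SchwartzMap.derivCLM ℝ ℝ (SchwartzMap.derivCLM ℝ ℝ φ))) ht
  have hsk : MemLp (fun s => -σ • pairing (SchwartzMap.derivCLM ℝ ℝ φ) (u s)) 2 (timeMeasure T) :=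
    (memLp_pairing hu _).const_smul (-σ)
  rw [skorokhodCoeff_processCoeff hX b hsk ht, chaosCoeff_sub hX, chaosCoeff_sub hX,
    chaosCoeff_smul hX, chaosCoeff_const hX, chaosCoeff_intervalIntegral hX b hint]
  simp_rw [chaosCoeff_smul hX, inner_vectorCoeff_pairing hX]
  rw [sub_eq_iff_eq_add', sub_eq_iff_eq_add']
  constructor <;> intro h <;> rw [h] <;> ring

theorem intervalIntegral_ofReal_add_mul_I {A B : ℝ → ℝ} {t : ℝ}
    (hA : IntervalIntegrable A volume 0 t) (hB : IntervalIntegrable B volume 0 t) :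
    ∫ s in (0 : ℝ)..t, ((A s : ℂ) + (B s : ℂ) * Complex.I)
      = ((∫ s in (0 : ℝ)..t, A s : ℝ) : ℂ) + ((∫ s in (0 : ℝ)..t, B s : ℝ) : ℂ) * Complex.I := by
  have hA' : IntervalIntegrable (fun s => (A s : ℂ)) volume 0 t := ⟨hA.1.ofReal, hA.2.ofReal⟩
  have hB' : IntervalIntegrable (fun s => (B s : ℂ)) volume 0 t := ⟨hB.1.ofReal, hB.2.ofReal⟩
  rw [intervalIntegral.integral_add hA' (hB'.mul_const _), intervalIntegral.integral_mul_const,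
    intervalIntegral.integral_ofReal, intervalIntegral.integral_ofReal]

theorem mulVar_mulVar (c d : ℂ) (χ : 𝓢(ℝ, ℂ)) (y : ℝ) :
    mulVar c (mulVar d χ) y = c * d * (y : ℂ) ^ 2 * χ y := by
  rw [mulVar_apply, mulVar_apply]
  ring

/-- The frequency form of the equation for the chaos coefficients. -/
theorem freqPairing_equation (hX : IsZeroMeanGaussianField P X)
    (b : HilbertBasis ι ℝ (firstChaos P X)) {a σ : ℝ} {u₀ : L2Line} {u : ℝ → Lp L2Line 2 P}
    (hu : IsSPDESolution b a σ u₀ u) {t : ℝ} (ht : t ∈ Icc 0 T) (χ : 𝓢(ℝ, ℂ)) (γ : ι →₀ ℕ)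
    [Decidable (γ = 0)] :
    freqPairing χ (vectorCoeff b (u t) γ)
      = (if γ = 0 then freqPairing χ u₀ else 0)
        + a * (∫ s in (0 : ℝ)..t,
          freqPairing (mulVar (2 * Real.pi * Complex.I) (mulVar (2 * Real.pi * Complex.I) χ))
            (vectorCoeff b (u s) γ))
        + ∑ k ∈ γ.support, (√(γ k : ℝ) : ℂ) * ∫ s in (0 : ℝ)..t, (kernelFn hX b k s : ℂ)
          * freqPairing (mulVar (2 * Real.pi * Complex.I * σ) χ)
            (vectorCoeff b (u s) (γ - Finsupp.single k 1)) := by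
  set c : ℂ := -2 * Real.pi * Complex.I with hc
  -- The equation is tested with the real and imaginary parts of the transform of χ, and the two
  -- real identities are recombined.
  have hR := (chaosCoeff_equation_iff hX b hu.memLp ht (schwartzRe (𝓕 χ)) γ).1
    ((hu.equation t ht _).coeff_eq γ)
  have hI := (chaosCoeff_equation_iff hX b hu.memLp ht (schwartzIm (𝓕 χ)) γ).1
    ((hu.equation t ht _).coeff_eq γ)
  simp_rw [derivCLM_schwartzRe, derivCLM_fourier] at hR
  simp_rw [derivCLM_schwartzIm, derivCLM_fourier] at hI
  rw [← hc] at hR hI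
  have h2 : mulVar (2 * Real.pi * Complex.I) (mulVar (2 * Real.pi * Complex.I) χ)
      = mulVar c (mulVar c χ) := by
    ext y
    rw [mulVar_mulVar, mulVar_mulVar, hc]
    ring
  -- The sign of -σ, from moving the derivative onto the test function, cancels the sign in the
  -- symbol -2πi.
  have h1 : ∀ f, freqPairing (mulVar (2 * Real.pi * Complex.I * σ) χ) f
      = -σ * freqPairing (mulVar c χ) f := by
    intro f
    rw [freqPairing, freqPairing, ← integral_const_mul]
    refine integral_congr_ae (ae_of_all _ fun y => ?_)
    simp only [mulVar_apply, hc]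
    ring
  have hi := fun (φ : 𝓢(ℝ, ℝ)) (δ : ι →₀ ℕ) =>
    memLp_inner_vectorCoeff hX b hu.memLp (φ.toLp 2 volume) δ
  have hk := fun (k : ι) (φ : 𝓢(ℝ, ℝ)) (δ : ι →₀ ℕ) =>
    intervalIntegrable_of_integrable_timeMeasure
      ((Lp.memLp (kernelFn hX b k)).integrable_mul ((hi φ δ).const_mul (-σ))) ht
  have hB := intervalIntegral_ofReal_add_mul_I
    (intervalIntegrable_of_memLp (hi (schwartzRe (𝓕 (mulVar c (mulVar c χ)))) γ) ht)
    (intervalIntegrable_of_memLp (hi (schwartzIm (𝓕 (mulVar c (mulVar c χ)))) γ) ht)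
  have hC := fun k : ι => intervalIntegral_ofReal_add_mul_I
    (hk k (schwartzRe (𝓕 (mulVar c χ))) (γ - Finsupp.single k 1))
    (hk k (schwartzIm (𝓕 (mulVar c χ))) (γ - Finsupp.single k 1))
  have hC' : ∀ (k : ι) (s : ℝ), (kernelFn hX b k s : ℂ)
      * freqPairing (mulVar (2 * Real.pi * Complex.I * σ) χ)
        (vectorCoeff b (u s) (γ - Finsupp.single k 1))
      = ((kernelFn hX b k s * (-σ * inner ℝ ((schwartzRe (𝓕 (mulVar c χ))).toLp 2 volume)
          (vectorCoeff b (u s) (γ - Finsupp.single k 1))) : ℝ) : ℂ)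
        + ((kernelFn hX b k s * (-σ * inner ℝ ((schwartzIm (𝓕 (mulVar c χ))).toLp 2 volume)
          (vectorCoeff b (u s) (γ - Finsupp.single k 1))) : ℝ) : ℂ) * Complex.I := by
    intro k s
    rw [h1, freqPairing_eq_inner]
    push_cast
    ring
  simp only [Pi.mul_apply] at hC
  rw [h2]
  simp_rw [hC', hC, freqPairing_eq_inner (mulVar c (mulVar c χ)), hB]
  rw [freqPairing_eq_inner, hR, hI, freqPairing_eq_inner]
  push_cast
  simp_rw [mul_add, Finset.sum_add_distrib]
  split_ifs
  all_goals
    simp only [Complex.ofReal_zero, add_mul, Finset.sum_mul, mul_assoc]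
    ring

end Solution

end GaussField

namespace GaussField

/-! ### Every solution has the candidate coefficients; uniqueness -/

section SolutionCoefficients

open FourierTransform

variable {Ω : Type*} [MeasurableSpace Ω] {P : Measure Ω} {T : ℝ} {X : L2Time T → Ω → ℝ}
  {ι : Type*} [IsProbabilityMeasure P]

theorem hasCompactSupport_mulVar (c : ℂ) {χ : 𝓢(ℝ, ℂ)} (h : HasCompactSupport χ) :
    HasCompactSupport (mulVar c χ) := by
  have : (mulVar c χ : ℝ → ℂ) = fun y => (c * y) * χ y := funext fun y => mulVar_apply c χ y
  rw [this]
  exact h.mul_left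

theorem iterate_mulVar_apply (c : ℂ) (χ : 𝓢(ℝ, ℂ)) (n : ℕ) (y : ℝ) :
    ((fun ψ => mulVar c (mulVar c ψ))^[n] χ) y = ((c * y) ^ 2) ^ n * χ y := by
  induction n with
  | zero => simp
  | succ n ih => rw [Function.iterate_succ_apply', mulVar_mulVar, ih, pow_succ]; ring

/-- Compact support in the frequency makes any continuous weight harmless, so a may have either
sign. -/
theorem freqDecay_of_hasCompactSupport (a T : ℝ) {χ : 𝓢(ℝ, ℂ)} (hχ : HasCompactSupport χ)
    (f : L2Line) : FreqDecay a T fun y => χ y * lineFourier f y := by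
  intro n
  have h1 : MemLp (fun y : ℝ => (y : ℂ) ^ n
      * ((max 1 (Real.exp (-a * (2 * Real.pi * y) ^ 2 * T)) : ℝ) : ℂ) * χ y) 2 volume := by
    refine Continuous.memLp_of_hasCompactSupport ?_ hχ.mul_left
    have := χ.continuous
    fun_prop
  refine (h1.integrable_mul (Lp.memLp (lineFourier f))).congr (ae_of_all _ fun y => ?_)
  simp only [Pi.mul_apply]
  ring

theorem aestronglyMeasurable_mul_lineFourier (χ : 𝓢(ℝ, ℂ)) (f : L2Line) :
    AEStronglyMeasurable fun y => χ y * lineFourier f y :=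
  χ.continuous.aestronglyMeasurable.mul (Lp.aestronglyMeasurable _)

/-- The chaos coefficients of a solution are determined by the equation. -/
theorem freqPairing_vectorCoeff_of_solution (hX : IsZeroMeanGaussianField P X)
    (b : HilbertBasis ι ℝ (firstChaos P X)) {a σ : ℝ} {u₀ : L2Line} {u : ℝ → Lp L2Line 2 P}
    (hu : IsSPDESolution b a σ u₀ u) (γ : ι →₀ ℕ) :
    ∀ (χ : 𝓢(ℝ, ℂ)), HasCompactSupport χ → ∀ t ∈ Icc 0 T,
      freqPairing χ (vectorCoeff b (u t) γ)
        = freqCoeff (fun k => kernelFn hX b k) a σ (fun y => χ y * lineFourier u₀ y) γ t := by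
  classical
  induction hd : γ.degree using Nat.strong_induction_on generalizing γ with
  | _ d ih =>
  intro χ hχ t ht
  have hT : 0 ≤ T := ht.1.trans ht.2
  have he := fun k => intervalIntegrable_kernelFn hX b k hT
  -- Multiplication by the symbol of ∂ₓ². On the support of χ the symbol is bounded by K, so the
  -- iterates grow at most geometrically.
  set D : 𝓢(ℝ, ℂ) → 𝓢(ℝ, ℂ) := fun ψ =>
    mulVar (2 * Real.pi * Complex.I) (mulVar (2 * Real.pi * Complex.I) ψ) with hD
  have hDc : ∀ n, HasCompactSupport (D^[n] χ) := by
    intro n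
    induction n with
    | zero => exact hχ
    | succ n ihn =>
      rw [Function.iterate_succ_apply']
      exact hasCompactSupport_mulVar _ (hasCompactSupport_mulVar _ ihn)
  set W : 𝓢(ℝ, ℂ) → (ι →₀ ℕ) → ℝ → ℂ := fun ψ =>
    freqCoeff (fun k => kernelFn hX b k) a σ (fun y => ψ y * lineFourier u₀ y) with hW
  obtain ⟨R, hR⟩ : ∃ R : ℝ, ∀ y, χ y ≠ 0 → |y| ≤ R := by
    obtain ⟨R, hR⟩ := hχ.isCompact.isBounded.exists_norm_le
    exact ⟨R, fun y hy => hR y (subset_tsupport _ hy)⟩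
  set K : ℝ := (2 * Real.pi * R) ^ 2 with hK
  have hDb : ∀ n y, ‖(D^[n] χ) y‖ ≤ K ^ n * ‖χ y‖ := by
    intro n y
    rw [hD, iterate_mulVar_apply, norm_mul]
    by_cases hy : χ y = 0
    · simp [hy]
    · gcongr
      rw [norm_pow, norm_pow]
      have : ‖2 * (Real.pi : ℂ) * Complex.I * y‖ = 2 * Real.pi * |y| := by
        simp [abs_of_pos Real.pi_pos]
      rw [this, hK]
      have := hR y hy
      gcongr
  obtain ⟨B, hB0, hB⟩ := exists_abs_expPow_le hT he γ
  have hdec := freqDecay_of_hasCompactSupport a T hχ u₀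
  -- Bounds the candidate for the test function χ uniformly in time; passing to the n-th iterate
  -- costs only K^n.
  set M : ℝ := ∫ y : ℝ, ‖(2 * Real.pi * Complex.I * σ : ℂ) ^ d‖ * B * ‖(y : ℂ) ^ d
      * ((max 1 (Real.exp (-a * (2 * Real.pi * y) ^ 2 * T)) : ℝ) : ℂ)
      * (χ y * lineFourier u₀ y)‖ with hM
  have key := eq_zero_of_iterated_integral (a := a) (K := K) hT (sq_nonneg _)
    (c := fun n s => freqPairing (D^[n] χ) (vectorCoeff b (u s) γ) - W (D^[n] χ) γ s)
    (g := fun s => ‖χ.toLp 2 volume‖ * ‖u s‖ + M) ?_ ?_ ?_ ht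
  · exact sub_eq_zero.1 key
  · exact ((intervalIntegrable_of_memLp hu.memLp.norm ⟨hT, le_rfl⟩).const_mul _).add
      intervalIntegrable_const
  · intro n s hs
    have hsub : uIcc 0 s ⊆ Icc 0 T := by
      rw [uIcc_of_le hs.1]
      exact Icc_subset_Icc_right hs.2
    have h1 := freqPairing_equation hX b hu hs (D^[n] χ) γ
    have hwm := aestronglyMeasurable_mul_lineFourier (D^[n] χ) u₀
    have hdn := freqDecay_of_hasCompactSupport a T (hDc n) u₀
    have h2 := freqCoeff_eq he σ hwm hdn γ hs
    -- The noise terms have degree d - 1 and agree with those of the candidate by induction. The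
    -- difference then satisfies an equation containing only the term with a and the next iterate of
    -- D.
    have h3 : ∀ k ∈ γ.support, ∫ r in (0 : ℝ)..s, (kernelFn hX b k r : ℂ)
          * freqPairing (mulVar (2 * Real.pi * Complex.I * σ) (D^[n] χ))
            (vectorCoeff b (u r) (γ - Finsupp.single k 1))
        = ∫ r in (0 : ℝ)..s, (kernelFn hX b k r : ℂ)
          * freqCoeff (fun k => kernelFn hX b k) a σ
              (fun y => (2 * Real.pi * Complex.I * σ * y) ^ 1
                * ((D^[n] χ) y * lineFourier u₀ y)) (γ - Finsupp.single k 1) r := by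
      intro k hk
      refine intervalIntegral.integral_congr fun r hr => ?_
      have := degree_sub_single_add_one hk
      rw [ih _ (by omega) (γ - Finsupp.single k 1) rfl _
        (hasCompactSupport_mulVar _ (hDc n)) r (hsub hr)]
      congr 2
      funext y
      rw [mulVar_apply, pow_one]
      ring
    have h4 : (fun y : ℝ => (2 * Real.pi * Complex.I * y) ^ 2 * ((D^[n] χ) y * lineFourier u₀ y))
        = fun y => (D^[n + 1] χ) y * lineFourier u₀ y := by
      funext y
      rw [Function.iterate_succ_apply', hD, mulVar_mulVar]
      ring
    have h5 : IntervalIntegrable (fun r => W (D^[n + 1] χ) γ r) volume 0 s := by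
      have := (freqCoeff_swap he σ (aestronglyMeasurable_mul_lineFourier (D^[n + 1] χ) u₀)
        (freqDecay_of_hasCompactSupport a T (hDc (n + 1)) u₀) (g := fun _ => 1)
        intervalIntegrable_const γ hs).1
      simpa using this
    have h6 := intervalIntegrable_of_memLp (memLp_freqPairing hX b hu.memLp (D^[n + 1] χ) γ) hs
    rw [intervalIntegral.integral_sub h6 h5, hW]
    beta_reduce
    rw [h1, h2, Finset.sum_congr rfl fun k hk => congrArg _ (h3 k hk), h4,
      Function.iterate_succ_apply']
    have h7 : freqPairing (D^[n] χ) u₀ = ∫ y, (D^[n] χ) y * lineFourier u₀ y := rfl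
    rw [h7]
    ring
  · intro n s hs
    refine (norm_sub_le _ _).trans ?_
    rw [mul_add]
    refine add_le_add ?_ ?_
    · refine (norm_freqPairing_le _ _).trans ?_
      rw [← mul_assoc]
      refine mul_le_mul ?_ (norm_vectorCoeff_le hX b _ _) (norm_nonneg _) (by positivity)
      refine Lp.norm_le_mul_norm_of_ae_le_mul ?_
      filter_upwards [(D^[n] χ).coeFn_toLp 2 volume, χ.coeFn_toLp 2 volume] with y h1 h2
      rw [h1, h2]
      exact hDb n y
    · rw [hM, ← integral_const_mul]
      refine norm_integral_le_of_norm_le (((hdec d).norm.const_mul _).const_mul _)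
        (ae_of_all _ fun y => ?_)
      have h1 := hB (-a * (2 * Real.pi * y) ^ 2) s hs
      have h2 := hDb n y
      rw [hd]
      simp only [norm_mul, norm_pow, Complex.norm_real, mul_pow, Real.norm_eq_abs] at h1 h2 ⊢
      rw [abs_of_pos (a := max 1 (Real.exp _)) (by positivity)]
      calc _ = (‖(2 : ℂ)‖ ^ d * |Real.pi| ^ d * ‖Complex.I‖ ^ d * |σ| ^ d) * |y| ^ d
              * ‖lineFourier u₀ y‖
              * (|expPow (fun k => kernelFn hX b k) (-a * (2 ^ 2 * Real.pi ^ 2 * y ^ 2)) γ s|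
                * ‖(D^[n] χ) y‖) := by ring
        _ ≤ (‖(2 : ℂ)‖ ^ d * |Real.pi| ^ d * ‖Complex.I‖ ^ d * |σ| ^ d) * |y| ^ d
              * ‖lineFourier u₀ y‖
              * ((B * max 1 (Real.exp (-a * (2 ^ 2 * Real.pi ^ 2 * y ^ 2) * T)))
                * (K ^ n * ‖χ y‖)) := by gcongr
        _ = _ := by ring

/-- The frequency symbol of the chaos coefficients of the solution. -/
def coeffSymbol (e : ι → ℝ → ℝ) (a σ : ℝ) (γ : ι →₀ ℕ) (t y : ℝ) : ℂ :=
  (2 * Real.pi * Complex.I * σ * y) ^ γ.degree * (expPow e (-a * (2 * Real.pi * y) ^ 2) γ t : ℂ)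

theorem continuous_coeffSymbol (e : ι → ℝ → ℝ) (a σ : ℝ) (γ : ι →₀ ℕ) (t : ℝ) :
    Continuous (coeffSymbol e a σ γ t) := by
  unfold coeffSymbol expPow
  fun_prop

theorem lineFourier_vectorCoeff_of_solution (hX : IsZeroMeanGaussianField P X)
    (b : HilbertBasis ι ℝ (firstChaos P X)) {a σ : ℝ} {u₀ : L2Line} {u : ℝ → Lp L2Line 2 P}
    (hu : IsSPDESolution b a σ u₀ u) (γ : ι →₀ ℕ) {t : ℝ} (ht : t ∈ Icc 0 T) :
    lineFourier (vectorCoeff b (u t) γ) =ᵐ[volume] fun y =>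
      coeffSymbol (fun k => kernelFn hX b k) a σ γ t y * lineFourier u₀ y := by
  refine lineFourier_ae_eq ?_ fun χ hχ => ?_
  · exact ((Lp.memLp (lineFourier u₀)).locallyIntegrable one_le_two).continuous_mul
      (continuous_coeffSymbol _ _ _ _ _)
  · rw [freqPairing_vectorCoeff_of_solution hX b hu γ χ hχ t ht, freqCoeff]
    refine integral_congr_ae (ae_of_all _ fun y => ?_)
    simp only [coeffSymbol]
    ring

/-- Two solutions with the same initial condition coincide. -/
theorem solution_unique (hX : IsZeroMeanGaussianField P X)
    (b : HilbertBasis ι ℝ (firstChaos P X)) {a σ : ℝ} {u₀ : L2Line} {u v : ℝ → Lp L2Line 2 P}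
    (hu : IsSPDESolution b a σ u₀ u) (hv : IsSPDESolution b a σ u₀ v) {t : ℝ}
    (ht : t ∈ Icc 0 T) : u t = v t := by
  have : Fact ((2 : ℝ≥0∞) ≠ ∞) := ⟨ENNReal.ofNat_ne_top⟩
  refine eq_of_vectorCoeff_eq hX b (hu.mem_chaosSpace t ht) (hv.mem_chaosSpace t ht) fun γ => ?_
  refine lineFourier_injective (Lp.ext ?_)
  exact (lineFourier_vectorCoeff_of_solution hX b hu γ ht).trans
    (lineFourier_vectorCoeff_of_solution hX b hv γ ht).symm

end SolutionCoefficients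

end GaussField

namespace GaussField

/-! ### Gaussian averages of translations -/

section HeatShift

open FourierTransform

/-- The shear (z, x) ↦ (z, z + x) preserves the product of μ with Lebesgue measure. -/
theorem integrable_comp_add (f : L2Line) (μ : Measure ℝ) [IsFiniteMeasure μ] :
    Integrable (fun p : ℝ × ℝ => f (p.1 + p.2) ^ 2) (μ.prod volume) := by
  have h1 : Integrable (fun p : ℝ × ℝ => f p.2 ^ 2) (μ.prod volume) :=
    ((memLp_two_iff_integrable_sq (Lp.aestronglyMeasurable f)).1 (Lp.memLp f)).comp_snd μ
  exact (measurePreserving_prod_add μ volume).integrable_comp_of_integrable h1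

theorem stronglyMeasurable_comp_add (f : L2Line) :
    StronglyMeasurable (fun p : ℝ × ℝ => f (p.1 + p.2)) :=
  (Lp.stronglyMeasurable f).comp_measurable (measurable_fst.add measurable_snd)

theorem memLp_integral_comp_add (f : L2Line) (μ : Measure ℝ) [IsProbabilityMeasure μ] :
    MemLp (fun x => ∫ z, f (z + x) ∂μ) 2 volume := by
  have hm : StronglyMeasurable (fun x => ∫ z, f (z + x) ∂μ) :=
    (stronglyMeasurable_comp_add f).integral_prod_left'
  have hi := integrable_comp_add f μ
  rw [memLp_two_iff_integrable_sq hm.aestronglyMeasurable]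
  refine hi.integral_prod_right.mono' (hm.aestronglyMeasurable.pow 2) ?_
  filter_upwards [hi.prod_left_ae] with x hx
  have hL : MemLp (fun z => f (z + x)) 2 μ := by
    rw [memLp_two_iff_integrable_sq]
    · exact hx
    · exact ((Lp.stronglyMeasurable f).comp_measurable
        (measurable_id.add_const x)).aestronglyMeasurable
  -- Jensen's inequality: the square of the mean is at most the mean square.
  have h := variance_nonneg (fun z => f (z + x)) μ
  rw [variance_eq_sub hL] at h
  rw [Real.norm_eq_abs, abs_of_nonneg (sq_nonneg _)]
  simpa using h

/-- The average of the translations of a function by a Gaussian variable with mean `s` and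
variance `v`. -/
def heatShift (s : ℝ) (v : ℝ≥0) (f : L2Line) : L2Line :=
  (memLp_integral_comp_add f (gaussianReal s v)).toLp _

theorem coeFn_heatShift (s : ℝ) (v : ℝ≥0) (f : L2Line) :
    heatShift s v f =ᵐ[volume] fun x => ∫ y, f y ∂(gaussianReal (x + s) v) := by
  filter_upwards [(memLp_integral_comp_add f (gaussianReal s v)).coeFn_toLp] with x hx
  rw [heatShift, hx, add_comm x s, ← gaussianReal_map_add_const,
    (measurableEmbedding_addRight x).integral_map]

/-- The frequency symbol of the averaged translation. -/
def heatSymbol (s : ℝ) (v : ℝ≥0) (y : ℝ) : ℂ :=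
  Complex.exp ((2 * Real.pi * y : ℝ) * s * Complex.I - v * ((2 * Real.pi * y : ℝ) : ℂ) ^ 2 / 2)

theorem continuous_heatSymbol (s : ℝ) (v : ℝ≥0) : Continuous (heatSymbol s v) := by
  unfold heatSymbol
  fun_prop

theorem norm_heatSymbol_le (s : ℝ) (v : ℝ≥0) (y : ℝ) : ‖heatSymbol s v y‖ ≤ 1 := by
  rw [heatSymbol, Complex.norm_exp]
  have : (((2 * Real.pi * y : ℝ) : ℂ) * s * Complex.I
      - v * ((2 * Real.pi * y : ℝ) : ℂ) ^ 2 / 2).re = -(v * (2 * Real.pi * y) ^ 2 / 2) := by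
    have h1 : (v : ℂ) * ((2 * Real.pi * y : ℝ) : ℂ) ^ 2 / 2
        = ((v * (2 * Real.pi * y) ^ 2 / 2 : ℝ) : ℂ) := by push_cast; rfl
    rw [h1, Complex.sub_re, Complex.ofReal_re, ← Complex.ofReal_mul, Complex.re_ofReal_mul]
    simp
  rw [this]
  exact Real.exp_le_one_iff.2 (neg_nonpos.2 (by positivity))

theorem fourierInv_compSubConst (ψ : 𝓢(ℝ, ℂ)) (z y : ℝ) :
    𝓕⁻ (SchwartzMap.compSubConstCLM ℝ z ψ) y
      = Complex.exp ((2 * Real.pi * y : ℝ) * z * Complex.I) * 𝓕⁻ ψ y := by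
  rw [SchwartzMap.fourierInv_coe, SchwartzMap.fourierInv_coe, Real.fourierInv_eq', Real.fourierInv_eq',
    ← integral_const_mul,
    ← integral_add_right_eq_self (fun v : ℝ => Complex.exp (↑(2 * Real.pi * inner ℝ v y) * Complex.I)
      • SchwartzMap.compSubConstCLM ℝ z ψ v) z]
  refine integral_congr_ae (ae_of_all _ fun v => ?_)
  simp only [SchwartzMap.compSubConstCLM_apply, add_sub_cancel_right, smul_eq_mul, ← mul_assoc,
    ← Complex.exp_add]
  congr 2
  simp
  ring

/-- Translation by z multiplies the transform by e^{2πiyz}; averaging over Gaussian z turns this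
factor into the characteristic function at 2πy, which is `heatSymbol`. Fubini is used twice, in x
and then in y. -/
theorem freqPairing_heatShift (χ : 𝓢(ℝ, ℂ)) (s : ℝ) (v : ℝ≥0) (f : L2Line) :
    freqPairing χ (heatShift s v f) = ∫ y, χ y * (heatSymbol s v y * lineFourier f y) := by
  set μ := gaussianReal s v with hμ
  set ψ := 𝓕 χ with hψ
  have h1 : freqPairing χ (heatShift s v f) = ∫ x, ∫ z, ψ x * (f (z + x) : ℂ) ∂μ := by
    rw [freqPairing_eq]
    refine integral_congr_ae ?_
    filter_upwards [(memLp_integral_comp_add f μ).coeFn_toLp] with x hx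
    rw [heatShift, hx, ← integral_complex_ofReal, integral_const_mul]
  have hint : Integrable (fun p : ℝ × ℝ => ψ p.2 * (f (p.1 + p.2) : ℂ)) (μ.prod volume) := by
    have a1 : Integrable (fun p : ℝ × ℝ => ‖ψ p.2‖ ^ 2) (μ.prod volume) :=
      ((memLp_two_iff_integrable_sq_norm ψ.continuous.aestronglyMeasurable).1
        (ψ.memLp 2 volume)).comp_snd μ
    refine (a1.add (integrable_comp_add f μ)).mono' ?_ (ae_of_all _ fun p => ?_)
    · exact (ψ.continuous.comp continuous_snd).aestronglyMeasurable.mul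
        (Complex.continuous_ofReal.comp_stronglyMeasurable
          (stronglyMeasurable_comp_add f)).aestronglyMeasurable
    · rw [norm_mul, Complex.norm_real, Pi.add_apply, Real.norm_eq_abs]
      nlinarith [sq_nonneg (‖ψ p.2‖ - |f (p.1 + p.2)|), sq_abs (f (p.1 + p.2)),
        sq_nonneg (‖ψ p.2‖), sq_nonneg (f (p.1 + p.2))]
  have h2 : ∀ z : ℝ, ∫ x, ψ x * (f (z + x) : ℂ)
      = ∫ y, Complex.exp ((2 * Real.pi * y : ℝ) * z * Complex.I) * (χ y * lineFourier f y) := by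
    intro z
    have b1 : ∫ x, ψ x * (f (z + x) : ℂ)
        = freqPairing (𝓕⁻ (SchwartzMap.compSubConstCLM ℝ z ψ)) f := by
      rw [freqPairing_eq, FourierTransform.fourier_fourierInv_eq,
        ← integral_add_left_eq_self (fun x => SchwartzMap.compSubConstCLM ℝ z ψ x * (f x : ℂ)) z]
      simp
    rw [b1, freqPairing]
    refine integral_congr_ae (ae_of_all _ fun y => ?_)
    simp only
    rw [fourierInv_compSubConst, hψ, FourierTransform.fourierInv_fourier_eq, mul_assoc]
  rw [h1, ← integral_integral_swap (f := fun z x => ψ x * (f (z + x) : ℂ)) hint]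
  simp_rw [h2]
  have hint2 : Integrable (fun p : ℝ × ℝ => Complex.exp ((2 * Real.pi * p.2 : ℝ) * p.1 * Complex.I)
      * (χ p.2 * lineFourier f p.2)) (μ.prod volume) := by
    have a1 := (integrable_schwartz_mul χ (lineFourier f)).comp_snd μ
    refine a1.mono (AEStronglyMeasurable.mul ?_ a1.1) (ae_of_all _ fun p => ?_)
    · exact Continuous.aestronglyMeasurable (by fun_prop)
    · rw [norm_mul, ← Complex.ofReal_mul, Complex.norm_exp_ofReal_mul_I, one_mul]
  rw [integral_integral_swap (f := fun z y : ℝ =>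
    Complex.exp ((2 * Real.pi * y : ℝ) * z * Complex.I) * (χ y * lineFourier f y)) hint2]
  refine integral_congr_ae (ae_of_all _ fun y => ?_)
  simp only
  rw [integral_mul_const, ← charFun_apply_real, charFun_gaussianReal, heatSymbol]
  ring

theorem lineFourier_heatShift (s : ℝ) (v : ℝ≥0) (f : L2Line) :
    lineFourier (heatShift s v f) =ᵐ[volume] fun y => heatSymbol s v y * lineFourier f y :=
  lineFourier_ae_eq (((Lp.memLp (lineFourier f)).locallyIntegrable one_le_two).continuous_mul
    (continuous_heatSymbol s v)) fun χ _ => freqPairing_heatShift χ s v f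

theorem norm_heatShift_le (s : ℝ) (v : ℝ≥0) (f : L2Line) : ‖heatShift s v f‖ ≤ ‖f‖ := by
  rw [← norm_lineFourier, ← norm_lineFourier f]
  refine Lp.norm_le_norm_of_ae_le ?_
  filter_upwards [lineFourier_heatShift s v f] with y hy
  rw [hy, norm_mul]
  exact mul_le_of_le_one_left (norm_nonneg _) (norm_heatSymbol_le s v y)

theorem integrable_norm_sq_lineFourier (f : L2Line) :
    Integrable fun y => ‖lineFourier f y‖ ^ 2 :=
  (memLp_two_iff_integrable_sq_norm (Lp.aestronglyMeasurable _)).1 (Lp.memLp _)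

/-- By Plancherel: conjugating one symbol subtracts the shifts and adds the variances. -/
theorem inner_heatShift (s s' : ℝ) (v v' : ℝ≥0) (f : L2Line) :
    (inner ℝ (heatShift s v f) (heatShift s' v' f) : ℂ)
      = ∫ y, heatSymbol (s' - s) (v + v') y * (‖lineFourier f y‖ ^ 2 : ℝ) := by
  rw [← inner_lineFourier, L2.inner_def]
  refine integral_congr_ae ?_
  filter_upwards [lineFourier_heatShift s v f, lineFourier_heatShift s' v' f] with y h1 h2
  have h3 : (starRingEnd ℂ) (heatSymbol s v y) * heatSymbol s' v' y
      = heatSymbol (s' - s) (v + v') y := by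
    simp only [heatSymbol, ← Complex.exp_conj, ← Complex.exp_add]
    congr 1
    simp only [map_sub, map_mul, map_div₀, map_pow, Complex.conj_ofReal, Complex.conj_I, map_ofNat,
      NNReal.coe_add, Complex.ofReal_add, Complex.ofReal_sub]
    ring
  rw [h1, h2, RCLike.inner_apply, map_mul, ← h3, Complex.ofReal_pow, ← Complex.mul_conj']
  ring

theorem continuous_heatShift (f : L2Line) :
    Continuous fun p : ℝ × ℝ≥0 => heatShift p.1 p.2 f := by
  refine continuous_of_continuous_inner ?_
  have h : Continuous fun q : (ℝ × ℝ≥0) × ℝ × ℝ≥0 =>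
      ∫ y, heatSymbol (q.2.1 - q.1.1) (q.1.2 + q.2.2) y * (‖lineFourier f y‖ ^ 2 : ℝ) := by
    refine continuous_of_dominated (bound := fun y => ‖lineFourier f y‖ ^ 2) (fun q => ?_)
      (fun q => ae_of_all _ fun y => ?_) (integrable_norm_sq_lineFourier f)
      (ae_of_all _ fun y => ?_)
    · exact (continuous_heatSymbol _ _).aestronglyMeasurable.mul
        (integrable_norm_sq_lineFourier f).ofReal.1
    · rw [norm_mul, Complex.norm_real, Real.norm_eq_abs, abs_of_nonneg (sq_nonneg _)]
      exact mul_le_of_le_one_left (sq_nonneg _) (norm_heatSymbol_le _ _ _)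
    · unfold heatSymbol
      fun_prop
  have h' := Complex.continuous_re.comp h
  refine h'.congr fun q => ?_
  rw [Function.comp_apply, ← inner_heatShift, Complex.ofReal_re]

end HeatShift

end GaussField

namespace GaussField

/-! ### The explicit solution -/

section ExplicitSolution

open FourierTransform

variable {Ω : Type*} [MeasurableSpace Ω] {P : Measure Ω} {T : ℝ} {X : L2Time T → Ω → ℝ}
  {ι : Type*} [IsProbabilityMeasure P]

/-- The random shift enters the symbol only through exp(zh) with z = 2πiσy, whose coefficients are
known; the expectation adds σ²‖h‖² to the variance v. -/
theorem integral_heatSymbol_mul_chaosVar (hX : IsZeroMeanGaussianField P X)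
    (b : HilbertBasis ι ℝ (firstChaos P X)) {h : Lp ℝ 2 P} (hh : h ∈ firstChaos P X)
    (σ : ℝ) (v : ℝ≥0) (y : ℝ) (γ : ι →₀ ℕ) :
    ∫ ω, heatSymbol (σ * h ω) v y * (chaosVar b γ ω : ℂ) ∂P
      = Complex.exp (-((v + σ ^ 2 * ‖h‖ ^ 2) * (2 * Real.pi * y) ^ 2 / 2 : ℝ))
        * ((2 * Real.pi * Complex.I * σ * y) ^ γ.degree
          * (multiPow (fun k => inner ℝ (b k : Lp ℝ 2 P) h) γ : ℂ)) := by
  have h1 : ∀ ω, heatSymbol (σ * h ω) v y * (chaosVar b γ ω : ℂ)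
      = Complex.exp (-(v * (2 * Real.pi * y) ^ 2 / 2 : ℝ))
        * (Complex.exp ((2 * Real.pi * Complex.I * σ * y) * h ω) * (chaosVar b γ ω : ℂ)) := by
    intro ω
    rw [heatSymbol, ← mul_assoc, ← Complex.exp_add]
    congr 2
    push_cast
    ring
  simp_rw [h1]
  rw [integral_const_mul, integral_cexp_mul_chaosVar hX b hh, mul_assoc (Complex.exp (_ / 2)),
    ← mul_assoc, ← Complex.exp_add]
  congr 2
  push_cast
  simp only [mul_pow, Complex.I_sq]
  ring

theorem integral_heatSymbol (hX : IsZeroMeanGaussianField P X)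
    {h : Lp ℝ 2 P} (hh : h ∈ firstChaos P X) (σ : ℝ) (v : ℝ≥0) (y : ℝ) :
    ∫ ω, heatSymbol (σ * h ω) v y ∂P
      = Complex.exp (-((v + σ ^ 2 * ‖h‖ ^ 2) * (2 * Real.pi * y) ^ 2 / 2 : ℝ)) := by
  have h1 : ∀ ω, heatSymbol (σ * h ω) v y
      = Complex.exp (-(v * (2 * Real.pi * y) ^ 2 / 2 : ℝ))
        * Complex.exp ((2 * Real.pi * Complex.I * σ * y) * h ω) := by
    intro ω
    rw [heatSymbol, ← Complex.exp_add]
    congr 1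
    push_cast
    ring
  simp_rw [h1]
  rw [integral_const_mul, integral_cexp_of_mem_firstChaos hX hh, ← Complex.exp_add]
  congr 1
  push_cast
  simp only [mul_pow, Complex.I_sq]
  ring

/-- The variance of the Gaussian average in the explicit solution. -/
def heatVariance (P : Measure Ω) (X : L2Time T → Ω → ℝ) (a σ t : ℝ) : ℝ≥0 :=
  Real.toNNReal (2 * (a * t - σ ^ 2 / 2 * secondMoment P X t))

omit [IsProbabilityMeasure P] in
theorem stronglyMeasurable_heatShift_assocProcess (a σ t : ℝ) (u₀ : L2Line) :
    StronglyMeasurable[fieldSigma X] fun ω =>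
      heatShift (σ * assocProcess X t ω) (heatVariance P X a σ t) u₀ := by
  have h : Measurable[fieldSigma X] (assocProcess X t) := measurable_fieldSigma X _
  exact ((continuous_heatShift u₀).comp
    (continuous_id.prodMk continuous_const)).comp_stronglyMeasurable
      (h.const_mul σ).stronglyMeasurable

theorem memLp_heatShift_assocProcess (hX : IsZeroMeanGaussianField P X) (a σ t : ℝ)
    (u₀ : L2Line) :
    MemLp (fun ω => heatShift (σ * assocProcess X t ω) (heatVariance P X a σ t) u₀) 2 P :=
  MemLp.of_bound ((stronglyMeasurable_heatShift_assocProcess a σ t u₀).mono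
    (fieldSigma_le hX)).aestronglyMeasurable ‖u₀‖ (ae_of_all _ fun _ => norm_heatShift_le _ _ _)

/-- The explicit solution: the Gaussian average of the initial condition, translated along the
associated process. -/
def heatSolution (hX : IsZeroMeanGaussianField P X) (a σ : ℝ) (u₀ : L2Line) (t : ℝ) :
    Lp L2Line 2 P :=
  (memLp_heatShift_assocProcess hX a σ t u₀).toLp _

theorem coeFn_heatSolution (hX : IsZeroMeanGaussianField P X) (a σ : ℝ) (u₀ : L2Line) (t : ℝ) :
    heatSolution hX a σ u₀ t =ᵐ[P] fun ω =>
      heatShift (σ * assocProcess X t ω) (heatVariance P X a σ t) u₀ :=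
  (memLp_heatShift_assocProcess hX a σ t u₀).coeFn_toLp

theorem heatSolution_mem_chaosSpaceOf (hX : IsZeroMeanGaussianField P X) (a σ : ℝ) (u₀ : L2Line)
    (t : ℝ) : heatSolution hX a σ u₀ t ∈ chaosSpaceOf L2Line P X := by
  rw [mem_chaosSpaceOf_iff]
  exact ⟨_, stronglyMeasurable_heatShift_assocProcess a σ t u₀, coeFn_heatSolution hX a σ u₀ t⟩

theorem norm_heatSolution_le (hX : IsZeroMeanGaussianField P X) (a σ : ℝ) (u₀ : L2Line) (t : ℝ) :
    ‖heatSolution hX a σ u₀ t‖ ≤ ‖u₀‖ := by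
  have h := Lp.norm_le_of_ae_bound (f := heatSolution hX a σ u₀ t) (norm_nonneg u₀) (by
    filter_upwards [coeFn_heatSolution hX a σ u₀ t] with ω h
    rw [h]
    exact norm_heatShift_le _ _ _)
  simpa [measureUnivNNReal] using h

omit [IsProbabilityMeasure P] in
theorem aestronglyMeasurable_heatSymbol (h : Lp ℝ 2 P) (σ : ℝ) (v : ℝ≥0) :
    AEStronglyMeasurable (fun p : Ω × ℝ => heatSymbol (σ * h p.1) v p.2) (P.prod volume) := by
  have hm : AEStronglyMeasurable (fun p : Ω × ℝ => (h p.1, p.2)) (P.prod volume) :=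
    (Lp.aestronglyMeasurable h).comp_fst.prodMk measurable_snd.aestronglyMeasurable
  have hc : Continuous (fun q : ℝ × ℝ => heatSymbol (σ * q.1) v q.2) := by
    unfold heatSymbol
    fun_prop
  exact Continuous.comp_aestronglyMeasurable (g := fun q : ℝ × ℝ => heatSymbol (σ * q.1) v q.2)
    (f := fun p : Ω × ℝ => (h p.1, p.2)) hc hm

/-- The shifts enter through σ(X(t) - X(s)), which is again in the first chaos, so the expectation
is an explicit Gaussian factor. Continuity of the solution in time is read off from it. -/
theorem inner_heatSolution (hX : IsZeroMeanGaussianField P X) (a σ : ℝ) (u₀ : L2Line) (s t : ℝ) :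
    (inner ℝ (heatSolution hX a σ u₀ s) (heatSolution hX a σ u₀ t) : ℂ)
      = ∫ y, Complex.exp (-(((heatVariance P X a σ s + heatVariance P X a σ t : ℝ≥0)
          + σ ^ 2 * ‖fieldCLM hX (chi T t) - fieldCLM hX (chi T s)‖ ^ 2)
          * (2 * Real.pi * y) ^ 2 / 2 : ℝ)) * (‖lineFourier u₀ y‖ ^ 2 : ℝ) := by
  set v := heatVariance P X a σ s + heatVariance P X a σ t with hv
  set h : Lp ℝ 2 P := fieldCLM hX (chi T t) - fieldCLM hX (chi T s) with hh
  have hmem : h ∈ firstChaos P X :=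
    Submodule.sub_mem _ (fieldCLM_mem_firstChaos hX _) (fieldCLM_mem_firstChaos hX _)
  have h1 : (inner ℝ (heatSolution hX a σ u₀ s) (heatSolution hX a σ u₀ t) : ℂ)
      = ∫ ω, (∫ y : ℝ, heatSymbol (σ * h ω) v y * (‖lineFourier u₀ y‖ ^ 2 : ℝ)) ∂P := by
    rw [L2.inner_def, ← integral_complex_ofReal]
    refine integral_congr_ae ?_
    filter_upwards [coeFn_heatSolution hX a σ u₀ s, coeFn_heatSolution hX a σ u₀ t,
      assocProcess_ae_eq hX s, assocProcess_ae_eq hX t,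
      Lp.coeFn_sub (fieldCLM hX (chi T t)) (fieldCLM hX (chi T s))] with ω h1 h2 h3 h4 h5
    rw [h1, h2, inner_heatShift, hh, h5, Pi.sub_apply, h3, h4, mul_sub]
  have hint : Integrable (fun p : Ω × ℝ => heatSymbol (σ * h p.1) v p.2
      * (‖lineFourier u₀ p.2‖ ^ 2 : ℝ)) (P.prod volume) := by
    have a1 := (integrable_norm_sq_lineFourier u₀).ofReal (𝕜 := ℂ) |>.comp_snd P
    refine a1.mono (AEStronglyMeasurable.mul ?_ a1.1) (ae_of_all _ fun p => ?_)
    · exact aestronglyMeasurable_heatSymbol h σ v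
    · rw [norm_mul]
      exact mul_le_of_le_one_left (norm_nonneg _) (norm_heatSymbol_le _ _ _)
  rw [h1, integral_integral_swap (f := fun ω y => heatSymbol (σ * h ω) v y
    * ((‖lineFourier u₀ y‖ ^ 2 : ℝ) : ℂ)) hint]
  refine integral_congr_ae (ae_of_all _ fun y => ?_)
  simp only
  rw [integral_mul_const, integral_heatSymbol hX hmem]

theorem continuous_heatSolution (hX : IsZeroMeanGaussianField P X) (a σ : ℝ) (u₀ : L2Line) :
    Continuous (heatSolution hX a σ u₀) := by
  refine continuous_of_continuous_inner ?_
  have hF : Continuous fun t : ℝ => fieldCLM hX (chi T t) :=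
    (fieldCLM hX).continuous.comp continuous_chi
  have hv : Continuous (heatVariance P X a σ) := by
    unfold heatVariance
    simp_rw [secondMoment_eq hX]
    fun_prop
  have h : Continuous fun q : ℝ × ℝ =>
      ∫ y, Complex.exp (-(((heatVariance P X a σ q.1 + heatVariance P X a σ q.2 : ℝ≥0)
          + σ ^ 2 * ‖fieldCLM hX (chi T q.2) - fieldCLM hX (chi T q.1)‖ ^ 2)
          * (2 * Real.pi * y) ^ 2 / 2 : ℝ)) * (‖lineFourier u₀ y‖ ^ 2 : ℝ) := by
    refine continuous_of_dominated (bound := fun y => ‖lineFourier u₀ y‖ ^ 2) (fun q => ?_)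
      (fun q => ae_of_all _ fun y => ?_) (integrable_norm_sq_lineFourier u₀)
      (ae_of_all _ fun y => ?_)
    · exact (Continuous.aestronglyMeasurable (by fun_prop)).mul
        (integrable_norm_sq_lineFourier u₀).ofReal.1
    · rw [norm_mul, Complex.norm_real, Real.norm_eq_abs, abs_of_nonneg (sq_nonneg _),
        ← Complex.ofReal_neg, ← Complex.ofReal_exp, Complex.norm_real, Real.norm_eq_abs, Real.abs_exp]
      refine mul_le_of_le_one_left (sq_nonneg _) (Real.exp_le_one_iff.2 (neg_nonpos.2 ?_))
      positivity
    · have h1 : Continuous fun q : ℝ × ℝ => heatVariance P X a σ q.1 + heatVariance P X a σ q.2 := by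
        fun_prop
      have h2 : Continuous fun q : ℝ × ℝ =>
          ‖fieldCLM hX (chi T q.2) - fieldCLM hX (chi T q.1)‖ :=
        ((hF.comp continuous_snd).sub (hF.comp continuous_fst)).norm
      fun_prop
  have h' := Complex.continuous_re.comp h
  refine h'.congr fun q => ?_
  rw [Function.comp_apply, ← inner_heatSolution, Complex.ofReal_re]

theorem freqPairing_vectorCoeff (hX : IsZeroMeanGaussianField P X)
    (b : HilbertBasis ι ℝ (firstChaos P X)) (χ : 𝓢(ℝ, ℂ)) (ζ : Lp L2Line 2 P) (γ : ι →₀ ℕ) :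
    freqPairing χ (vectorCoeff b ζ γ) = ∫ ω, freqPairing χ (ζ ω) * (chaosVar b γ ω : ℂ) ∂P := by
  have h : ∀ f : L2Line, inner ℝ f (vectorCoeff b ζ γ) = ∫ ω, inner ℝ f (ζ ω) * chaosVar b γ ω ∂P := by
    intro f
    rw [vectorCoeff, ← integral_inner (integrable_chaosVar_smul hX b ζ γ)]
    simp_rw [real_inner_smul_right, mul_comm]
  have hi : ∀ f : L2Line, Integrable (fun ω => inner ℝ f (ζ ω) * chaosVar b γ ω) P := by
    intro f
    refine ((innerSL ℝ f).integrable_comp (integrable_chaosVar_smul hX b ζ γ)).congr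
      (ae_of_all _ fun ω => ?_)
    simp [mul_comm]
  simp_rw [freqPairing_eq_inner, h, ← integral_complex_ofReal]
  rw [← integral_mul_const, ← integral_add (hi _).ofReal ((hi _).ofReal.mul_const _)]
  refine integral_congr_ae (ae_of_all _ fun ω => ?_)
  push_cast
  ring

/-- The averaging has variance 2r(t) and the random shift contributes σ² E X(t)². The total is 2at,
so the deterministic factor is exactly exp(-a(2πy)²t). -/
theorem freqPairing_vectorCoeff_heatSolution (hX : IsZeroMeanGaussianField P X)
    (b : HilbertBasis ι ℝ (firstChaos P X)) {a σ : ℝ} (u₀ : L2Line) {t : ℝ} (ht : t ∈ Icc 0 T)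
    (hr : σ ^ 2 / 2 * secondMoment P X t ≤ a * t) (γ : ι →₀ ℕ) (χ : 𝓢(ℝ, ℂ)) :
    freqPairing χ (vectorCoeff b (heatSolution hX a σ u₀ t) γ)
      = freqCoeff (fun k => kernelFn hX b k) a σ (fun y => χ y * lineFourier u₀ y) γ t := by
  set v := heatVariance P X a σ t with hv
  set h : Lp ℝ 2 P := fieldCLM hX (chi T t) with hh
  have hmem : h ∈ firstChaos P X := fieldCLM_mem_firstChaos hX _
  -- By `hr` the truncation at zero in `heatVariance` is inactive; this identity is where the
  -- condition on a and σ is used.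
  have hvr : (v : ℝ) + σ ^ 2 * ‖h‖ ^ 2 = 2 * a * t := by
    rw [hv, heatVariance, Real.coe_toNNReal _ (by linarith), secondMoment_eq hX]
    ring
  have h1 : freqPairing χ (vectorCoeff b (heatSolution hX a σ u₀ t) γ)
      = ∫ ω, (∫ y : ℝ, heatSymbol (σ * h ω) v y * (chaosVar b γ ω : ℂ)
        * (χ y * lineFourier u₀ y)) ∂P := by
    rw [freqPairing_vectorCoeff hX]
    refine integral_congr_ae ?_
    filter_upwards [coeFn_heatSolution hX a σ u₀ t, assocProcess_ae_eq hX t] with ω h1 h2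
    rw [h1, freqPairing_heatShift, ← integral_mul_const, hh, h2]
    refine integral_congr_ae (ae_of_all _ fun y => ?_)
    simp only
    ring
  have hint : Integrable (fun p : Ω × ℝ => heatSymbol (σ * h p.1) v p.2
      * (chaosVar b γ p.1 : ℂ) * (χ p.2 * lineFourier u₀ p.2)) (P.prod volume) := by
    have a1 := (((memLp_chaosVar hX b γ).integrable one_le_two).ofReal (𝕜 := ℂ)).mul_prod
      (integrable_schwartz_mul χ (lineFourier u₀))
    have hm := aestronglyMeasurable_heatSymbol h σ v
    refine (a1.mono (hm.mul a1.1) (ae_of_all _ fun p => ?_)).congr (ae_of_all _ fun p => ?_)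
    · rw [Pi.mul_apply, norm_mul]
      exact mul_le_of_le_one_left (norm_nonneg _) (norm_heatSymbol_le _ _ _)
    · simp only [Pi.mul_apply]
      exact (mul_assoc _ _ _).symm
  rw [h1, integral_integral_swap (f := fun ω y => heatSymbol (σ * h ω) v y
    * (chaosVar b γ ω : ℂ) * (χ y * lineFourier u₀ y)) hint, freqCoeff]
  refine integral_congr_ae (ae_of_all _ fun y => ?_)
  simp only
  rw [integral_mul_const, integral_heatSymbol_mul_chaosVar hX b hmem, hvr, expPow]
  have hb : (fun k => inner ℝ (b k : Lp ℝ 2 P) h) = fun k => ∫ s in (0 : ℝ)..t, kernelFn hX b k s :=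
    funext fun k => inner_basis_chi hX b k ht
  have he : Complex.exp (-(2 * a * t * (2 * Real.pi * y) ^ 2 / 2 : ℝ))
      = (Real.exp (-a * (2 * Real.pi * y) ^ 2 * t) : ℂ) := by
    push_cast
    congr 1
    ring
  rw [hb, he]
  push_cast
  ring

end ExplicitSolution

end GaussField

namespace GaussField

/-! ### Verification of the explicit solution and well-posedness -/

section ExplicitSolution

open FourierTransform

variable {Ω : Type*} [MeasurableSpace Ω] {P : Measure Ω} {T : ℝ} {X : L2Time T → Ω → ℝ}
  {ι : Type*} [IsProbabilityMeasure P]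

theorem fourierInv_derivCLM (φ : 𝓢(ℝ, ℝ)) :
    𝓕⁻ ((SchwartzMap.derivCLM ℝ ℝ φ).postcompCLM Complex.ofRealCLM)
      = mulVar (-2 * Real.pi * Complex.I) (𝓕⁻ (φ.postcompCLM Complex.ofRealCLM)) := by
  have h : (SchwartzMap.derivCLM ℝ ℝ φ).postcompCLM Complex.ofRealCLM
      = SchwartzMap.derivCLM ℝ ℂ (φ.postcompCLM Complex.ofRealCLM) := by
    ext x
    rw [SchwartzMap.derivCLM_apply]
    exact (Complex.ofRealCLM.hasFDerivAt.comp_hasDerivAt x φ.differentiableAt.hasDerivAt).deriv.symm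
  have h' : SchwartzMap.derivCLM ℝ ℂ (φ.postcompCLM Complex.ofRealCLM)
      = 𝓕 (mulVar (-2 * Real.pi * Complex.I) (𝓕⁻ (φ.postcompCLM Complex.ofRealCLM))) := by
    rw [← derivCLM_fourier, FourierTransform.fourier_fourierInv_eq]
  rw [h, h', FourierTransform.fourierInv_fourier_eq]

omit [IsProbabilityMeasure P] in
theorem intervalIntegral_mem_chaosSpaceOf (hX : IsZeroMeanGaussianField P X) {η : ℝ → Lp ℝ 2 P}
    (hη : Continuous η) (hm : ∀ s, η s ∈ chaosSpaceOf ℝ P X) (t : ℝ) :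
    (∫ s in (0 : ℝ)..t, η s : Lp ℝ 2 P) ∈ chaosSpaceOf ℝ P X := by
  have : Fact (fieldSigma X ≤ ‹MeasurableSpace Ω›) := ⟨fieldSigma_le hX⟩
  -- The chaos space is complete, so the integral can be formed inside it and then included into
  -- L₂(Ω).
  have : CompleteSpace (chaosSpaceOf ℝ P X) :=
    inferInstanceAs (CompleteSpace (lpMeas ℝ ℝ (fieldSigma X) 2 P))
  have hc : Continuous fun s => (⟨η s, hm s⟩ : chaosSpaceOf ℝ P X) := hη.subtype_mk _
  have h := (chaosSpaceOf ℝ P X).subtypeL.intervalIntegral_comp_comm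
    (hc.intervalIntegrable (μ := volume) 0 t)
  simp only [Submodule.subtypeL_apply] at h
  rw [h]
  exact Subtype.coe_prop _

/-- For a ≥ 0 the weight equals 1 and Schwartz decay suffices. Existence must be tested with all
Schwartz functions, whose transforms need not have compact support. -/
theorem freqDecay_of_nonneg {a T : ℝ} (ha : 0 ≤ a) (hT : 0 ≤ T) (χ : 𝓢(ℝ, ℂ)) (f : L2Line) :
    FreqDecay a T fun y => χ y * lineFourier f y := by
  intro n
  have hg : (fun y : ℝ => (y : ℂ) ^ n).HasTemperateGrowth := by fun_prop
  refine (integrable_schwartz_mul (SchwartzMap.smulLeftCLM ℂ (fun y : ℝ => (y : ℂ) ^ n) χ)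
    (lineFourier f)).congr (ae_of_all _ fun y => ?_)
  have h : Real.exp (-a * (2 * Real.pi * y) ^ 2 * T) ≤ 1 := by
    rw [Real.exp_le_one_iff, neg_mul, neg_mul]
    exact neg_nonpos.2 (by positivity)
  simp only
  rw [SchwartzMap.smulLeftCLM_apply_apply hg, max_eq_left h, smul_eq_mul]
  push_cast
  ring

/-- The explicit process solves the equation. -/
theorem isSPDESolution_heatSolution (hX : IsZeroMeanGaussianField P X)
    (b : HilbertBasis ι ℝ (firstChaos P X)) (hT : 0 < T) {a σ : ℝ}
    (hr : ∀ t ∈ Icc 0 T, σ ^ 2 / 2 * secondMoment P X t ≤ a * t) (u₀ : L2Line) :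
    IsSPDESolution b a σ u₀ (heatSolution hX a σ u₀) := by
  classical
  -- The condition at t = T, with a nonnegative second moment, forces a ≥ 0.
  have ha : 0 ≤ a := by
    have h1 := hr T ⟨hT.le, le_rfl⟩
    have h2 : 0 ≤ σ ^ 2 / 2 * secondMoment P X T := by
      rw [secondMoment_eq hX]
      positivity
    exact nonneg_of_mul_nonneg_left (h2.trans h1) hT
  have hc := continuous_heatSolution hX a σ u₀
  have hm := memLp_of_continuous (T := T) hc
  have hmem := heatSolution_mem_chaosSpaceOf hX a σ u₀
  refine ⟨hm, fun t _ => hmem t, fun t ht φ => ⟨(memLp_pairing hm _).const_smul (-σ),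
    ae_of_all _ fun s => Submodule.smul_mem _ _ (compLp_mem_chaosSpaceOf _ (hmem s)), ?_,
    fun γ => ?_⟩⟩
  · refine Submodule.sub_mem _ (Submodule.sub_mem _ (compLp_mem_chaosSpaceOf _ (hmem t))
      (const_mem_chaosSpaceOf _)) (Submodule.smul_mem _ _ (intervalIntegral_mem_chaosSpaceOf hX ?_
      (fun s => compLp_mem_chaosSpaceOf _ (hmem s)) t))
    exact ((innerSL ℝ _).compLpL 2 P).continuous.comp hc
  · rw [chaosCoeff_equation_iff hX b hm ht]
    -- With φ written as the transform of χ, every term is a frequency integral, and the equation at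
    -- γ becomes `freqCoeff_eq`.
    set χ : 𝓢(ℝ, ℂ) := 𝓕⁻ (φ.postcompCLM Complex.ofRealCLM) with hχ
    set c : ℂ := -2 * Real.pi * Complex.I with hc
    have hB : ∀ s ∈ Icc 0 T, ((inner ℝ ((SchwartzMap.derivCLM ℝ ℝ
        (SchwartzMap.derivCLM ℝ ℝ φ)).toLp 2 volume)
          (vectorCoeff b (heatSolution hX a σ u₀ s) γ) : ℝ) : ℂ)
        = freqCoeff (fun k => kernelFn hX b k) a σ
          (fun y => (2 * Real.pi * Complex.I * y) ^ 2 * (χ y * lineFourier u₀ y)) γ s := by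
      intro s hs
      rw [inner_toLp_eq_freqPairing, fourierInv_derivCLM, fourierInv_derivCLM,
        freqPairing_vectorCoeff_heatSolution hX b u₀ hs (hr s hs)]
      congr 1
      funext y
      rw [mulVar_mulVar]
      ring
    have hC : ∀ (k : ι), ∀ s ∈ Icc 0 T, ((kernelFn hX b k s * (-σ * inner ℝ
        ((SchwartzMap.derivCLM ℝ ℝ φ).toLp 2 volume)
          (vectorCoeff b (heatSolution hX a σ u₀ s) (γ - Finsupp.single k 1))) : ℝ) : ℂ)
        = (kernelFn hX b k s : ℂ) * freqCoeff (fun k => kernelFn hX b k) a σ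
          (fun y => (2 * Real.pi * Complex.I * σ * y) ^ 1 * (χ y * lineFourier u₀ y))
            (γ - Finsupp.single k 1) s := by
      intro k s hs
      push_cast
      rw [inner_toLp_eq_freqPairing, fourierInv_derivCLM,
        freqPairing_vectorCoeff_heatSolution hX b u₀ hs (hr s hs), freqCoeff, freqCoeff,
        ← integral_const_mul]
      congr 1
      refine integral_congr_ae (ae_of_all _ fun y => ?_)
      simp only [mulVar_apply]
      ring
    have hsub : uIcc 0 t ⊆ Icc 0 T := by
      rw [uIcc_of_le ht.1]
      exact Icc_subset_Icc_right ht.2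
    apply Complex.ofReal_injective
    push_cast
    simp_rw [← intervalIntegral.integral_ofReal]
    rw [inner_toLp_eq_freqPairing, freqPairing_vectorCoeff_heatSolution hX b u₀ ht (hr t ht),
      freqCoeff_eq (fun k => intervalIntegrable_kernelFn hX b k hT.le) σ
        (aestronglyMeasurable_mul_lineFourier χ u₀) (freqDecay_of_nonneg ha hT.le χ u₀) γ ht]
    congr 1
    · congr 1
      · split_ifs
        · exact (inner_toLp_eq_freqPairing φ u₀).symm
        · simp
      · congr 1
        exact intervalIntegral.integral_congr fun s hs => (hB s (hsub hs)).symm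
    · refine Finset.sum_congr rfl fun k _ => ?_
      congr 1
      exact intervalIntegral.integral_congr fun s hs => (hC k s (hsub hs)).symm

/-- The formula for the solution. -/
theorem solution_ae_eq (hX : IsZeroMeanGaussianField P X)
    (b : HilbertBasis ι ℝ (firstChaos P X)) (hT : 0 < T) {a σ : ℝ}
    (hr : ∀ t ∈ Icc 0 T, σ ^ 2 / 2 * secondMoment P X t ≤ a * t) {u₀ : L2Line}
    {u : ℝ → Lp L2Line 2 P} (hu : IsSPDESolution b a σ u₀ u) {t : ℝ} (ht : t ∈ Icc 0 T) :
    ∀ᵐ ω ∂P, u t ω =ᵐ[volume] fun x => ∫ y, u₀ y ∂(gaussianReal (x + σ * assocProcess X t ω)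
      (Real.toNNReal (2 * (a * t - σ ^ 2 / 2 * secondMoment P X t)))) := by
  rw [solution_unique hX b hu (isSPDESolution_heatSolution hX b hT hr u₀) ht]
  filter_upwards [coeFn_heatSolution hX a σ u₀ t] with ω h
  rw [h]
  exact coeFn_heatShift _ _ _

theorem wellPosed_of_le (hX : IsZeroMeanGaussianField P X)
    (b : HilbertBasis ι ℝ (firstChaos P X)) (hT : 0 < T) {a σ : ℝ}
    (hr : ∀ t ∈ Icc 0 T, σ ^ 2 / 2 * secondMoment P X t ≤ a * t) (D : Set L2Line) :
    WellPosed b a σ D where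
  existence u₀ _ := ⟨_, isSPDESolution_heatSolution hX b hT hr u₀⟩
  uniqueness _ _ _ _ hu hv _ ht := solution_unique hX b hu hv ht
  stability := ⟨1, fun u₀ _ u hu t ht => by
    rw [solution_unique hX b hu (isSPDESolution_heatSolution hX b hT hr u₀) ht, one_mul]
    exact norm_heatSolution_le hX a σ u₀ t⟩

end ExplicitSolution

end GaussField

namespace GaussField

/-! ### Necessity of the condition on the coefficients -/

/-! ### Gaussian decay of the transform against compact support -/

section Uncertainty

open FourierTransform

/-- Square-integrability against a Gaussian weight gives integrability against every exponential:
factor the integrand as AB with AB ≤ A² + B², where B² is dominated by an integrable Gaussian after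
completing the square. -/
theorem integrable_exp_mul_abs_mul {c : ℝ} (hc : 0 < c) {w : ℝ → ℂ} (hw : Continuous w)
    (h : Integrable fun y => Real.exp (c * y ^ 2) * ‖w y‖ ^ 2) (k : ℝ) :
    Integrable fun y => Real.exp (k * |y|) * ‖w y‖ := by
  have h1 := (integrable_exp_neg_mul_sq (b := c / 2) (by positivity)).const_mul
    (Real.exp (2 * k ^ 2 / c))
  refine (h.add h1).mono' (Continuous.aestronglyMeasurable (by fun_prop)) (ae_of_all _ fun y => ?_)
  rw [Real.norm_eq_abs, abs_of_nonneg (by positivity), Pi.add_apply]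
  set A := Real.exp (c * y ^ 2 / 2) * ‖w y‖ with hA
  set B := Real.exp (k * |y| - c * y ^ 2 / 2) with hB
  have e1 : Real.exp (k * |y|) * ‖w y‖ = A * B := by
    rw [hA, hB, mul_right_comm, ← Real.exp_add]
    congr 2
    ring
  have e2 : A ^ 2 = Real.exp (c * y ^ 2) * ‖w y‖ ^ 2 := by
    rw [hA, mul_pow, ← Real.exp_nat_mul]
    congr 2
    push_cast
    ring
  have e3 : B ^ 2 ≤ Real.exp (2 * k ^ 2 / c) * Real.exp (-(c / 2) * y ^ 2) := by
    rw [hB, ← Real.exp_nat_mul, ← Real.exp_add, Real.exp_le_exp]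
    have h2 : 2 * k ^ 2 / c + -(c / 2) * y ^ 2 - ((2 : ℕ) : ℝ) * (k * |y| - c * y ^ 2 / 2)
        = (2 * k - c * |y|) ^ 2 / (2 * c) := by
      field_simp
      push_cast
      rw [← sq_abs y]
      ring
    have h3 : 0 ≤ (2 * k - c * |y|) ^ 2 / (2 * c) := by positivity
    linarith
  rw [e1, ← e2]
  nlinarith [sq_nonneg (A - B), sq_nonneg A, sq_nonneg B]

theorem fourier_iterate_derivCLM (φ : 𝓢(ℝ, ℂ)) (n : ℕ) (y : ℝ) :
    𝓕 ((SchwartzMap.derivCLM ℝ ℂ)^[n] φ) y = (2 * Real.pi * Complex.I * y) ^ n * 𝓕 φ y := by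
  induction n with
  | zero => simp
  | succ n ih =>
    set ψ := (SchwartzMap.derivCLM ℝ ℂ)^[n] φ with hψ
    have h : ((SchwartzMap.derivCLM ℝ ℂ ψ : 𝓢(ℝ, ℂ)) : ℝ → ℂ) = deriv ψ := rfl
    rw [Function.iterate_succ_apply', SchwartzMap.fourier_coe, h,
      Real.fourier_deriv ψ.integrable ψ.differentiable (SchwartzMap.derivCLM ℝ ℂ ψ).integrable,
      ← SchwartzMap.fourier_coe]
    beta_reduce
    rw [ih, smul_eq_mul, pow_succ]
    ring

theorem tsupport_iterate_derivCLM_subset (φ : 𝓢(ℝ, ℂ)) (n : ℕ) :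
    tsupport ((SchwartzMap.derivCLM ℝ ℂ)^[n] φ : 𝓢(ℝ, ℂ)) ⊆ tsupport φ := by
  induction n with
  | zero => rfl
  | succ n ih =>
    rw [Function.iterate_succ_apply']
    exact (SchwartzMap.tsupport_derivCLM_subset ℝ _).trans ih

theorem fourierInv_fourier_apply (φ : 𝓢(ℝ, ℂ)) (x : ℝ) :
    φ x = ∫ y, Complex.exp ((2 * Real.pi * x * y : ℝ) * Complex.I) * 𝓕 φ y := by
  have h : φ = 𝓕⁻ (𝓕 φ : 𝓢(ℝ, ℂ)) := (FourierTransform.fourierInv_fourier_eq φ).symm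
  conv_lhs => rw [h]
  rw [SchwartzMap.fourierInv_coe, Real.fourierInv_eq']
  refine integral_congr_ae (ae_of_all _ fun y => ?_)
  simp only [smul_eq_mul]
  congr 3
  simp
  ring

/-- A compactly supported function whose Fourier transform decays like a Gaussian vanishes. -/
theorem eq_zero_of_hasCompactSupport_of_integrable {φ : 𝓢(ℝ, ℂ)} (hφ : HasCompactSupport φ)
    {c : ℝ} (hc : 0 < c) (h : Integrable fun y => Real.exp (c * y ^ 2) * ‖𝓕 φ y‖ ^ 2) : φ = 0 := by
  have hw : Continuous (𝓕 φ : 𝓢(ℝ, ℂ)) := (𝓕 φ).continuous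
  -- At a point outside the support all derivatives vanish; by Fourier inversion these are the
  -- moments of the transform in `hzero`.
  obtain ⟨x₀, hx₀⟩ : ∃ x₀, x₀ ∉ tsupport φ := by
    by_contra! hall
    exact noncompact_univ ℝ ((eq_univ_of_forall hall) ▸ hφ.isCompact)
  have hzero : ∀ n : ℕ, ∫ y, Complex.exp ((2 * Real.pi * x₀ * y : ℝ) * Complex.I)
      * ((2 * Real.pi * Complex.I * y) ^ n * 𝓕 φ y) = 0 := by
    intro n
    have h1 := fourierInv_fourier_apply ((SchwartzMap.derivCLM ℝ ℂ)^[n] φ) x₀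
    simp_rw [fourier_iterate_derivCLM] at h1
    rw [← h1]
    exact image_eq_zero_of_notMem_tsupport fun hx =>
      hx₀ (tsupport_iterate_derivCLM_subset φ n hx)
  ext x
  rw [fourierInv_fourier_apply φ x]
  set d := x - x₀ with hd
  set F : ℕ → ℝ → ℂ := fun n y => (d : ℂ) ^ n / (Nat.factorial n : ℂ)
    * (Complex.exp ((2 * Real.pi * x₀ * y : ℝ) * Complex.I)
      * ((2 * Real.pi * Complex.I * y) ^ n * 𝓕 φ y)) with hF
  -- Taylor expansion of the inversion formula about x₀, integrated term by term. The absolute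
  -- series sums to e^{2π|d||y|} times the modulus of the transform, integrable for every d, so the
  -- expansion is valid for every x and all its terms vanish.
  have hsum := hasSum_integral_of_dominated_convergence (μ := volume) (F := F)
    (f := fun y => Complex.exp ((2 * Real.pi * x * y : ℝ) * Complex.I) * 𝓕 φ y)
    (fun n y => (2 * Real.pi * |d| * |y|) ^ n / (Nat.factorial n : ℝ) * ‖𝓕 φ y‖)
    (fun n => Continuous.aestronglyMeasurable (by fun_prop))
    (fun n => ae_of_all _ fun y => ?_) (ae_of_all _ fun y => ?_) ?_ (ae_of_all _ fun y => ?_)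
  · have hF0 : ∀ n, ∫ y, F n y = 0 := by
      intro n
      simp only [hF]
      rw [integral_const_mul, hzero n, mul_zero]
    simp_rw [hF0] at hsum
    rw [hsum.unique hasSum_zero]
    rfl
  · refine le_of_eq ?_
    simp only [hF]
    rw [norm_mul, norm_mul, Complex.norm_exp_ofReal_mul_I, norm_mul]
    simp [abs_of_pos Real.pi_pos, mul_pow]
    ring
  · exact (Real.summable_pow_div_factorial _).mul_right _
  · have h1 : ∀ y : ℝ, ∑' n : ℕ, (2 * Real.pi * |d| * |y|) ^ n / (Nat.factorial n : ℝ) * ‖𝓕 φ y‖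
        = Real.exp (2 * Real.pi * |d| * |y|) * ‖𝓕 φ y‖ := by
      intro y
      rw [tsum_mul_right, Real.exp_eq_exp_ℝ, NormedSpace.exp_eq_tsum_div]
    simp_rw [h1]
    exact integrable_exp_mul_abs_mul hc hw h _
  · have h1 := (NormedSpace.expSeries_div_hasSum_exp (2 * Real.pi * Complex.I * y * d)).mul_right
      (Complex.exp ((2 * Real.pi * x₀ * y : ℝ) * Complex.I) * 𝓕 φ y)
    rw [← Complex.exp_eq_exp_ℂ, ← mul_assoc, ← Complex.exp_add] at h1
    have h2 : 2 * Real.pi * Complex.I * y * d + ((2 * Real.pi * x₀ * y : ℝ) : ℂ) * Complex.I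
        = ((2 * Real.pi * x * y : ℝ) : ℂ) * Complex.I := by
      rw [hd]
      push_cast
      ring
    rw [h2] at h1
    refine h1.congr_fun fun n => ?_
    simp only [hF, mul_pow]
    ring

theorem lineFourier_ae_eq_fourier {f : L2Line} {φ : 𝓢(ℝ, ℝ)} (h : f =ᵐ[volume] φ) :
    lineFourier f =ᵐ[volume] (𝓕 (φ.postcompCLM Complex.ofRealCLM) : 𝓢(ℝ, ℂ)) := by
  have h1 : Complex.ofRealCLM.compLp f
      = ((φ.postcompCLM Complex.ofRealCLM : 𝓢(ℝ, ℂ)).toLp 2 volume) := by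
    apply Lp.ext
    filter_upwards [h, Complex.ofRealCLM.coeFn_compLp f,
      (φ.postcompCLM Complex.ofRealCLM : 𝓢(ℝ, ℂ)).coeFn_toLp 2 volume] with x h1 h2 h3
    rw [h2, h3, h1]
    rfl
  rw [lineFourier, h1, SchwartzMap.toLp_fourier_eq]
  exact SchwartzMap.coeFn_toLp _ 2 volume

end Uncertainty

/-! ### From solutions to Gaussian decay of the initial condition -/

section Necessity

open FourierTransform

variable {Ω : Type*} [MeasurableSpace Ω] {P : Measure Ω} {T : ℝ} {X : L2Time T → Ω → ℝ}
  {ι : Type*} [IsProbabilityMeasure P]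

/-- Bessel's inequality and Plancherel bound the box sums of the squared transforms of the
coefficients by ‖u(t)‖². Pointwise in y these sums converge to the stated weighted square, and
Fatou's lemma gives integrability. A finite set s of coordinates suffices for the necessity
argument. -/
theorem integrable_of_solution (hX : IsZeroMeanGaussianField P X)
    (b : HilbertBasis ι ℝ (firstChaos P X)) {a σ : ℝ} {u₀ : L2Line} {u : ℝ → Lp L2Line 2 P}
    (hu : IsSPDESolution b a σ u₀ u) {t : ℝ} (ht : t ∈ Icc 0 T) (s : Finset ι) :
    Integrable fun y => Real.exp ((2 * Real.pi) ^ 2 * (σ ^ 2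
      * (∑ k ∈ s, (∫ r in (0 : ℝ)..t, kernelFn hX b k r) ^ 2) - 2 * a * t) * y ^ 2)
      * ‖lineFourier u₀ y‖ ^ 2 := by
  set m : ι → ℝ := fun k => ∫ r in (0 : ℝ)..t, kernelFn hX b k r with hm
  set G : ℕ → ℝ → ℝ := fun n y => ∑ γ ∈ multiBox s n,
    ‖lineFourier (vectorCoeff b (u t) γ) y‖ ^ 2 with hG
  have hi : ∀ γ, Integrable fun y => ‖lineFourier (vectorCoeff b (u t) γ) y‖ ^ 2 := fun γ =>
    integrable_norm_sq_lineFourier _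
  have hGi : ∀ n, Integrable (G n) := fun n => integrable_finsetSum _ fun γ _ => hi γ
  have hG0 : ∀ n y, 0 ≤ G n y := fun n y => Finset.sum_nonneg fun _ _ => sq_nonneg _
  have hGb : ∀ n, ∫⁻ y, ‖G n y‖ₑ ≤ ENNReal.ofReal (‖u t‖ ^ 2) := by
    intro n
    have h1 : ∫ y, G n y = ∑ γ ∈ multiBox s n, ‖vectorCoeff b (u t) γ‖ ^ 2 := by
      rw [hG, integral_finsetSum _ fun γ _ => hi γ]
      refine Finset.sum_congr rfl fun γ _ => ?_
      have h2 := inner_lineFourier (vectorCoeff b (u t) γ) (vectorCoeff b (u t) γ)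
      rw [real_inner_self_eq_norm_sq, L2.inner_def] at h2
      apply Complex.ofReal_injective
      rw [← h2, ← integral_complex_ofReal]
      refine integral_congr_ae (ae_of_all _ fun y => ?_)
      simp only
      rw [inner_self_eq_norm_sq_to_K]
      simp
    have h3 : ∫⁻ y, ‖G n y‖ₑ = ENNReal.ofReal (∫ y, G n y) := by
      rw [ofReal_integral_eq_lintegral_ofReal (hGi n) (ae_of_all _ (hG0 n))]
      refine lintegral_congr fun y => ?_
      rw [Real.enorm_eq_ofReal (hG0 n y)]
    rw [h3, h1]
    exact ENNReal.ofReal_le_ofReal (sum_norm_vectorCoeff_sq_le hX b (u t) _)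
  refine integrable_of_tendsto (G := G) ?_ (fun n => (hGi n).1) ?_
  · have hae : ∀ᵐ y : ℝ, ∀ n, ∀ γ ∈ multiBox s n, lineFourier (vectorCoeff b (u t) γ) y
        = coeffSymbol (fun k => kernelFn hX b k) a σ γ t y * lineFourier u₀ y := by
      rw [ae_all_iff]
      exact fun n => (Finset.eventually_all _).2 fun γ _ =>
        lineFourier_vectorCoeff_of_solution hX b hu γ ht
    filter_upwards [hae] with y hy
    have h1 : ∀ n, G n y = Real.exp (-2 * a * t * (2 * Real.pi * y) ^ 2) * ‖lineFourier u₀ y‖ ^ 2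
        * ∑ γ ∈ multiBox s n, multiPow (fun k => 2 * Real.pi * σ * y * m k) γ ^ 2 := by
      intro n
      simp only [hG]
      rw [Finset.mul_sum]
      refine Finset.sum_congr rfl fun γ hγ => ?_
      have h2 : Real.exp (-2 * a * t * (2 * Real.pi * y) ^ 2)
          = Real.exp (-a * (2 * Real.pi * y) ^ 2 * t) ^ 2 := by
        rw [← Real.exp_nat_mul]
        congr 1
        push_cast
        ring
      rw [hy n γ hγ, coeffSymbol, expPow, multiPow_const_mul, h2, norm_mul, norm_mul,
        Complex.norm_real, norm_pow]
      have h3 : ‖2 * (Real.pi : ℂ) * Complex.I * σ * y‖ = |2 * Real.pi * σ * y| := by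
        simp [abs_mul]
      rw [h3, Real.norm_eq_abs, ← abs_pow]
      simp only [mul_pow, sq_abs]
      ring
    simp_rw [h1]
    have h4 := (tendsto_sum_multiBox (fun k => 2 * Real.pi * σ * y * m k) s).const_mul
      (Real.exp (-2 * a * t * (2 * Real.pi * y) ^ 2) * ‖lineFourier u₀ y‖ ^ 2)
    have h5 : Real.exp (-2 * a * t * (2 * Real.pi * y) ^ 2) * ‖lineFourier u₀ y‖ ^ 2
        * Real.exp (∑ k ∈ s, (2 * Real.pi * σ * y * m k) ^ 2)
        = Real.exp ((2 * Real.pi) ^ 2 * (σ ^ 2 * (∑ k ∈ s, m k ^ 2) - 2 * a * t) * y ^ 2)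
          * ‖lineFourier u₀ y‖ ^ 2 := by
      rw [mul_right_comm, ← Real.exp_add]
      congr 2
      simp_rw [mul_pow, ← Finset.mul_sum]
      ring
    rwa [h5] at h4
  · refine ne_top_of_le_ne_top ENNReal.ofReal_ne_top
      ((liminf_le_liminf (Eventually.of_forall hGb)).trans (liminf_const _).le)

/-- Smooth compactly supported initial conditions do not admit solutions if the noise is too
strong. -/
theorem le_of_exists_solution (hX : IsZeroMeanGaussianField P X)
    (b : HilbertBasis ι ℝ (firstChaos P X)) {a σ : ℝ}
    (hex : ∀ u₀ ∈ smoothData, ∃ u, IsSPDESolution b a σ u₀ u) {t : ℝ} (ht : t ∈ Icc 0 T) :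
    σ ^ 2 / 2 * secondMoment P X t ≤ a * t := by
  by_contra! hlt
  let φ : ContDiffBump (0 : ℝ) := ⟨1, 2, one_pos, one_lt_two⟩
  set ψ : 𝓢(ℝ, ℝ) := φ.hasCompactSupport.toSchwartzMap φ.contDiff with hψ
  set u₀ : L2Line := ψ.toLp 2 volume with hu₀
  have h0 : u₀ =ᵐ[volume] ψ := ψ.coeFn_toLp 2 volume
  obtain ⟨u, hu⟩ := hex u₀ ⟨φ, φ.contDiff, φ.hasCompactSupport, h0⟩
  have hs := (hasSum_inner_basis_sq b (fieldCLM_mem_firstChaos hX (chi T t))).mul_left (σ ^ 2 / 2)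
  rw [← secondMoment_eq hX] at hs
  -- By Parseval the strict inequality already holds for a finite partial sum of E X(t)²; the
  -- resulting exponent c is positive.
  obtain ⟨s, hs'⟩ := (hs.eventually_const_lt hlt).exists
  rw [← Finset.mul_sum] at hs'
  simp_rw [inner_basis_chi hX b _ ht] at hs'
  set c : ℝ := (2 * Real.pi) ^ 2 * (σ ^ 2
      * (∑ k ∈ s, (∫ r in (0 : ℝ)..t, kernelFn hX b k r) ^ 2) - 2 * a * t) with hc
  have hc0 : 0 < c := by
    rw [hc]
    have : 0 < σ ^ 2 * (∑ k ∈ s, (∫ r in (0 : ℝ)..t, kernelFn hX b k r) ^ 2) - 2 * a * t := by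
      linarith
    positivity
  have hint := integrable_of_solution hX b hu ht s
  rw [← hc] at hint
  have hint' : Integrable fun y => Real.exp (c * y ^ 2)
      * ‖𝓕 (ψ.postcompCLM Complex.ofRealCLM : 𝓢(ℝ, ℂ)) y‖ ^ 2 := by
    refine hint.congr ?_
    filter_upwards [lineFourier_ae_eq_fourier h0] with y hy
    rw [hy]
  have hcs : HasCompactSupport (ψ.postcompCLM Complex.ofRealCLM : 𝓢(ℝ, ℂ)) :=
    φ.hasCompactSupport.comp_left (g := Complex.ofReal) Complex.ofReal_zero
  have hzero := eq_zero_of_hasCompactSupport_of_integrable hcs hc0 hint'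
  have h1 : ((φ 0 : ℝ) : ℂ) = 0 := DFunLike.congr_fun hzero 0
  rw [Complex.ofReal_eq_zero] at h1
  have h2 : φ 0 = 1 := φ.one_of_mem_closedBall (by simp [φ])
  rw [h2] at h1
  exact one_ne_zero h1

theorem tfae_wellPosed (hX : IsZeroMeanGaussianField P X)
    (b : HilbertBasis ι ℝ (firstChaos P X)) (hT : 0 < T) (a σ : ℝ) :
    List.TFAE [
      ∀ u₀ ∈ smoothData, ∃ u, IsSPDESolution b a σ u₀ u,
      WellPosed b a σ smoothData,
      WellPosed b a σ Set.univ,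
      ∀ t ∈ Icc 0 T, a * t ≥ σ ^ 2 / 2 * secondMoment P X t] := by
  tfae_have 1 → 4 := fun h t ht => le_of_exists_solution hX b h ht
  tfae_have 4 → 3 := fun h => wellPosed_of_le hX b hT h _
  tfae_have 3 → 1 := fun h u₀ _ => h.existence u₀ (mem_univ _)
  tfae_have 4 → 2 := fun h => wellPosed_of_le hX b hT h _
  tfae_have 2 → 1 := fun h => h.existence
  tfae_finish

end Necessity

end GaussField

end

/-- The Gaussian law of variance 2r(t) is the heat kernel at time r(t) when r(t) > 0 and a point
mass when r(t) = 0, so one integral covers both cases of the formula for the solution. -/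
theorem mainTheorem5 {Ω : Type*} [MeasurableSpace Ω] (P : Measure Ω) [IsProbabilityMeasure P]
    (T : ℝ) (hT : 0 < T) (X : GaussField.L2Time T → Ω → ℝ)
    (hX : GaussField.IsZeroMeanGaussianField P X)
    {ι : Type*} (b : HilbertBasis ι ℝ (GaussField.firstChaos P X)) :
    ((∃ u : ℝ → Lp ℝ 2 P, ∀ t ∈ Icc 0 T, GaussField.SolvesLinearAt b u t) ∧
      (∀ u : ℝ → Lp ℝ 2 P, (∀ t ∈ Icc 0 T, GaussField.SolvesLinearAt b u t) →
        ∀ t ∈ Icc 0 T, u t =ᵐ[P] fun ω =>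
          Real.exp (GaussField.assocProcess X t ω - 1 / 2 * GaussField.secondMoment P X t)) ∧
      (∀ u : ℝ → Lp ℝ 2 P,
        (∀ᵐ t ∂(GaussField.timeMeasure T), GaussField.SolvesLinearAt b u t) →
        ∀ᵐ t ∂(GaussField.timeMeasure T), u t =ᵐ[P] fun ω =>
          Real.exp (GaussField.assocProcess X t ω - 1 / 2 * GaussField.secondMoment P X t))) ∧
    (∀ a σ : ℝ,
      List.TFAE [
        ∀ u₀ ∈ GaussField.smoothData, ∃ u, GaussField.IsSPDESolution b a σ u₀ u,
        GaussField.WellPosed b a σ GaussField.smoothData,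
        GaussField.WellPosed b a σ Set.univ,
        ∀ t ∈ Icc 0 T, a * t ≥ σ ^ 2 / 2 * GaussField.secondMoment P X t] ∧
      ((∀ t ∈ Icc 0 T, a * t ≥ σ ^ 2 / 2 * GaussField.secondMoment P X t) →
        ∀ (u₀ : GaussField.L2Line) (u : ℝ → Lp GaussField.L2Line 2 P),
          GaussField.IsSPDESolution b a σ u₀ u → ∀ t ∈ Icc 0 T, ∀ᵐ ω ∂P,
            u t ω =ᵐ[volume] fun x => ∫ y, u₀ y ∂(gaussianReal
              (x + σ * GaussField.assocProcess X t ω)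
              (Real.toNNReal (2 * (a * t - σ ^ 2 / 2 * GaussField.secondMoment P X t)))))) :=
  ⟨GaussField.linear_equation hX b, fun a σ =>
    ⟨GaussField.tfae_wellPosed hX b hT a σ, fun h _ _ hu _ ht =>
      GaussField.solution_ae_eq hX b hT h hu ht⟩⟩
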